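/- Let $d\ge 1$, let $(\Omega,\mathcal F,P)$ be a probability space and, for each $n$, let $\mathcal I_n$ be a set with $n$ elements and a metric $\mathbf d:\mathcal I_n\times\mathcal I_n\to[0,\infty]$ such that $\mathbf d(i,j)\ge 1$ for $i\ne j$. Let $X_i$, $i\in\mathcal I_n$, be random vectors in $\mathbb R^d$ (they may depend on $n$), and let $H=H_n:\mathbb R^d\times\mathbb R^d\to\mathbb R$ be measurable and symmetric. For $i\neq j$ write $\tilde X_j$ for a copy of $X_j$ that is independent of $X_i$. Put $\|Y\|_p=(E|Y|^p)^{1/p}$ and - $\mathcal N_i^m=\{j\in\mathcal I_n:\mathbf d(i,j)\le m\}$ and $\eta_m=\max_{i}|\mathcal N_i^m|$; - $\mathbf H_p=\sup_{i\ne j}\max\{\|H(X_i,X_j)\|_p,\|H(X_i,\tilde X_j)\|_p\}$ and $\tilde{\mathbf H}_2=\sup_{i\ne j}\|H(X_i,\tilde X_j)\|_2$; - $\Gamma^{i,j}(x,y)=E[H(X_i,x)H(X_j,y)]$ and $\mathbf\Gamma_{m,p}=\sup\{\|\Gamma^{i,j}(X_{k_1},\tilde X_{k_2})\|_p : i,j,k_1,k_2\in\mathcal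 I_n,\ j\in\mathcal N_i^m,\ \mathbf d(k_1,k_2)>m\}$, where $\tilde X_{k_2}$ is a copy of $X_{k_2}$ that is independent of $X_{k_1}$; - $\beta(m)=\beta(2,\infty,m)=\sup_n\sup\beta\big(\sigma(X_i:i\in I_1),\sigma(X_i:i\in I_2)\big)$, where the inner supremum is over $I_1,I_2\subset\mathcal I_n$ with $|I_1|\le 2$, $I_2$ of any size and $\mathbf d(I_1,I_2)=\inf_{i\in I_1,j\in I_2}\mathbf d(i,j)\ge m$, and where $\beta(\mathcal F_1,\mathcal F_2)=\sup\frac12\sum_{A\in\mathcal A}\sum_{B\in\mathcal B}|P(A\cap B)-P(A)P(B)|$ over finite partitions $\mathcal A\subset\mathcal F_1$, $\mathcal B\subset\mathcal F_2$ of $\Omega$. Assume that $E\,H(X_i,\tilde X_j)^2<\infty$ for all $i\ne j$, and that the kernel is degenerate: for all $i\ne k$, $E\,H(X_k,x)=0$ for almost every $x$ with respect to the law of $X_i$. Let $$S_n=\sum_{i\ne k}H(X_i,X_k),\qquad s_n^2=\operatorname{Var}(S_n),\qquad W_n=s_n^{-1}(S_n-E S_n).$$ Suppose that $s_n=\Theta(n)$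 and that $\tilde{\mathbf H}_2$ is bounded away from $0$ and $\infty$ for all large $n$. Then for every sequence $m=m(n)>0$ and every $\delta>0$ there is a constant $C>0$ such that, for all sufficiently large $n$, $$\mathbf d_W(W_n,N(0,1))\le C\left[\sqrt{n^2\eta_m^2\,\mathbf H_{4+\delta}^4\,\beta(m)^{\delta/(4+\delta)}}+\sqrt{\frac{\eta_m^7+\eta_{4m}^3}{n}\,\mathbf H_4^4}+\sqrt{\eta_m^4\,\mathbf\Gamma_{m,2}^2}\right],$$ where $\mathbf d_W(W,Z)=\sup|E g(W)-E g(Z)|$ over all $1$-Lipschitz functions $g:\mathbb R\to\mathbb R$ (and $0\cdot\infty=0$). -/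

import Mathlib

open MeasureTheory ProbabilityTheory Filter Asymptotics
open scoped ENNReal

noncomputable section

namespace DegenerateUStat

/-- The Wasserstein distance of two laws on the real line: the supremum over all functions `g` that
are Lipschitz with constant one of the distance of the two expectations of `g`. -/
def wassersteinDist (μ ν : Measure ℝ) : ℝ≥0∞ :=
  ⨆ (g : ℝ → ℝ) (_ : LipschitzWith 1 g), ENNReal.ofReal |(∫ x, g x ∂μ) - ∫ x, g x ∂ν|

/-- A finite partition of `Ω`, indexed by `Fin a`, into members of the sigma-algebra `F`. -/
def IsPartition {Ω : Type*} (F : MeasurableSpace Ω) {a : ℕ} (A : Fin a → Set Ω) : Prop :=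
  (∀ i, MeasurableSet[F] (A i)) ∧ Pairwise (fun i j => Disjoint (A i) (A j)) ∧
    (⋃ i, A i) = Set.univ

/-- The beta-mixing coefficient of two sigma-algebras. -/
def betaCoeff {Ω : Type*} [MeasurableSpace Ω] (P : Measure Ω) (F G : MeasurableSpace Ω) : ℝ≥0∞ :=
  ⨆ (a : ℕ) (b : ℕ) (A : Fin a → Set Ω) (B : Fin b → Set Ω)
    (_ : IsPartition F A) (_ : IsPartition G B),
    ENNReal.ofReal
      ((1 / 2) * ∑ i, ∑ j, |P.real (A i ∩ B j) - P.real (A i) * P.real (B j)|)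

section Sample

variable {Ω : Type*} [MeasurableSpace Ω] {d : ℕ} {ι : Type*}

/-- The sigma-algebra generated by the observations with index in `s`. -/
@[reducible] def sigmaOf (X : ι → Ω → EuclideanSpace ℝ (Fin d)) (s : Finset ι) : MeasurableSpace Ω :=
  ⨆ i ∈ s, MeasurableSpace.comap (X i) inferInstance

/-- The distance between two groups of nodes. -/
def groupDist [EMetricSpace ι] (s t : Finset ι) : ℝ≥0∞ :=
  ⨅ i ∈ s, ⨅ j ∈ t, edist i j

/-- The mixing coefficient of one sample: the largest beta-mixing coefficient of two groups of at
most `n₁` and at most `n₂` observations (either may be infinite) at distance at least `m`. -/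
def sampleBeta [EMetricSpace ι] (P : Measure Ω) (X : ι → Ω → EuclideanSpace ℝ (Fin d))
    (n₁ n₂ : ℕ∞) (m : ℝ) : ℝ≥0∞ :=
  ⨆ (s : Finset ι) (t : Finset ι) (_ : (s.card : ℕ∞) ≤ n₁) (_ : (t.card : ℕ∞) ≤ n₂)
    (_ : ENNReal.ofReal m ≤ groupDist s t), betaCoeff P (sigmaOf X s) (sigmaOf X t)

/-- The `m`-neighbourhood of the node `i` (which contains `i`). -/
def nbhd [EMetricSpace ι] (m : ℝ) (i : ι) : Set ι :=
  {j | edist i j ≤ ENNReal.ofReal m}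

/-- The maximal size of an `m`-neighbourhood. -/
def maxNbhd (ι : Type*) [Fintype ι] [EMetricSpace ι] (m : ℝ) : ℕ :=
  Finset.univ.sup fun i : ι => (nbhd m i).ncard

/-- The law of `(X i, X' j)`, where `X' j` is a copy of `X j` that is independent of `X i`. -/
def indepPair (P : Measure Ω) (X : ι → Ω → EuclideanSpace ℝ (Fin d)) (i j : ι) :
    Measure (EuclideanSpace ℝ (Fin d) × EuclideanSpace ℝ (Fin d)) :=
  (P.map (X i)).prod (P.map (X j))

/-- The supremum over `i ≠ j` of the `L^p` norms of `H (X i) (X' j)`, with `X' j` a copy of `X j`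
independent of `X i`. -/
def indepKernelNorm (P : Measure Ω) (X : ι → Ω → EuclideanSpace ℝ (Fin d))
    (H : EuclideanSpace ℝ (Fin d) → EuclideanSpace ℝ (Fin d) → ℝ) (p : ℝ≥0∞) : ℝ≥0∞ :=
  ⨆ (i : ι) (j : ι) (_ : i ≠ j), eLpNorm (Function.uncurry H) p (indepPair P X i j)

/-- The supremum over `i ≠ j` of the `L^p` norms of `H (X i) (X j)` and of `H (X i) (X' j)`, with
`X' j` a copy of `X j` independent of `X i`. -/
def kernelNorm (P : Measure Ω) (X : ι → Ω → EuclideanSpace ℝ (Fin d))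
    (H : EuclideanSpace ℝ (Fin d) → EuclideanSpace ℝ (Fin d) → ℝ) (p : ℝ≥0∞) : ℝ≥0∞ :=
  ⨆ (i : ι) (j : ι) (_ : i ≠ j),
    max (eLpNorm (fun ω => H (X i ω) (X j ω)) p P)
      (eLpNorm (Function.uncurry H) p (indepPair P X i j))

/-- The function `(x, y) ↦ E [H (X i) x * H (X j) y]`. -/
def Gam (P : Measure Ω) (X : ι → Ω → EuclideanSpace ℝ (Fin d))
    (H : EuclideanSpace ℝ (Fin d) → EuclideanSpace ℝ (Fin d) → ℝ) (i j : ι)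
    (x y : EuclideanSpace ℝ (Fin d)) : ℝ :=
  ∫ ω, H (X i ω) x * H (X j ω) y ∂P

/-- The supremum of the `L^p` norms of `Gam i j (X k₁) (X' k₂)`, with `X' k₂` a copy of `X k₂`
independent of `X k₁`, over `j` in the `m`-neighbourhood of `i` and `k₁`, `k₂` at distance greater
than `m`. -/
def gamNorm [EMetricSpace ι] (P : Measure Ω) (X : ι → Ω → EuclideanSpace ℝ (Fin d))
    (H : EuclideanSpace ℝ (Fin d) → EuclideanSpace ℝ (Fin d) → ℝ) (m : ℝ) (p : ℝ≥0∞) : ℝ≥0∞ :=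
  ⨆ (i : ι) (j : ι) (k₁ : ι) (k₂ : ι) (_ : j ∈ nbhd m i) (_ : ENNReal.ofReal m < edist k₁ k₂),
    eLpNorm (Function.uncurry (Gam P X H i j)) p (indepPair P X k₁ k₂)

/-- Degeneracy of the kernel: the function `x ↦ E [H (X k) x]` vanishes almost surely at every
other observation. -/
def IsDegenerate (P : Measure Ω) (X : ι → Ω → EuclideanSpace ℝ (Fin d))
    (H : EuclideanSpace ℝ (Fin d) → EuclideanSpace ℝ (Fin d) → ℝ) : Prop :=
  ∀ i k, i ≠ k → ∀ᵐ x ∂(P.map (X i)), ∫ ω, H (X k ω) x ∂P = 0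

open Classical in
/-- The U-statistic: the sum of `H (X i) (X k)` over all ordered pairs `i ≠ k`. -/
def uStat [Fintype ι] (X : ι → Ω → EuclideanSpace ℝ (Fin d))
    (H : EuclideanSpace ℝ (Fin d) → EuclideanSpace ℝ (Fin d) → ℝ) (ω : Ω) : ℝ :=
  ∑ i, ∑ k ∈ Finset.univ.filter (fun k => k ≠ i), H (X i ω) (X k ω)

/-- The standard deviation of the U-statistic. -/
def sdev [Fintype ι] (P : Measure Ω) (X : ι → Ω → EuclideanSpace ℝ (Fin d))
    (H : EuclideanSpace ℝ (Fin d) → EuclideanSpace ℝ (Fin d) → ℝ) : ℝ :=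
  √(variance (uStat X H) P)

/-- The standardised U-statistic. -/
def stdUStat [Fintype ι] (P : Measure Ω) (X : ι → Ω → EuclideanSpace ℝ (Fin d))
    (H : EuclideanSpace ℝ (Fin d) → EuclideanSpace ℝ (Fin d) → ℝ) (ω : Ω) : ℝ :=
  (uStat X H ω - ∫ ω', uStat X H ω' ∂P) / sdev P X H

end Sample

/-- The mixing coefficient of the array of samples: the supremum over the sample sizes `n` of the
coefficients of the samples. -/
def arrayBeta {Ω : Type*} [MeasurableSpace Ω] {d : ℕ} {I : ℕ → Type*} [∀ n, EMetricSpace (I n)]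
    (P : Measure Ω) (X : ∀ n, I n → Ω → EuclideanSpace ℝ (Fin d)) (n₁ n₂ : ℕ∞) (m : ℝ) : ℝ≥0∞ :=
  ⨆ n, sampleBeta P (X n) n₁ n₂ m

end DegenerateUStat

end

open MeasureTheory ProbabilityTheory Filter Asymptotics
open scoped ENNReal

noncomputable section

namespace DegenerateUStat

/-! The proof is Stein's method for a locally dependent sum, combined with decoupling by mixing.
Call two nodes near when their distance is at most `m`. The statistic splits as `farSum + nearSum`.
The near part has small variance (`variance_nearSum_le`), so the work concerns U = `farSum` = Σ A_i,
where A_i = `rowSum` collects the kernels H(X_i, X_k) with k far from i. For each i write U = B_i +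
D_i, where B_i = `awaySum` uses only nodes far from i. Besides X_i itself, the product A_i f(B_i/s)
involves only observations far from i. Replacing X_i by an independent copy therefore costs only a
power of the mixing coefficient, and afterwards degeneracy makes the expectation zero.

Let f solve Stein's equation with f, f' bounded and f' Lipschitz (`exists_stein_solution`).
Expanding f(B_i/s) around U/s and summing (`abs_stein_exchange_le`) turns E[f'(U/s) - (U/s) f(U/s)]
into E[f'(U/s)(1 - s⁻² Σ A_i D_i)] plus a third-order remainder in A_i D_i². By symmetry of the
kernel, Σ A_i D_i = 2Q - Σ A_i R_i, where Q = `quadSum` sums A_i A_j over near i, j, and R_i =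
`localSum` is local and small. The same decoupling gives E U² ≈ 2 E Q, hence s² ≈ 2 E Q. The
distance is thus governed by the standard deviation of Q and by the moments of A_i and D_i.

All these moments are expectations of products of kernels over a finite set of vertices. They are
treated uniformly by `labelLaw` and `labelInt`: each vertex carries a label telling from which
independent copy of the sample it is drawn. Moving a group of at most two nodes that is far from the
rest of its copy into a fresh copy changes the integral little (`enorm_labelInt_sub_le`), and a
vertex alone in its copy makes it vanish (`labelInt_eq_zero`). So a vertex without near vertices
leaves only a mixing error. The remaining configurations are counted through their proximity graph
(`exists_grown_of_noIsolated`, `card_noIsolated_le`, `card_noIsolated_hasFork_le`).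

For Var Q there are eight vertices. A graph with no isolated vertex that is not a perfect matching
has at most three components, which yields n³η⁵ configurations, each bounded by fourth moments. In a
perfect matching (`abs_labelInt_sub_split_le`), either no edge joins the two factors of the
covariance, and both terms agree up to mixing errors, or two edges do, and decoupling leaves a
product of two `Gam` functions. The latter configurations number at most (nη)⁴ and produce the term
with `gamNorm`.

With s at least of order n, `exists_rate_const` checks that every error is a multiple of the rate.
The power η⁷ comes from the third-order remainder. Second moments of far kernels are compared with
those at independent copies, which stay bounded; this keeps a further factor of the fourth-moment
norm out of that remainder. -/

/-- Two measures are within `β` of one another, uniformly over the measurable sets. -/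
def TVClose {α : Type*} [MeasurableSpace α] (μ ν : Measure α) (β : ℝ≥0∞) : Prop :=
  ∀ E, MeasurableSet E → μ E ≤ ν E + β ∧ ν E ≤ μ E + β

/-! ### Uniform closeness of measures and integrals of functions with moments -/

section TotalVariation

variable {α : Type*} [MeasurableSpace α] {μ ν : Measure α} {β : ℝ≥0∞}

/-- Both measures have mass one, so the bound on a complement is the reverse inequality. -/
lemma TVClose.of_le [IsProbabilityMeasure μ] [IsProbabilityMeasure ν]
    (h : ∀ E, MeasurableSet E → μ E ≤ ν E + β) : TVClose μ ν β := by
  intro E hE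
  refine ⟨h E hE, ?_⟩
  have h1 := h Eᶜ hE.compl
  rw [prob_compl_eq_one_sub hE, prob_compl_eq_one_sub hE] at h1
  have h2 : 1 ≤ (1 - ν E + β) + μ E := tsub_le_iff_right.mp h1
  have h3 : ν E + (1 - ν E) = 1 := add_tsub_cancel_of_le prob_le_one
  have h4 : ν E + (1 - ν E) ≤ (μ E + β) + (1 - ν E) := by
    rw [h3]
    refine h2.trans (le_of_eq (by ring))
  exact (ENNReal.add_le_add_iff_right (ne_top_of_le_ne_top ENNReal.one_ne_top tsub_le_self)).mp h4

/-- Hölder against the constant function: the small total mass supplies the power of `β`, and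
domination by `μ` supplies the moment. -/
lemma enorm_integral_le_of_measure_univ_le {lam : Measure α} {f : α → ℝ} (hf : Measurable f)
    {p : ℝ} (hp : 1 ≤ p) {M : ℝ≥0∞} (hle : lam ≤ μ) (huniv : lam Set.univ ≤ β)
    (hM : eLpNorm f (ENNReal.ofReal p) μ ≤ M) :
    ‖∫ x, f x ∂lam‖ₑ ≤ β ^ (1 - 1 / p) * M := by
  have hp1 : (1 : ℝ≥0∞) ≤ ENNReal.ofReal p := by simpa using hp
  calc ‖∫ x, f x ∂lam‖ₑ ≤ eLpNorm f 1 lam := by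
        rw [eLpNorm_one_eq_lintegral_enorm]; exact enorm_integral_le_lintegral_enorm f
    _ ≤ eLpNorm f (ENNReal.ofReal p) lam * lam Set.univ ^ (1 / (1 : ℝ≥0∞).toReal
          - 1 / (ENNReal.ofReal p).toReal) :=
        eLpNorm_le_eLpNorm_mul_rpow_measure_univ hp1 hf.aestronglyMeasurable
    _ ≤ M * β ^ (1 - 1 / p) := by
        rw [ENNReal.toReal_ofReal (by linarith)]
        simp only [ENNReal.toReal_one, div_one]
        refine mul_le_mul' ((eLpNorm_mono_measure f hle).trans hM)
          (ENNReal.rpow_le_rpow huniv ?_)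
        have : 1 / p ≤ 1 := by rw [div_le_one (by linarith)]; exact hp
        linarith
    _ = β ^ (1 - 1 / p) * M := mul_comm _ _

/-- Uniform closeness on sets gives closeness of the integrals of functions with a bounded moment. -/
lemma TVClose.enorm_integral_sub_le [IsFiniteMeasure μ] [IsFiniteMeasure ν]
    (h : TVClose μ ν β) {f : α → ℝ} (hf : Measurable f) {p : ℝ} (hp : 1 ≤ p) {M : ℝ≥0∞}
    (hμ : eLpNorm f (ENNReal.ofReal p) μ ≤ M) (hν : eLpNorm f (ENNReal.ofReal p) ν ≤ M) :
    ‖∫ x, f x ∂μ - ∫ x, f x ∂ν‖ₑ ≤ 2 * (β ^ (1 - 1 / p) * M) := by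
  have hp0 : 0 ≤ 1 - 1 / p := by
    have : 1 / p ≤ 1 := by rw [div_le_one (by linarith)]; exact hp
    linarith
  -- With an infinite moment the bound is infinite unless `β` vanishes, in which case the two
  -- measures coincide. This is the convention 0 · ∞ = 0.
  by_cases hMtop : M = ⊤
  · by_cases hz : β ^ (1 - 1 / p) = 0
    · have hβ : β = 0 := by
        rcases ENNReal.rpow_eq_zero_iff.mp hz with ⟨h1, -⟩ | ⟨-, h2⟩
        · exact h1
        · linarith
      have : μ = ν := by
        ext E hE
        have := h E hE
        simp only [hβ, add_zero] at this
        exact le_antisymm this.1 this.2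
      simp [this]
    · rw [hMtop, ENNReal.mul_top hz]; simp
  have hp1 : (1 : ℝ≥0∞) ≤ ENNReal.ofReal p := by simpa using hp
  have hiμ : Integrable f μ := by
    rw [← memLp_one_iff_integrable]
    exact MemLp.mono_exponent ⟨hf.aestronglyMeasurable, lt_of_le_of_lt hμ (lt_top_iff_ne_top.mpr hMtop)⟩ hp1
  have hiν : Integrable f ν := by
    rw [← memLp_one_iff_integrable]
    exact MemLp.mono_exponent ⟨hf.aestronglyMeasurable, lt_of_le_of_lt hν (lt_top_iff_ne_top.mpr hMtop)⟩ hp1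
  -- On each half of a Hahn decomposition one measure dominates the other. Each excess is a positive
  -- measure of mass at most `β`, lying below `μ` or `ν`, so the previous lemma applies to both.
  obtain ⟨s, hs, h1, h2⟩ := hahn_decomposition μ ν
  have le1 : ν.restrict s ≤ μ.restrict s := by
    refine Measure.le_iff.mpr fun t ht => ?_
    rw [Measure.restrict_apply ht, Measure.restrict_apply ht]
    exact h1 _ (ht.inter hs) Set.inter_subset_right
  have le2 : μ.restrict sᶜ ≤ ν.restrict sᶜ := by
    refine Measure.le_iff.mpr fun t ht => ?_
    rw [Measure.restrict_apply ht, Measure.restrict_apply ht]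
    exact h2 _ (ht.inter hs.compl) Set.inter_subset_right
  have e1 : (μ.restrict s - ν.restrict s) + ν.restrict s = μ.restrict s :=
    Measure.sub_add_cancel_of_le le1
  have e2 : (ν.restrict sᶜ - μ.restrict sᶜ) + μ.restrict sᶜ = ν.restrict sᶜ :=
    Measure.sub_add_cancel_of_le le2
  have l1 : μ.restrict s - ν.restrict s ≤ μ := Measure.sub_le.trans Measure.restrict_le_self
  have l2 : ν.restrict sᶜ - μ.restrict sᶜ ≤ ν := Measure.sub_le.trans Measure.restrict_le_self
  have u1 : (μ.restrict s - ν.restrict s) Set.univ ≤ β := by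
    rw [Measure.sub_apply MeasurableSet.univ le1]
    simp only [Measure.restrict_apply MeasurableSet.univ, Set.univ_inter]
    rw [tsub_le_iff_left]
    exact (h s hs).1
  have u2 : (ν.restrict sᶜ - μ.restrict sᶜ) Set.univ ≤ β := by
    rw [Measure.sub_apply MeasurableSet.univ le2]
    simp only [Measure.restrict_apply MeasurableSet.univ, Set.univ_inter]
    rw [tsub_le_iff_left]
    exact (h sᶜ hs.compl).2
  have key : ∫ x, f x ∂μ - ∫ x, f x ∂ν
      = ∫ x, f x ∂(μ.restrict s - ν.restrict s) - ∫ x, f x ∂(ν.restrict sᶜ - μ.restrict sᶜ) := by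
    have a1 := integral_add_compl hs hiμ
    have a2 := integral_add_compl hs hiν
    have a3 : ∫ x in s, f x ∂μ = ∫ x, f x ∂(μ.restrict s - ν.restrict s) + ∫ x in s, f x ∂ν := by
      rw [← integral_add_measure (hiμ.mono_measure l1) hiν.restrict, e1]
    have a4 : ∫ x in sᶜ, f x ∂ν
        = ∫ x, f x ∂(ν.restrict sᶜ - μ.restrict sᶜ) + ∫ x in sᶜ, f x ∂μ := by
      rw [← integral_add_measure (hiν.mono_measure l2) hiμ.restrict, e2]
    linarith
  rw [key]
  refine enorm_sub_le.trans ?_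
  rw [two_mul]
  exact add_le_add (enorm_integral_le_of_measure_univ_le hf hp l1 u1 hμ)
    (enorm_integral_le_of_measure_univ_le hf hp l2 u2 hν)

end TotalVariation

/-! ### The mixing coefficient as a total variation distance -/

section Mixing

variable {Ω : Type*} {F G : MeasurableSpace Ω} [mΩ : MeasurableSpace Ω] {S T : Type*}
  [MeasurableSpace S] [MeasurableSpace T]

/-- The sets of a product that are described by finitely many measurable cells in each factor. -/
def cellAlgebra (S T : Type*) [MeasurableSpace S] [MeasurableSpace T] : Set (Set (S × T)) :=
  {E | ∃ (a b : ℕ) (φ : S → Fin a) (ψ : T → Fin b) (J : Set (Fin a × Fin b)),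
    Measurable φ ∧ Measurable ψ ∧ E = {z | (φ z.1, ψ z.2) ∈ J}}

lemma isSetAlgebra_cellAlgebra : IsSetAlgebra (cellAlgebra S T) where
  empty_mem := ⟨1, 1, fun _ => 0, fun _ => 0, ∅, measurable_const, measurable_const, by simp⟩
  compl_mem := by
    rintro _ ⟨a, b, φ, ψ, J, h1, h2, rfl⟩
    exact ⟨a, b, φ, ψ, Jᶜ, h1, h2, rfl⟩
  union_mem := by
    rintro _ _ ⟨a, b, φ, ψ, J, h1, h2, rfl⟩ ⟨a', b', φ', ψ', J', h1', h2', rfl⟩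
    -- The common refinement of the two partitions describes both sets at once.
    refine ⟨a * a', b * b', fun x => finProdFinEquiv (φ x, φ' x),
      fun y => finProdFinEquiv (ψ y, ψ' y),
      {w | ((finProdFinEquiv.symm w.1).1, (finProdFinEquiv.symm w.2).1) ∈ J ∨
        ((finProdFinEquiv.symm w.1).2, (finProdFinEquiv.symm w.2).2) ∈ J'},
      (measurable_of_finite _).comp (h1.prodMk h1'),
      (measurable_of_finite _).comp (h2.prodMk h2'), ?_⟩
    ext z
    simp only [Set.mem_union, Set.mem_ofPred_eq, Equiv.symm_apply_apply]

lemma generateFrom_cellAlgebra :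
    (inferInstance : MeasurableSpace (S × T)) = MeasurableSpace.generateFrom (cellAlgebra S T) := by
  apply le_antisymm
  · rw [← generateFrom_prod]
    apply MeasurableSpace.generateFrom_mono
    rintro _ ⟨A, hA, B, hB, rfl⟩
    classical
    refine ⟨2, 2, fun x => if x ∈ A then 1 else 0, fun y => if y ∈ B then 1 else 0, {(1, 1)},
      Measurable.ite hA measurable_const measurable_const,
      Measurable.ite hB measurable_const measurable_const, ?_⟩
    ext z
    by_cases h1 : z.1 ∈ A <;> by_cases h2 : z.2 ∈ B <;> simp [h1, h2]
  · apply MeasurableSpace.generateFrom_le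
    rintro _ ⟨a, b, φ, ψ, J, h1, h2, rfl⟩
    have : Measurable fun z : S × T => (φ z.1, ψ z.2) :=
      (h1.comp measurable_fst).prodMk (h2.comp measurable_snd)
    exact this (Set.toFinite J).measurableSet

/-- A partial sum is at most the sum of the positive parts, which for a family of total zero is half
the sum of the absolute values. -/
lemma sum_le_half_sum_abs {γ : Type*} [Fintype γ] [DecidableEq γ] (f : γ → ℝ) (h : ∑ c, f c = 0)
    (J : Finset γ) : ∑ c ∈ J, f c ≤ (1 / 2) * ∑ c, |f c| := by
  have h1 : ∑ c ∈ J, f c ≤ ∑ c ∈ J, (f c + |f c|) / 2 :=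
    Finset.sum_le_sum fun c _ => by linarith [le_abs_self (f c)]
  have h2 : ∑ c ∈ J, (f c + |f c|) / 2 ≤ ∑ c, (f c + |f c|) / 2 :=
    Finset.sum_le_sum_of_subset_of_nonneg (Finset.subset_univ _) fun c _ _ => by
      linarith [neg_abs_le (f c)]
  have h3 : ∑ c, (f c + |f c|) / 2 = (1 / 2) * ∑ c, |f c| := by
    rw [← Finset.sum_div, Finset.sum_add_distrib, h]; ring
  linarith

lemma measureReal_eq_sum_cells {α γ : Type*} [MeasurableSpace α] [Fintype γ] [MeasurableSpace γ]
    [MeasurableSingletonClass γ] (μ : Measure α) [IsFiniteMeasure μ] (κ : α → γ) (hκ : Measurable κ)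
    (J : Finset γ) : μ.real (κ ⁻¹' J) = ∑ c ∈ J, μ.real (κ ⁻¹' {c}) := by
  classical
  have : κ ⁻¹' (J : Set γ) = ⋃ c ∈ J, κ ⁻¹' {c} := by ext x; simp
  rw [this, measureReal_biUnion_finset]
  · intro c _ c' _ hcc
    exact Disjoint.preimage _ (by simpa using hcc)
  · intro c _
    exact hκ (measurableSet_singleton c)

/-- On a union of product cells the difference of joint and product measure is a partial sum of an
array of total zero. Half its absolute sum is exactly the expression maximised in `betaCoeff`. -/
lemma measure_cell_le (P : Measure Ω) [IsProbabilityMeasure P]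
    {U : Ω → S} {V : Ω → T} (hU : Measurable U) (hV : Measurable V)
    (hUF : Measurable[F] U) (hVG : Measurable[G] V) {E : Set (S × T)} (hE : E ∈ cellAlgebra S T) :
    P.map (fun ω => (U ω, V ω)) E ≤ ((P.map U).prod (P.map V)) E + betaCoeff P F G := by
  classical
  obtain ⟨a, b, φ, ψ, J, h1, h2, rfl⟩ := hE
  have := Measure.isProbabilityMeasure_map (μ := P) hU.aemeasurable
  have := Measure.isProbabilityMeasure_map (μ := P) hV.aemeasurable
  have hκ : Measurable fun z : S × T => (φ z.1, ψ z.2) :=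
    (h1.comp measurable_fst).prodMk (h2.comp measurable_snd)
  set A : Fin a → Set Ω := fun i => (φ ∘ U) ⁻¹' {i} with hA
  set B : Fin b → Set Ω := fun i => (ψ ∘ V) ⁻¹' {i} with hB
  have pA : IsPartition F A := by
    refine ⟨fun i => ?_, fun i j hij => Disjoint.preimage _ (by simpa using hij), ?_⟩
    · exact (h1.comp hUF) (measurableSet_singleton i)
    · ext x; simp [hA]
  have pB : IsPartition G B := by
    refine ⟨fun i => ?_, fun i j hij => Disjoint.preimage _ (by simpa using hij), ?_⟩
    · exact (h2.comp hVG) (measurableSet_singleton i)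
    · ext x; simp [hB]
  set d : Fin a × Fin b → ℝ := fun c => P.real (A c.1 ∩ B c.2) - P.real (A c.1) * P.real (B c.2)
  have hle : ENNReal.ofReal ((1 / 2) * ∑ c, |d c|) ≤ betaCoeff P F G := by
    rw [Fintype.sum_prod_type]
    exact le_iSup_of_le a <| le_iSup_of_le b <| le_iSup_of_le A <| le_iSup_of_le B <|
      le_iSup_of_le pA <| le_iSup_of_le pB le_rfl
  set μ := P.map (fun ω => (U ω, V ω))
  set ν := (P.map U).prod (P.map V)
  have : IsProbabilityMeasure μ :=
    Measure.isProbabilityMeasure_map (hU.prodMk hV).aemeasurable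
  have hμc : ∀ c : Fin a × Fin b, μ.real ((fun z : S × T => (φ z.1, ψ z.2)) ⁻¹' {c})
      = P.real (A c.1 ∩ B c.2) := by
    intro c
    rw [map_measureReal_apply (hU.prodMk hV) (hκ (measurableSet_singleton c))]
    congr 1
    ext ω
    simp [hA, hB, Prod.ext_iff]
  have hνc : ∀ c : Fin a × Fin b, ν.real ((fun z : S × T => (φ z.1, ψ z.2)) ⁻¹' {c})
      = P.real (A c.1) * P.real (B c.2) := by
    intro c
    have : (fun z : S × T => (φ z.1, ψ z.2)) ⁻¹' {c} = (φ ⁻¹' {c.1}) ×ˢ (ψ ⁻¹' {c.2}) := by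
      ext z; simp [Prod.ext_iff]
    rw [this, measureReal_prod_prod, map_measureReal_apply hU (h1 (measurableSet_singleton _)),
      map_measureReal_apply hV (h2 (measurableSet_singleton _))]
    rfl
  have hJ : {z : S × T | (φ z.1, ψ z.2) ∈ J}
      = (fun z : S × T => (φ z.1, ψ z.2)) ⁻¹' (J.toFinset : Set (Fin a × Fin b)) := by
    ext z; simp
  have hdiff : ∀ K : Finset (Fin a × Fin b),
      μ.real ((fun z : S × T => (φ z.1, ψ z.2)) ⁻¹' K)
        - ν.real ((fun z : S × T => (φ z.1, ψ z.2)) ⁻¹' K) = ∑ c ∈ K, d c := by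
    intro K
    rw [measureReal_eq_sum_cells μ _ hκ K, measureReal_eq_sum_cells ν _ hκ K,
      ← Finset.sum_sub_distrib]
    exact Finset.sum_congr rfl fun c _ => by rw [hμc, hνc]
  have hzero : ∑ c, d c = 0 := by
    rw [← hdiff Finset.univ]; simp
  have hfin := sum_le_half_sum_abs d hzero J.toFinset
  rw [← hdiff, ← hJ] at hfin
  have hmain : μ.real {z : S × T | (φ z.1, ψ z.2) ∈ J}
      ≤ ν.real {z : S × T | (φ z.1, ψ z.2) ∈ J} + (1 / 2) * ∑ c, |d c| := by linarith
  have h0 : 0 ≤ (1 / 2) * ∑ c, |d c| := by positivity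
  calc μ {z : S × T | (φ z.1, ψ z.2) ∈ J}
      = ENNReal.ofReal (μ.real {z : S × T | (φ z.1, ψ z.2) ∈ J}) := (ofReal_measureReal).symm
    _ ≤ ENNReal.ofReal (ν.real {z : S × T | (φ z.1, ψ z.2) ∈ J} + (1 / 2) * ∑ c, |d c|) :=
        ENNReal.ofReal_le_ofReal hmain
    _ = ν {z : S × T | (φ z.1, ψ z.2) ∈ J} + ENNReal.ofReal ((1 / 2) * ∑ c, |d c|) := by
        rw [ENNReal.ofReal_add measureReal_nonneg h0, ofReal_measureReal]
    _ ≤ _ := by gcongr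

/-- The beta-mixing coefficient bounds the distance of a joint law from the product law. -/
lemma tvClose_map_prod (P : Measure Ω) [IsProbabilityMeasure P]
    {U : Ω → S} {V : Ω → T} (hU : Measurable U) (hV : Measurable V)
    (hUF : Measurable[F] U) (hVG : Measurable[G] V) {β : ℝ≥0∞} (hβ : betaCoeff P F G ≤ β) :
    TVClose (P.map (fun ω => (U ω, V ω))) ((P.map U).prod (P.map V)) β := by
  have := Measure.isProbabilityMeasure_map (μ := P) hU.aemeasurable
  have := Measure.isProbabilityMeasure_map (μ := P) hV.aemeasurable
  have : IsProbabilityMeasure (P.map (fun ω => (U ω, V ω))) :=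
    Measure.isProbabilityMeasure_map (hU.prodMk hV).aemeasurable
  apply TVClose.of_le
  intro E hE
  set μ := P.map (fun ω => (U ω, V ω))
  set ν := (P.map U).prod (P.map V)
  -- Density with respect to the sum of the two laws gives one approximating set that is good for
  -- both.
  have hd := Measure.MeasureDense.of_generateFrom_isSetAlgebra_finite (μ + ν)
    (isSetAlgebra_cellAlgebra (S := S) (T := T)) generateFrom_cellAlgebra
  apply ENNReal.le_of_forall_pos_le_add
  intro ε hε _
  obtain ⟨E', hE', hlt⟩ := hd.approx E hE (measure_ne_top _ _) (ε : ℝ) (by exact_mod_cast hε)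
  rw [ENNReal.ofReal_coe_nnreal, Measure.add_apply] at hlt
  have hc := (measure_cell_le P hU hV hUF hVG hE').trans (add_le_add_right hβ _)
  have e1 : E ⊆ E' ∪ symmDiff E E' := by
    intro x hx
    by_cases h : x ∈ E'
    · exact Or.inl h
    · exact Or.inr (Or.inl ⟨hx, h⟩)
  have e2 : E' ⊆ E ∪ symmDiff E E' := by
    intro x hx
    by_cases h : x ∈ E
    · exact Or.inl h
    · exact Or.inr (Or.inr ⟨hx, h⟩)
  calc μ E ≤ μ E' + μ (symmDiff E E') := (measure_mono e1).trans (measure_union_le _ _)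
    _ ≤ (ν E' + β) + μ (symmDiff E E') := by gcongr
    _ ≤ ((ν E + ν (symmDiff E E')) + β) + μ (symmDiff E E') := by
        gcongr; exact (measure_mono e2).trans (measure_union_le _ _)
    _ = ν E + β + (μ (symmDiff E E') + ν (symmDiff E E')) := by ring
    _ ≤ ν E + β + ε := by gcongr

lemma IsPartition.sum_measureReal_inter {P : Measure Ω} [IsProbabilityMeasure P]
    (hF : F ≤ mΩ) {a : ℕ} {A : Fin a → Set Ω}
    (hA : IsPartition F A) {B : Set Ω} (hB : MeasurableSet B) :
    ∑ i, P.real (A i ∩ B) = P.real B := by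
  have h1 : ⋃ i, (A i ∩ B) = B := by rw [← Set.iUnion_inter, hA.2.2, Set.univ_inter]
  conv_rhs => rw [← h1]
  rw [measureReal_iUnion_fintype]
  · intro i j hij
    exact (hA.2.1 hij).mono Set.inter_subset_left Set.inter_subset_left
  · exact fun i => (hF _ (hA.1 i)).inter hB

/-- Needed when powers of the coefficient with different exponents are compared. -/
lemma betaCoeff_le_one (P : Measure Ω) [IsProbabilityMeasure P]
    (hF : F ≤ mΩ) (hG : G ≤ mΩ) : betaCoeff P F G ≤ 1 := by
  refine iSup_le fun a => iSup_le fun b => iSup_le fun A => iSup_le fun B => iSup_le fun hA =>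
    iSup_le fun hB => ?_
  have hsA : ∑ i, P.real (A i) = 1 := by
    simpa using hA.sum_measureReal_inter (P := P) hF MeasurableSet.univ
  have hsB : ∑ i, P.real (B i) = 1 := by
    simpa using hB.sum_measureReal_inter (P := P) hG MeasurableSet.univ
  have h1 : ∑ i, ∑ j, |P.real (A i ∩ B j) - P.real (A i) * P.real (B j)|
      ≤ ∑ i, ∑ j, (P.real (B j ∩ A i) + P.real (A i) * P.real (B j)) := by
    refine Finset.sum_le_sum fun i _ => Finset.sum_le_sum fun j _ => ?_
    rw [Set.inter_comm (B j)]
    refine (abs_sub _ _).trans (le_of_eq ?_)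
    rw [abs_of_nonneg measureReal_nonneg, abs_of_nonneg (by positivity)]
  have h2 : ∑ i, ∑ j, (P.real (B j ∩ A i) + P.real (A i) * P.real (B j)) = 2 := by
    simp_rw [Finset.sum_add_distrib, ← Finset.mul_sum, hsB, mul_one,
      hB.sum_measureReal_inter (P := P) hG (hF _ (hA.1 _)), hsA]
    norm_num
  rw [ENNReal.ofReal_le_one]
  linarith

end Mixing

/-! ### Stein's equation for Lipschitz test functions -/

section Stein

open Real Topology

lemma hasDerivAt_exp_neg_sq_half (x : ℝ) :
    HasDerivAt (fun x : ℝ => exp (-x ^ 2 / 2)) (-x * exp (-x ^ 2 / 2)) x := by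
  have h : HasDerivAt (fun x : ℝ => -x ^ 2 / 2) (-x) x := by
    have : HasDerivAt (fun x : ℝ => -x ^ 2 / 2) _ x := ((hasDerivAt_pow 2 x).neg).div_const 2
    exact this.congr_deriv (by simp; ring)
  exact h.exp.congr_deriv (by ring)

/-- Comparison for the equation `y' = x y + r` on the half line. -/
lemma le_of_stein_ode {y r q q' : ℝ → ℝ} (hy : ∀ x, 0 ≤ x → HasDerivAt y (x * y x + r x) x)
    (hq : ∀ x, 0 ≤ x → HasDerivAt q (q' x) x) (hr : ∀ x, 0 ≤ x → |r x| ≤ x * q x - q' x)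
    (hy0 : Tendsto (fun x => exp (-x ^ 2 / 2) * y x) atTop (𝓝 0))
    (hq0 : Tendsto (fun x => exp (-x ^ 2 / 2) * q x) atTop (𝓝 0)) {x : ℝ} (hx : 0 ≤ x) :
    y x ≤ q x := by
  set D : ℝ → ℝ := fun x => exp (-x ^ 2 / 2) * y x - exp (-x ^ 2 / 2) * q x with hD
  have hderiv : ∀ t, 0 ≤ t → HasDerivAt D (exp (-t ^ 2 / 2) * (r t + (t * q t - q' t))) t := by
    intro t ht
    have h1 := (hasDerivAt_exp_neg_sq_half t).mul (hy t ht)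
    have h2 := (hasDerivAt_exp_neg_sq_half t).mul (hq t ht)
    exact (h1.sub h2).congr_deriv (by ring)
  have hmono : MonotoneOn D (Set.Ici 0) := by
    apply monotoneOn_of_deriv_nonneg (convex_Ici 0)
    · exact fun t ht => (hderiv t ht).continuousAt.continuousWithinAt
    · intro t ht
      rw [interior_Ici] at ht
      exact (hderiv t (le_of_lt ht)).differentiableAt.differentiableWithinAt
    · intro t ht
      rw [interior_Ici] at ht
      rw [(hderiv t (le_of_lt ht)).deriv]
      have := hr t (le_of_lt ht)
      have := neg_abs_le (r t)
      exact mul_nonneg (exp_pos _).le (by linarith)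
  have hlim : Tendsto D atTop (𝓝 0) := by simpa using hy0.sub hq0
  have hle : D x ≤ 0 := by
    refine ge_of_tendsto hlim ?_
    filter_upwards [eventually_ge_atTop x] with t ht
    exact hmono hx (hx.trans ht) ht
  have h3 : exp (-x ^ 2 / 2) * (y x - q x) ≤ 0 := by simpa [hD, mul_sub] using hle
  have h4 := nonpos_of_mul_nonpos_right h3 (exp_pos _)
  linarith

/-- The one-sided comparison is applied to y and -y on the right half line, and after reflecting the
variable on the left one. These operations preserve the form of the equation and the size of its
inhomogeneity. -/
lemma abs_le_of_stein_ode {y r q q' : ℝ → ℝ} (hy : ∀ x, HasDerivAt y (x * y x + r x) x)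
    (hq : ∀ x, 0 ≤ x → HasDerivAt q (q' x) x) (hr : ∀ x, |r x| ≤ |x| * q |x| - q' |x|)
    (hy0 : Tendsto (fun x => exp (-x ^ 2 / 2) * y x) atTop (𝓝 0))
    (hy1 : Tendsto (fun x => exp (-x ^ 2 / 2) * y x) atBot (𝓝 0))
    (hq0 : Tendsto (fun x => exp (-x ^ 2 / 2) * q x) atTop (𝓝 0)) (x : ℝ) :
    |y x| ≤ q |x| := by
  have hrefl : ∀ x, HasDerivAt (fun t => -y (-t)) (x * (-y (-x)) + r (-x)) x := by
    intro x
    have h := ((hy (-x)).comp x (hasDerivAt_neg x)).neg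
    exact h.congr_deriv (by ring)
  have hneg : ∀ {z s : ℝ → ℝ}, (∀ x, HasDerivAt z (x * z x + s x) x) →
      ∀ x, HasDerivAt (fun t => -z t) (x * (-z x) + -s x) x := by
    intro z s hz x
    exact (hz x).neg.congr_deriv (by ring)
  have hr' : ∀ x, 0 ≤ x → |r x| ≤ x * q x - q' x := fun x hx => by
    simpa [abs_of_nonneg hx] using hr x
  have hr'' : ∀ x, 0 ≤ x → |r (-x)| ≤ x * q x - q' x := fun x hx => by
    simpa [abs_of_nonneg hx] using hr (-x)
  have hy2 : Tendsto (fun x => exp (-x ^ 2 / 2) * y (-x)) atTop (𝓝 0) := by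
    refine (hy1.comp tendsto_neg_atTop_atBot).congr fun x => ?_
    simp
  rcases le_total 0 x with hx | hx
  · rw [abs_of_nonneg hx, abs_le']
    refine ⟨le_of_stein_ode (fun x _ => hy x) hq hr' hy0 hq0 hx, ?_⟩
    refine le_of_stein_ode (y := fun t => -y t) (r := fun t => -r t) (fun x _ => hneg hy x) hq
      (fun x hx => by simpa using hr' x hx) ?_ hq0 hx
    simpa using hy0.neg
  · obtain ⟨u, rfl⟩ : ∃ u, x = -u := ⟨-x, by ring⟩
    have hu : 0 ≤ u := by linarith
    rw [abs_neg, abs_of_nonneg hu, abs_le']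
    constructor
    · have := le_of_stein_ode (y := fun t => - -y (-t)) (r := fun t => -r (-t))
        (fun x _ => hneg hrefl x) hq (fun x hx => by simpa using hr'' x hx) (by simpa using hy2)
        hq0 hu
      simpa using this
    · exact le_of_stein_ode (y := fun t => -y (-t)) (r := fun t => r (-t))
        (fun x _ => hrefl x) hq hr'' (by simpa using hy2.neg) hq0 hu

lemma tendsto_exp_neg_sq_half_mul_affine (a b : ℝ) :
    Tendsto (fun x : ℝ => exp (-x ^ 2 / 2) * (a + b * |x|)) (cocompact ℝ) (𝓝 0) := by
  have h0 : Tendsto (fun x : ℝ => |x| ^ (0 : ℝ) * exp (-(1 / 2) * x ^ 2)) (cocompact ℝ) (𝓝 0) :=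
    tendsto_rpow_abs_mul_exp_neg_mul_sq_cocompact (by norm_num) 0
  have h1 : Tendsto (fun x : ℝ => |x| ^ (1 : ℝ) * exp (-(1 / 2) * x ^ 2)) (cocompact ℝ) (𝓝 0) :=
    tendsto_rpow_abs_mul_exp_neg_mul_sq_cocompact (by norm_num) 1
  have h2 := (h0.const_mul a).add (h1.const_mul b)
  simp only [mul_zero, add_zero] at h2
  refine h2.congr fun x => ?_
  rw [Real.rpow_zero, Real.rpow_one, show -(1 / 2) * x ^ 2 = -x ^ 2 / 2 by ring]
  ring

lemma tendsto_exp_mul_of_abs_le {y : ℝ → ℝ} {a b : ℝ} (h : ∀ x, |y x| ≤ a + b * |x|) :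
    Tendsto (fun x : ℝ => exp (-x ^ 2 / 2) * y x) (cocompact ℝ) (𝓝 0) := by
  refine squeeze_zero_norm (fun x => ?_) (tendsto_exp_neg_sq_half_mul_affine a b)
  rw [norm_mul, Real.norm_eq_abs, Real.norm_eq_abs, abs_of_pos (exp_pos _)]
  exact mul_le_mul_of_nonneg_left (h x) (exp_pos _).le

lemma integrable_exp_mul_of_abs_le {h : ℝ → ℝ} (hc : Continuous h) {a b : ℝ}
    (hh : ∀ x, |h x| ≤ a + b * |x|) : Integrable fun x : ℝ => h x * exp (-x ^ 2 / 2) := by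
  have h0 : Integrable fun x : ℝ => exp (-(1 / 2) * x ^ 2) :=
    integrable_exp_neg_mul_sq (by norm_num)
  have h1 : Integrable fun x : ℝ => x * exp (-(1 / 2) * x ^ 2) :=
    integrable_mul_exp_neg_mul_sq (by norm_num)
  refine ((h0.const_mul a).add (h1.abs.const_mul b)).mono' (by fun_prop) ?_
  refine Eventually.of_forall fun x => ?_
  simp only [Pi.add_apply]
  rw [norm_mul, Real.norm_eq_abs, Real.norm_eq_abs, abs_mul,
    show -(1 / 2) * x ^ 2 = -x ^ 2 / 2 by ring, abs_of_pos (exp_pos _)]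
  have := mul_le_mul_of_nonneg_right (hh x) (exp_pos (-x ^ 2 / 2)).le
  linarith

lemma integral_gaussianReal_std (h : ℝ → ℝ) :
    ∫ x, h x ∂(gaussianReal 0 1) = (√(2 * π))⁻¹ * ∫ x, h x * exp (-x ^ 2 / 2) := by
  rw [integral_gaussianReal_eq_integral_smul (by norm_num), ← integral_const_mul]
  refine integral_congr_ae (Eventually.of_forall fun x => ?_)
  simp [gaussianPDFReal, smul_eq_mul]
  ring

lemma integrable_gaussianReal_id : Integrable (fun x : ℝ => x) (gaussianReal 0 1) :=
  (memLp_id_gaussianReal (μ := 0) (v := 1) 1).integrable (by simp)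

lemma integral_sq_gaussianReal : ∫ x, x ^ 2 ∂(gaussianReal 0 1) = 1 := by
  have h := variance_id_gaussianReal (μ := 0) (v := 1)
  rw [variance_of_integral_eq_zero aemeasurable_id (by simp)] at h
  simpa using h

lemma integral_abs_gaussianReal_le : ∫ x, |x| ∂(gaussianReal 0 1) ≤ 1 := by
  have h2 : Integrable (fun x : ℝ => x ^ 2) (gaussianReal 0 1) :=
    (memLp_id_gaussianReal (μ := 0) (v := 1) 2).integrable_sq
  calc ∫ x, |x| ∂(gaussianReal 0 1) ≤ ∫ x, (1 + x ^ 2) / 2 ∂(gaussianReal 0 1) := by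
        refine integral_mono integrable_gaussianReal_id.abs
          (((integrable_const 1).add h2).div_const 2) fun x => ?_
        have : (|x| - 1) ^ 2 = |x| ^ 2 - 2 * |x| + 1 := by ring
        have h3 := sq_nonneg (|x| - 1)
        rw [this, sq_abs] at h3
        show |x| ≤ (1 + x ^ 2) / 2
        linarith
    _ = 1 := by
        rw [integral_div, integral_add (integrable_const 1) h2, integral_sq_gaussianReal]
        simp

lemma integrable_gaussianReal_of_lipschitz {g : ℝ → ℝ} (hg : LipschitzWith 1 g) :
    Integrable g (gaussianReal 0 1) := by
  refine ((integrable_const |g 0|).add integrable_gaussianReal_id.abs).mono'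
    hg.continuous.aestronglyMeasurable (Eventually.of_forall fun x => ?_)
  have h := hg.dist_le_mul x 0
  simp only [Real.dist_eq, NNReal.coe_one, one_mul, sub_zero] at h
  rw [Real.norm_eq_abs]
  have := abs_sub_abs_le_abs_sub (g x) (g 0)
  simp only [Pi.add_apply]
  linarith

/-- The solution of Stein's equation for a continuously differentiable test function with
derivative bounded by one, with bounds on the solution and its first two derivatives. -/
lemma exists_stein_solution {g g' : ℝ → ℝ} (hg : ∀ x, HasDerivAt g (g' x) x)
    (hg' : ∀ x, |g' x| ≤ 1) :
    ∃ f f' : ℝ → ℝ, (∀ x, HasDerivAt f (f' x) x) ∧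
      (∀ x, f' x - x * f x = g x - ∫ t, g t ∂(gaussianReal 0 1)) ∧
      (∀ x, |f x| ≤ 20) ∧ (∀ x, |f' x| ≤ 20) ∧ LipschitzWith 20 f' := by
  have hlip : LipschitzWith 1 g := by
    refine lipschitzWith_of_nnnorm_deriv_le (fun x => (hg x).differentiableAt) fun x => ?_
    rw [(hg x).deriv, ← NNReal.coe_le_coe]
    simpa only [coe_nnnorm, Real.norm_eq_abs, NNReal.coe_one] using hg' x
  have hgc : Continuous g := hlip.continuous
  set c := ∫ t, g t ∂(gaussianReal 0 1) with hc
  set h : ℝ → ℝ := fun x => g x - c with hh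
  have hgi := integrable_gaussianReal_of_lipschitz hlip
  have hlip0 : ∀ x, |g x - g 0| ≤ |x| := fun x => by
    simpa [Real.dist_eq] using hlip.dist_le_mul x 0
  have hc0 : |g 0 - c| ≤ 1 := by
    have e : g 0 - c = ∫ t, (g 0 - g t) ∂(gaussianReal 0 1) := by
      rw [integral_sub (integrable_const _) hgi]; simp [hc]
    rw [e]
    calc |∫ t, (g 0 - g t) ∂(gaussianReal 0 1)| ≤ ∫ t, |g 0 - g t| ∂(gaussianReal 0 1) :=
          abs_integral_le_integral_abs
      _ ≤ ∫ t, |t| ∂(gaussianReal 0 1) := by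
          refine integral_mono ((integrable_const _).sub hgi).abs integrable_gaussianReal_id.abs
            fun t => ?_
          show |g 0 - g t| ≤ |t|
          rw [abs_sub_comm]; exact hlip0 t
      _ ≤ 1 := integral_abs_gaussianReal_le
  have hbound : ∀ x, |h x| ≤ 1 + 1 * |x| := fun x => by
    have : h x = (g x - g 0) + (g 0 - c) := by simp [hh]
    rw [this]
    refine (abs_add_le _ _).trans ?_
    have := hlip0 x
    linarith
  have hhc : Continuous h := hgc.sub continuous_const
  have hint := integrable_exp_mul_of_abs_le hhc hbound
  -- The centred test function has Gaussian mean zero, so its weighted primitive vanishes at both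
  -- ends. These are the boundary conditions of the comparison lemma.
  have hzero : ∫ x, h x * exp (-x ^ 2 / 2) = 0 := by
    have h1 := integral_gaussianReal_std h
    have h2 : ∫ x, h x ∂(gaussianReal 0 1) = 0 := by
      simp only [hh]
      rw [integral_sub hgi (integrable_const _)]; simp [hc]
    rw [h2] at h1
    have : (√(2 * π))⁻¹ ≠ 0 := by positivity
    exact (mul_eq_zero.mp h1.symm).resolve_left this
  set k : ℝ → ℝ := fun x => h x * exp (-x ^ 2 / 2) with hk
  have hkc : Continuous k := by
    simp only [hk]; fun_prop
  set F : ℝ → ℝ := fun x => ∫ t in Set.Iic x, k t with hF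
  have hFd : ∀ x, HasDerivAt F (k x) x := by
    intro x
    have e : ∀ y, F y = F 0 + ∫ t in (0 : ℝ)..y, k t := fun y => by
      rw [← intervalIntegral.integral_Iic_sub_Iic hint.integrableOn hint.integrableOn]
      simp [hF]
    have hd : HasDerivAt (fun y => F 0 + ∫ t in (0 : ℝ)..y, k t) (k x) x :=
      (intervalIntegral.integral_hasDerivAt_right (hkc.intervalIntegrable _ _)
        (hkc.stronglyMeasurableAtFilter _ _) hkc.continuousAt).const_add _
    exact hd.congr_of_eventuallyEq (Eventually.of_forall e)
  have hFtop : Tendsto F atTop (𝓝 0) := by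
    have h1 : Tendsto (fun x => ∫ t in Set.Iic x, k t) atTop (𝓝 (∫ t, k t)) :=
      (aecover_Iic tendsto_id).integral_tendsto_of_countably_generated hint
    rwa [hzero] at h1
  have hFbot : Tendsto F atBot (𝓝 0) := by
    have e : ∀ x, F x = -∫ t in Set.Ioi x, k t := fun x => by
      have h1 := intervalIntegral.integral_Iic_add_Ioi (b := x) hint.integrableOn hint.integrableOn
      rw [hzero] at h1
      simp only [hF]; linarith
    have h1 : Tendsto (fun x => ∫ t in Set.Ioi x, k t) atBot (𝓝 (∫ t, k t)) :=
      (aecover_Ioi tendsto_id).integral_tendsto_of_countably_generated hint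
    rw [hzero] at h1
    have h2 := h1.neg
    rw [neg_zero] at h2
    exact h2.congr fun x => (e x).symm
  set f : ℝ → ℝ := fun x => exp (x ^ 2 / 2) * F x with hf
  have hfF : ∀ x, exp (-x ^ 2 / 2) * f x = F x := fun x => by
    simp only [hf]
    rw [← mul_assoc, ← Real.exp_add]
    ring_nf
    simp
  set f' : ℝ → ℝ := fun x => x * f x + h x with hf'
  have hfd : ∀ x, HasDerivAt f (x * f x + h x) x := by
    intro x
    have h1 : HasDerivAt (fun x : ℝ => exp (x ^ 2 / 2)) (x * exp (x ^ 2 / 2)) x := by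
      have h2 : HasDerivAt (fun x : ℝ => x ^ 2 / 2) x x := by
        have := (hasDerivAt_pow 2 x).div_const 2
        exact this.congr_deriv (by simp)
      exact h2.exp.congr_deriv (by ring)
    have h3 := h1.mul (hFd x)
    have e : exp (x ^ 2 / 2) * exp (-x ^ 2 / 2) = 1 := by
      rw [← Real.exp_add]; ring_nf; simp
    refine h3.congr_deriv ?_
    simp only [hf, hk]
    linear_combination (h x) * e
  have hq : ∀ (a b : ℝ) (x : ℝ), 0 ≤ x →
      HasDerivAt (fun x : ℝ => a + b / (1 + x)) (-b / (1 + x) ^ 2) x := by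
    intro a b x hx
    have h1 : HasDerivAt (fun x : ℝ => 1 + x) 1 x := (hasDerivAt_id x).const_add 1
    have h2 := ((hasDerivAt_const x b).div h1 (by positivity)).const_add a
    exact h2.congr_deriv (by simp)
  have hq0 : ∀ a b : ℝ, 0 ≤ a → 0 ≤ b →
      Tendsto (fun x : ℝ => exp (-x ^ 2 / 2) * (a + b / (1 + x))) atTop (𝓝 0) := by
    intro a b ha hb
    have h1 := (tendsto_exp_neg_sq_half_mul_affine (a + b) 0).mono_left
      (atTop_le_cocompact (α := ℝ))
    refine squeeze_zero' ?_ ?_ h1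
    · filter_upwards [eventually_ge_atTop 0] with x hx
      positivity
    · filter_upwards [eventually_ge_atTop 0] with x hx
      have : b / (1 + x) ≤ b := div_le_self hb (by linarith)
      have := mul_le_mul_of_nonneg_left (add_le_add_right this a) (exp_pos (-x ^ 2 / 2)).le
      simpa using this
  have hfb : ∀ x, |f x| ≤ 4 := by
    intro x
    -- The barrier q = 1 + 3/(1+x) satisfies x q - q' ≥ 1 + x, the growth of the centred test
    -- function, and stays below 4.
    have h1 := abs_le_of_stein_ode (y := f) (r := h) (q := fun x => 1 + 3 / (1 + x))
      (q' := fun x => -3 / (1 + x) ^ 2) hfd (hq 1 3) ?_ (hFtop.congr fun x => (hfF x).symm)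
      (hFbot.congr fun x => (hfF x).symm) (hq0 1 3 (by norm_num) (by norm_num)) x
    · have : 3 / (1 + |x|) ≤ 3 := div_le_self (by norm_num) (by linarith [abs_nonneg x])
      linarith
    · intro x
      refine (hbound x).trans ?_
      have hx := abs_nonneg x
      have : |x| * (1 + 3 / (1 + |x|)) - -3 / (1 + |x|) ^ 2 - (1 + 1 * |x|)
          = (2 * |x| ^ 2 + |x| + 2) / (1 + |x|) ^ 2 := by
        field_simp; ring
      have h2 : 0 ≤ (2 * |x| ^ 2 + |x| + 2) / (1 + |x|) ^ 2 := by positivity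
      linarith
  -- A crude linear bound, needed only to see that the Gaussian weight kills `f'` at infinity before
  -- the sharp comparison.
  have hf'lin : ∀ x, |f' x| ≤ 1 + 5 * |x| := fun x => by
    simp only [hf']
    refine (abs_add_le _ _).trans ?_
    rw [abs_mul]
    have h1 := hbound x
    have h2 := mul_le_mul_of_nonneg_left (hfb x) (abs_nonneg x)
    linarith
  have hf'd : ∀ x, HasDerivAt f' (x * f' x + (f x + g' x)) x := by
    intro x
    have h1 := ((hasDerivAt_id x).mul (hfd x)).add ((hg x).sub_const c)
    refine h1.congr_deriv ?_
    simp only [hf', id]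
    ring
  have hr : ∀ x, |f x + g' x| ≤ 5 := fun x =>
    (abs_add_le _ _).trans (by linarith [hfb x, hg' x])
  -- The derivative solves the same equation with inhomogeneity f + g', at most 5 in size. A barrier
  -- decaying like 1/(1+x) is used because x f' must also be bounded: 15 + 5 = 20 is then the
  -- Lipschitz constant. The summand 0 fits the template `hq`.
  have hf'b : ∀ x, |f' x| ≤ 0 + 15 / (1 + |x|) := by
    intro x
    have hlim := tendsto_exp_mul_of_abs_le hf'lin
    refine abs_le_of_stein_ode (y := f') (r := fun x => f x + g' x)
      (q := fun x => 0 + 15 / (1 + x)) (q' := fun x => -15 / (1 + x) ^ 2) hf'd (hq 0 15) ?_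
      (hlim.mono_left atTop_le_cocompact) (hlim.mono_left atBot_le_cocompact)
      (hq0 0 15 le_rfl (by norm_num)) x
    intro x
    refine (hr x).trans ?_
    have hx := abs_nonneg x
    have : |x| * (0 + 15 / (1 + |x|)) - -15 / (1 + |x|) ^ 2 - 5
        = (10 * |x| ^ 2 + 5 * |x| + 10) / (1 + |x|) ^ 2 := by
      field_simp; ring
    have h2 : 0 ≤ (10 * |x| ^ 2 + 5 * |x| + 10) / (1 + |x|) ^ 2 := by positivity
    linarith
  refine ⟨f, f', hfd, fun x => by simp [hf', hh], fun x => (hfb x).trans (by norm_num),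
    fun x => ?_, ?_⟩
  · have : 15 / (1 + |x|) ≤ 15 := div_le_self (by norm_num) (by linarith [abs_nonneg x])
    linarith [hf'b x]
  · refine lipschitzWith_of_nnnorm_deriv_le (fun x => (hf'd x).differentiableAt) fun x => ?_
    rw [(hf'd x).deriv, ← NNReal.coe_le_coe]
    simp only [coe_nnnorm, Real.norm_eq_abs]
    refine (abs_add_le _ _).trans ?_
    rw [abs_mul]
    have h1 := mul_le_mul_of_nonneg_left (hf'b x) (abs_nonneg x)
    have h2 : |x| * (0 + 15 / (1 + |x|)) ≤ 15 := by
      have hx := abs_nonneg x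
      rw [zero_add, mul_div_assoc', div_le_iff₀ (by positivity)]
      linarith
    have := hr x
    norm_num
    linarith

/-- Averaging over [x, x + ε] works: the derivative is a difference quotient, which the Lipschitz
condition bounds by one. -/
lemma exists_c1_approx {g : ℝ → ℝ} (hg : LipschitzWith 1 g) {ε : ℝ} (hε : 0 < ε) :
    ∃ u u' : ℝ → ℝ, (∀ x, HasDerivAt u (u' x) x) ∧ (∀ x, |u' x| ≤ 1) ∧ ∀ x, |u x - g x| ≤ ε := by
  have hgc := hg.continuous
  have hl : ∀ x y, |g x - g y| ≤ |x - y| := fun x y => by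
    simpa [Real.dist_eq] using hg.dist_le_mul x y
  set G : ℝ → ℝ := fun x => ∫ t in (0 : ℝ)..x, g t
  have hG : ∀ x, HasDerivAt G (g x) x := fun x =>
    intervalIntegral.integral_hasDerivAt_right (hgc.intervalIntegrable _ _)
      (hgc.stronglyMeasurableAtFilter _ _) hgc.continuousAt
  refine ⟨fun x => (G (x + ε) - G x) / ε, fun x => (g (x + ε) - g x) / ε, fun x => ?_,
    fun x => ?_, fun x => ?_⟩
  · exact (((hG (x + ε)).comp_add_const x ε).sub (hG x)).div_const ε
  · rw [abs_div, abs_of_pos hε, div_le_one hε]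
    have := hl (x + ε) x
    simpa [abs_of_pos hε] using this
  · have e1 : G (x + ε) - G x = ∫ t in x..(x + ε), g t :=
      intervalIntegral.integral_interval_sub_left (hgc.intervalIntegrable _ _)
        (hgc.intervalIntegrable _ _)
    have e2 : (G (x + ε) - G x) / ε - g x = (∫ t in x..(x + ε), (g t - g x)) / ε := by
      rw [intervalIntegral.integral_sub (hgc.intervalIntegrable _ _) (by simp), e1]
      simp
      field_simp
    rw [e2, abs_div, abs_of_pos hε, div_le_iff₀ hε]
    have := intervalIntegral.norm_integral_le_of_norm_le_const (a := x) (b := x + ε)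
      (f := fun t => g t - g x) (C := ε) ?_
    · simpa [abs_of_pos hε] using this
    · intro t ht
      rw [Set.uIoc_of_le (by linarith)] at ht
      refine (hl t x).trans ?_
      rw [abs_of_nonneg (by linarith [ht.1])]
      linarith [ht.2]

lemma integrable_comp_of_lipschitz {Ω : Type*} [MeasurableSpace Ω] {P : Measure Ω}
    [IsProbabilityMeasure P] {Y : Ω → ℝ} (hY : Integrable Y P) {g : ℝ → ℝ} (hg : LipschitzWith 1 g) :
    Integrable (fun ω => g (Y ω)) P := by
  refine ((integrable_const |g 0|).add hY.abs).mono'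
    (hg.continuous.comp_aestronglyMeasurable hY.1) (Eventually.of_forall fun ω => ?_)
  have h := hg.dist_le_mul (Y ω) 0
  simp only [Real.dist_eq, NNReal.coe_one, one_mul, sub_zero] at h
  rw [Real.norm_eq_abs]
  have := abs_sub_abs_le_abs_sub (g (Y ω)) (g 0)
  simp only [Pi.add_apply]
  linarith

/-- Stein's method for the Wasserstein distance. -/
lemma abs_integral_sub_gaussian_le {Ω : Type*} [MeasurableSpace Ω] {P : Measure Ω}
    [IsProbabilityMeasure P] {Y : Ω → ℝ} (hY : Integrable Y P) {B : ℝ}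
    (hB : ∀ f f' : ℝ → ℝ, (∀ x, HasDerivAt f (f' x) x) → (∀ x, |f x| ≤ 20) →
      (∀ x, |f' x| ≤ 20) → LipschitzWith 20 f' →
      |∫ ω, (f' (Y ω) - Y ω * f (Y ω)) ∂P| ≤ B) {g : ℝ → ℝ} (hg : LipschitzWith 1 g) :
    |∫ ω, g (Y ω) ∂P - ∫ x, g x ∂(gaussianReal 0 1)| ≤ B := by
  refine le_of_forall_pos_le_add fun ε hε => ?_
  obtain ⟨u, u', hu, hu1, hug⟩ := exists_c1_approx hg (half_pos hε)
  have hulip : LipschitzWith 1 u := by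
    refine lipschitzWith_of_nnnorm_deriv_le (fun x => (hu x).differentiableAt) fun x => ?_
    rw [(hu x).deriv, ← NNReal.coe_le_coe]
    simpa using hu1 x
  obtain ⟨f, f', hf, hs, h1, h2, h3⟩ := exists_stein_solution hu hu1
  have hb := hB f f' hf h1 h2 h3
  simp_rw [hs] at hb
  have iu := integrable_comp_of_lipschitz hY hulip
  have ig := integrable_comp_of_lipschitz hY hg
  rw [integral_sub iu (integrable_const _)] at hb
  simp only [integral_const, probReal_univ, one_smul] at hb
  have d1 : |∫ ω, u (Y ω) ∂P - ∫ ω, g (Y ω) ∂P| ≤ ε / 2 := by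
    rw [← integral_sub iu ig]
    have := norm_integral_le_of_norm_le_const (μ := P) (f := fun ω => u (Y ω) - g (Y ω))
      (C := ε / 2) (Eventually.of_forall fun ω => hug (Y ω))
    simpa using this
  have d2 : |∫ x, u x ∂(gaussianReal 0 1) - ∫ x, g x ∂(gaussianReal 0 1)| ≤ ε / 2 := by
    rw [← integral_sub (integrable_gaussianReal_of_lipschitz hulip)
      (integrable_gaussianReal_of_lipschitz hg)]
    have := norm_integral_le_of_norm_le_const (μ := gaussianReal 0 1) (f := fun x => u x - g x)
      (C := ε / 2) (Eventually.of_forall fun x => hug x)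
    simpa using this
  rw [abs_le] at *
  constructor <;> linarith [d1.1, d1.2, d2.1, d2.2, hb.1, hb.2]

end Stein

/-! ### Degenerate samples -/

/-- The space in which the observations take their values. -/
abbrev Pt (d : ℕ) := EuclideanSpace ℝ (Fin d)

/-- One sample with a degenerate kernel whose mixing coefficient at distance beyond `m` is at most
`β`. -/
structure DegenerateSample {Ω : Type*} [MeasurableSpace Ω] {d : ℕ} {ι : Type*} [EMetricSpace ι]
    (P : Measure Ω) (X : ι → Ω → Pt d) (H : Pt d → Pt d → ℝ) (m : ℝ) (β : ℝ≥0∞) : Prop where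
  measX : ∀ i, Measurable (X i)
  measH : Measurable (Function.uncurry H)
  symm : ∀ x y, H x y = H y x
  deg : IsDegenerate P X H
  mix : ∀ s t : Finset ι, s.card ≤ 2 → (∀ i ∈ s, ∀ j ∈ t, ENNReal.ofReal m < edist i j) →
    betaCoeff P (sigmaOf X s) (sigmaOf X t) ≤ β

/-! ### Resampling one coordinate of a product space -/

section PiUpdate

variable {Ω : Type*} [MeasurableSpace Ω] {P : Measure Ω} [IsProbabilityMeasure P]
  {L : Type*} [Fintype L] [DecidableEq L]

lemma measurable_update_pair (l : L) :
    Measurable fun z : (L → Ω) × Ω => Function.update z.1 l z.2 := by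
  rw [measurable_pi_iff]
  intro i
  by_cases h : i = l
  · subst h; simpa using measurable_snd
  · simp only [Function.update_of_ne h]
    exact (measurable_pi_apply i).comp measurable_fst

/-- A coordinate replaced by an independent draw leaves the product law unchanged. Hence any one
copy of the sample can be integrated out first, with the other copies frozen. -/
lemma map_update_pi (l : L) :
    ((Measure.pi fun _ : L => P).prod P).map (fun z => Function.update z.1 l z.2)
      = Measure.pi fun _ : L => P := by
  refine (Measure.pi_eq fun s hs => ?_).symm
  rw [Measure.map_apply (measurable_update_pair l) (MeasurableSet.univ_pi hs)]
  have : (fun z : (L → Ω) × Ω => Function.update z.1 l z.2) ⁻¹' (Set.pi Set.univ s)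
      = (Set.pi Set.univ (Function.update s l Set.univ)) ×ˢ s l := by
    ext z
    simp only [Set.mem_preimage, Set.mem_pi, Set.mem_univ, true_imp_iff, Set.mem_prod]
    constructor
    · intro h
      refine ⟨fun i => ?_, by simpa using h l⟩
      by_cases hi : i = l
      · subst hi; simp
      · simpa [hi] using h i
    · rintro ⟨h1, h2⟩ i
      by_cases hi : i = l
      · subst hi; simpa using h2
      · simpa [hi] using h1 i
  rw [this, Measure.prod_prod, Measure.pi_pi, ← Finset.mul_prod_erase _ _ (Finset.mem_univ l),
    ← Finset.mul_prod_erase Finset.univ (fun i => P (s i)) (Finset.mem_univ l)]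
  simp only [Function.update_self, measure_univ, one_mul]
  rw [mul_comm]
  congr 1
  refine Finset.prod_congr rfl fun i hi => ?_
  rw [Function.update_of_ne (Finset.ne_of_mem_erase hi)]

lemma lintegral_pi_update (l : L) {F : (L → Ω) → ℝ≥0∞} (hF : Measurable F) :
    ∫⁻ ω, F ω ∂(Measure.pi fun _ : L => P)
      = ∫⁻ ω, ∫⁻ a, F (Function.update ω l a) ∂P ∂(Measure.pi fun _ : L => P) := by
  conv_lhs => rw [← map_update_pi (P := P) l]
  rw [lintegral_map hF (measurable_update_pair l), lintegral_prod]
  exact (hF.comp (measurable_update_pair l)).aemeasurable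

lemma integrable_pi_update (l : L) {F : (L → Ω) → ℝ}
    (hF : Integrable F (Measure.pi fun _ : L => P)) :
    Integrable (fun z : (L → Ω) × Ω => F (Function.update z.1 l z.2))
      ((Measure.pi fun _ : L => P).prod P) := by
  rw [← map_update_pi (P := P) l] at hF
  exact (integrable_map_measure hF.1 (measurable_update_pair l).aemeasurable).mp hF

lemma integral_pi_update (l : L) {F : (L → Ω) → ℝ}
    (hF : Integrable F (Measure.pi fun _ : L => P)) :
    ∫ ω, F ω ∂(Measure.pi fun _ : L => P)
      = ∫ ω, ∫ a, F (Function.update ω l a) ∂P ∂(Measure.pi fun _ : L => P) := by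
  have h := integrable_pi_update l hF
  have hm : AEStronglyMeasurable F
      (((Measure.pi fun _ : L => P).prod P).map (fun z => Function.update z.1 l z.2)) := by
    rw [map_update_pi]; exact hF.1
  conv_lhs => rw [← map_update_pi (P := P) l]
  rw [integral_map (measurable_update_pair l).aemeasurable hm, integral_prod _ h]

lemma map_pi_pair {l l' : L} (hl : l ≠ l') :
    (Measure.pi fun _ : L => P).map (fun ω => (ω l, ω l')) = P.prod P := by
  have h := (iIndepFun_pi (μ := fun _ : L => P) (X := fun _ => id)
    (fun _ => aemeasurable_id)).indepFun hl
  have h2 := (indepFun_iff_map_prod_eq_prod_map_map (measurable_pi_apply l).aemeasurable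
    (measurable_pi_apply l').aemeasurable).mp h
  refine h2.trans ?_
  rw [show (fun ω : L → Ω => ω l) = Function.eval l from rfl,
    show (fun ω : L → Ω => ω l') = Function.eval l' from rfl, (measurePreserving_eval (fun _ : L => P) l).map_eq,
    (measurePreserving_eval (fun _ : L => P) l').map_eq]

end PiUpdate

/-! ### Joint laws of observations drawn from several independent copies -/

section LabelLaw

variable {Ω : Type*} [MeasurableSpace Ω] {P : Measure Ω} [IsProbabilityMeasure P]
  {d : ℕ} {ι : Type*} {X : ι → Ω → Pt d}
  {V L : Type*} [Fintype L] [DecidableEq L]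

/-- The observations with the indices `v u`, where observations with the same label `c u` are
taken from the same copy of the sample and different copies are independent. -/
def labelVec (X : ι → Ω → Pt d) (v : V → ι) (c : V → L) (ω : L → Ω) (u : V) : Pt d :=
  X (v u) (ω (c u))

/-- The law of `labelVec`. -/
def labelLaw (P : Measure Ω) (X : ι → Ω → Pt d) (v : V → ι) (c : V → L) : Measure (V → Pt d) :=
  (Measure.pi fun _ : L => P).map (labelVec X v c)

lemma measurable_labelVec (hX : ∀ i, Measurable (X i)) (v : V → ι) (c : V → L) :
    Measurable (labelVec X v c) := by
  rw [measurable_pi_iff]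
  exact fun u => (hX _).comp (measurable_pi_apply _)

lemma isProbabilityMeasure_labelLaw (hX : ∀ i, Measurable (X i)) (v : V → ι) (c : V → L) :
    IsProbabilityMeasure (labelLaw P X v c) :=
  Measure.isProbabilityMeasure_map (measurable_labelVec hX v c).aemeasurable

lemma measurable_sigmaOf (s : Finset ι) {i : ι} (hi : i ∈ s) :
    Measurable[sigmaOf X s] (X i) := by
  have h : MeasurableSpace.comap (X i) inferInstance ≤ sigmaOf X s :=
    le_iSup₂_of_le (f := fun i (_ : i ∈ s) => MeasurableSpace.comap (X i) inferInstance) i hi le_rfl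
  exact (comap_measurable (X i)).mono h le_rfl

lemma sigmaOf_le (hX : ∀ i, Measurable (X i)) (s : Finset ι) : sigmaOf X s ≤ ‹MeasurableSpace Ω› :=
  iSup₂_le fun i _ => (hX i).comap_le

lemma measurable_sigmaOf_pi {A : Type*} (s : Finset ι) {v : A → ι} (hv : ∀ u, v u ∈ s) :
    Measurable[sigmaOf X s] (fun ω u => X (v u) ω) :=
  @measurable_pi_lambda _ _ _ (sigmaOf X s) _ _ fun u => measurable_sigmaOf s (hv u)

/-- Moving a group of vertices to a new copy changes the law by at most the mixing coefficient. -/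
lemma tvClose_labelLaw [Fintype V] [DecidableEq V] [DecidableEq ι] (hX : ∀ i, Measurable (X i))
    (v : V → ι) (c : V → L) (s : Finset V) {l l' : L} (hs : ∀ u ∈ s, c u = l)
    (hl' : ∀ u, c u ≠ l') (hne : l ≠ l') {β : ℝ≥0∞}
    (hβ : betaCoeff P (sigmaOf X (s.image v))
      (sigmaOf X ((Finset.univ.filter fun u => u ∉ s ∧ c u = l).image v)) ≤ β) :
    TVClose (labelLaw P X v c) (labelLaw P X v fun u => if u ∈ s then l' else c u) β := by
  have := isProbabilityMeasure_labelLaw (P := P) hX v c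
  have := isProbabilityMeasure_labelLaw (P := P) hX v fun u => if u ∈ s then l' else c u
  apply TVClose.of_le
  intro E hE
  set U : Ω → ({u // u ∈ s} → Pt d) := fun ω u => X (v u) ω with hU
  set W : Ω → ({u // u ∉ s ∧ c u = l} → Pt d) := fun ω u => X (v u) ω with hW
  have mU : Measurable U := measurable_pi_lambda _ fun u => hX _
  have mW : Measurable W := measurable_pi_lambda _ fun u => hX _
  have hTV : TVClose (P.map fun ω => (U ω, W ω)) ((P.map U).prod (P.map W)) β := by
    refine tvClose_map_prod P mU mW (measurable_sigmaOf_pi _ fun u => ?_)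
      (measurable_sigmaOf_pi _ fun u => ?_) hβ
    · exact Finset.mem_image_of_mem v u.2
    · exact Finset.mem_image_of_mem v (by simpa using u.2)
  -- With the other copies frozen, the whole vector is a function of the moved group and of the rest
  -- of copy `l`. Before the move both arguments are read at the same sample point; after it they
  -- are read at independent points, since `l'` is used by no other vertex.
  set g : (L → Ω) → ({u // u ∈ s} → Pt d) × ({u // u ∉ s ∧ c u = l} → Pt d) → V → Pt d :=
    fun ω z u => if h : u ∈ s then z.1 ⟨u, h⟩ else if h' : c u = l then z.2 ⟨u, h, h'⟩
      else X (v u) (ω (c u)) with hg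
  have mg : ∀ ω, Measurable (g ω) := by
    intro ω
    refine measurable_pi_lambda _ fun u => ?_
    by_cases h : u ∈ s
    · simp only [hg, h, dif_pos]; exact (measurable_pi_apply _).comp measurable_fst
    · by_cases h' : c u = l
      · simp only [hg, h, h', dif_neg, dif_pos, not_false_eq_true]
        exact (measurable_pi_apply _).comp measurable_snd
      · simp only [hg, h, h', dif_neg, not_false_eq_true]; exact measurable_const
  have mind : Measurable (E.indicator (1 : (V → Pt d) → ℝ≥0∞)) := measurable_one.indicator hE
  have mY := measurable_labelVec hX v c
  have mY' := measurable_labelVec hX v fun u => if u ∈ s then l' else c u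
  have mI : Measurable fun ω : L → Ω => E.indicator (1 : (V → Pt d) → ℝ≥0∞) (labelVec X v c ω) :=
    mind.comp mY
  have mI' : Measurable fun ω : L → Ω => E.indicator (1 : (V → Pt d) → ℝ≥0∞)
      (labelVec X v (fun u => if u ∈ s then l' else c u) ω) := mind.comp mY'
  have mJ : Measurable fun ω : L → Ω => ∫⁻ b, E.indicator (1 : (V → Pt d) → ℝ≥0∞)
      (labelVec X v (fun u => if u ∈ s then l' else c u) (Function.update ω l' b)) ∂P :=
    (mI'.comp (measurable_update_pair l')).lintegral_prod_right'
  have e1 : labelLaw P X v c E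
      = ∫⁻ ω, (P.map fun a => (U a, W a)) (g ω ⁻¹' E) ∂(Measure.pi fun _ : L => P) := by
    rw [labelLaw, ← lintegral_indicator_one hE, lintegral_map mind mY,
      lintegral_pi_update l mI]
    refine lintegral_congr fun ω => ?_
    rw [Measure.map_apply (mU.prodMk mW) (mg ω hE),
      ← lintegral_indicator_one ((mU.prodMk mW) (mg ω hE))]
    refine lintegral_congr fun a => ?_
    have : labelVec X v c (Function.update ω l a) = g ω (U a, W a) := by
      ext1 u
      by_cases h : u ∈ s
      · simp [labelVec, hg, h, hU, hs u h]
      · by_cases h' : c u = l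
        · simp [labelVec, hg, h, h', hW]
        · simp [labelVec, hg, h, h']
    simp only [this]
    rfl
  have e2 : labelLaw P X v (fun u => if u ∈ s then l' else c u) E
      = ∫⁻ ω, ((P.map U).prod (P.map W)) (g ω ⁻¹' E) ∂(Measure.pi fun _ : L => P) := by
    rw [labelLaw, ← lintegral_indicator_one hE, lintegral_map mind mY',
      lintegral_pi_update l' mI',
      lintegral_pi_update l mJ]
    refine lintegral_congr fun ω => ?_
    rw [Measure.map_prod_map _ _ mU mW, Measure.map_apply (mU.prodMap mW) (mg ω hE),
      ← lintegral_indicator_one ((mU.prodMap mW) (mg ω hE)),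
      lintegral_prod_symm _ (measurable_one.indicator ((mU.prodMap mW) (mg ω hE))).aemeasurable]
    refine lintegral_congr fun a => lintegral_congr fun b => ?_
    have : labelVec X v (fun u => if u ∈ s then l' else c u)
        (Function.update (Function.update ω l a) l' b) = g ω (U b, W a) := by
      ext1 u
      by_cases h : u ∈ s
      · simp [labelVec, hg, h, hU]
      · by_cases h' : c u = l
        · simp [labelVec, hg, h, h', hW, hne]
        · simp [labelVec, hg, h, h', hl' u]
    simp only [this]
    rfl
  rw [e1, e2]
  calc _ ≤ ∫⁻ ω, (((P.map U).prod (P.map W)) (g ω ⁻¹' E) + β) ∂(Measure.pi fun _ : L => P) :=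
        lintegral_mono fun ω => (hTV _ (mg ω hE)).1
    _ = _ := by
        rw [lintegral_add_right _ measurable_const]
        simp

end LabelLaw

/-! ### Moments of products of kernels -/

section Kernel

variable {Ω : Type*} [MeasurableSpace Ω] {P : Measure Ω} [IsProbabilityMeasure P]
  {d : ℕ} {ι : Type*} {X : ι → Ω → Pt d} {H : Pt d → Pt d → ℝ}
  {L : Type*} [Fintype L] [DecidableEq L] {q : ℕ}

/-- The product of the kernel over `q` pairs of points. -/
def prodKer (H : Pt d → Pt d → ℝ) (q : ℕ) (x : Fin q × Bool → Pt d) : ℝ :=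
  ∏ e, H (x (e, false)) (x (e, true))

lemma measurable_prodKer (hH : Measurable (Function.uncurry H)) : Measurable (prodKer H q) := by
  unfold prodKer
  refine Finset.measurable_fun_prod _ fun e _ => ?_
  have h : Measurable fun x : Fin q × Bool → Pt d => (x (e, false), x (e, true)) :=
    (measurable_pi_apply _).prodMk (measurable_pi_apply _)
  exact hH.comp h

lemma eLpNorm_pi_pair (hX : ∀ i, Measurable (X i)) {g : Pt d × Pt d → ℝ} (hg : Measurable g)
    {i j : ι} {l l' : L} (hl : l ≠ l') (p : ℝ≥0∞) :
    eLpNorm (fun ω : L → Ω => g (X i (ω l), X j (ω l'))) p (Measure.pi fun _ : L => P)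
      = eLpNorm g p (indepPair P X i j) := by
  rw [indepPair, Measure.map_prod_map _ _ (hX i) (hX j), ← map_pi_pair (P := P) hl,
    Measure.map_map ((hX i).prodMap (hX j))
      ((measurable_pi_apply l).prodMk (measurable_pi_apply l')),
    eLpNorm_map_measure hg.aestronglyMeasurable]
  · rfl
  · exact (((hX i).prodMap (hX j)).comp
      ((measurable_pi_apply l).prodMk (measurable_pi_apply l'))).aemeasurable

lemma eLpNorm_pi_eval {g : Ω → ℝ} (hg : Measurable g) (l : L) (p : ℝ≥0∞) :
    eLpNorm (fun ω : L → Ω => g (ω l)) p (Measure.pi fun _ : L => P) = eLpNorm g p P :=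
  eLpNorm_comp_measurePreserving hg.aestronglyMeasurable (measurePreserving_eval (fun _ : L => P) l)

lemma measurable_kernel (hX : ∀ i, Measurable (X i)) (hH : Measurable (Function.uncurry H))
    (i j : ι) : Measurable fun ω => H (X i ω) (X j ω) :=
  hH.comp ((hX i).prodMk (hX j))

/-- Equal labels give the dependent pair and different labels the independent one, so a norm that
covers both serves every labelling. -/
lemma eLpNorm_kernel_label_le (hX : ∀ i, Measurable (X i)) (hH : Measurable (Function.uncurry H))
    {i j : ι} (hij : i ≠ j) (l l' : L) (p : ℝ≥0∞) :
    eLpNorm (fun ω : L → Ω => H (X i (ω l)) (X j (ω l'))) p (Measure.pi fun _ : L => P)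
      ≤ kernelNorm P X H p := by
  refine le_trans ?_ (le_iSup_of_le i <| le_iSup_of_le j <| le_iSup_of_le hij le_rfl)
  by_cases hl : l = l'
  · subst hl
    rw [eLpNorm_pi_eval (g := fun ω => H (X i ω) (X j ω)) (measurable_kernel hX hH i j)]
    exact le_max_left _ _
  · refine le_trans (le_of_eq ?_) (le_max_right _ _)
    exact eLpNorm_pi_pair hX hH hl p

/-- Hölder's inequality with `q` equal exponents. -/
lemma eLpNorm_fin_prod_le {α : Type*} [MeasurableSpace α] {μ : Measure α} (hq : 1 ≤ q)
    {f : Fin q → α → ℝ} (hf : ∀ e, Measurable (f e)) {r : ℝ} (hr : 0 < r) {M : ℝ≥0∞}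
    (hM : ∀ e, eLpNorm (f e) (ENNReal.ofReal r) μ ≤ M) :
    eLpNorm (fun x => ∏ e, f e x) (ENNReal.ofReal (r / q)) μ ≤ M ^ q := by
  have hq0 : (0 : ℝ) < q := by exact_mod_cast hq
  have hrq : 0 < r / q := by positivity
  rw [eLpNorm_eq_lintegral_rpow_enorm_toReal (by simpa using hrq) (by simp),
    ENNReal.toReal_ofReal hrq.le]
  have h1 : ∀ e, ∫⁻ x, ‖f e x‖ₑ ^ r ∂μ ≤ M ^ r := by
    intro e
    have := hM e
    rw [eLpNorm_eq_lintegral_rpow_enorm_toReal (by simpa using hr) (by simp),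
      ENNReal.toReal_ofReal hr.le] at this
    have h2 := ENNReal.rpow_le_rpow this hr.le
    rwa [← ENNReal.rpow_mul, one_div, inv_mul_cancel₀ hr.ne', ENNReal.rpow_one] at h2
  have h2 : ∫⁻ x, ‖∏ e, f e x‖ₑ ^ (r / q) ∂μ ≤ M ^ r := by
    calc ∫⁻ x, ‖∏ e, f e x‖ₑ ^ (r / q) ∂μ
        = ∫⁻ x, ∏ e, (‖f e x‖ₑ ^ r) ^ (1 / (q : ℝ)) ∂μ := by
          refine lintegral_congr fun x => ?_
          have hn : ‖∏ e, f e x‖ₑ = ∏ e, ‖f e x‖ₑ := by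
            simp only [enorm_eq_nnnorm, nnnorm_prod, ENNReal.ofNNReal_finsetProd]
          rw [hn, ← ENNReal.prod_rpow_of_nonneg hrq.le]
          refine Finset.prod_congr rfl fun e _ => ?_
          rw [← ENNReal.rpow_mul]
          congr 1
          ring
      _ ≤ ∏ e : Fin q, (∫⁻ x, ‖f e x‖ₑ ^ r ∂μ) ^ (1 / (q : ℝ)) := by
          refine ENNReal.lintegral_prod_norm_pow_le _ (fun e _ => ?_) ?_ (fun _ _ => by positivity)
          · exact ((hf e).enorm.pow_const r).aemeasurable
          · simp; field_simp
      _ ≤ ∏ e : Fin q, (M ^ r) ^ (1 / (q : ℝ)) := by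
          refine Finset.prod_le_prod' fun e _ => ?_
          exact ENNReal.rpow_le_rpow (h1 e) (by positivity)
      _ = M ^ r := by
          rw [Finset.prod_const, Finset.card_univ, Fintype.card_fin, ← ENNReal.rpow_natCast,
            ← ENNReal.rpow_mul, ← ENNReal.rpow_mul]
          congr 1
          field_simp
  calc _ ≤ (M ^ r) ^ (1 / (r / q)) := ENNReal.rpow_le_rpow h2 (by positivity)
    _ = M ^ q := by
        rw [← ENNReal.rpow_natCast, ← ENNReal.rpow_mul]
        congr 1
        field_simp

lemma eLpNorm_prodKer_le (hX : ∀ i, Measurable (X i)) (hH : Measurable (Function.uncurry H))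
    (hq : 1 ≤ q) {v : Fin q × Bool → ι} (hv : ∀ e, v (e, false) ≠ v (e, true))
    (c : Fin q × Bool → L) {r : ℝ} (hr : 0 < r) :
    eLpNorm (prodKer H q) (ENNReal.ofReal (r / q)) (labelLaw P X v c)
      ≤ kernelNorm P X H (ENNReal.ofReal r) ^ q := by
  rw [labelLaw, eLpNorm_map_measure (measurable_prodKer hH).aestronglyMeasurable
    (measurable_labelVec hX v c).aemeasurable]
  refine eLpNorm_fin_prod_le hq (f := fun e ω =>
    H (labelVec X v c ω (e, false)) (labelVec X v c ω (e, true))) (fun e => ?_) hr fun e => ?_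
  · exact hH.comp (((hX (v (e, false))).comp (measurable_pi_apply (c (e, false)))).prodMk
      ((hX (v (e, true))).comp (measurable_pi_apply (c (e, true)))))
  · exact eLpNorm_kernel_label_le hX hH (hv e) _ _ _

end Kernel

/-! ### Decoupling of products of kernels -/

section LabelInt

variable {Ω : Type*} [MeasurableSpace Ω] {P : Measure Ω} [IsProbabilityMeasure P]
  {d : ℕ} {ι : Type*} [EMetricSpace ι] {X : ι → Ω → Pt d} {H : Pt d → Pt d → ℝ} {m : ℝ} {β : ℝ≥0∞}
  {L : Type*} [Fintype L] [DecidableEq L] {q : ℕ}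

/-- The expectation of a product of kernels, with observations with different labels taken from
independent copies of the sample. -/
def labelInt (P : Measure Ω) (X : ι → Ω → Pt d) (H : Pt d → Pt d → ℝ) (q : ℕ)
    (v : Fin q × Bool → ι) (c : Fin q × Bool → L) : ℝ :=
  ∫ x, prodKer H q x ∂(labelLaw P X v c)

/-- The bound on the error of decoupling a product of `q` kernels. -/
def decErr (P : Measure Ω) (X : ι → Ω → Pt d) (H : Pt d → Pt d → ℝ) (β : ℝ≥0∞) (r : ℝ) (q : ℕ) :
    ℝ≥0∞ :=
  β ^ (1 - q / r) * kernelNorm P X H (ENNReal.ofReal r) ^ q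

lemma labelInt_eq (h : DegenerateSample P X H m β) (v : Fin q × Bool → ι) (c : Fin q × Bool → L) :
    labelInt P X H q v c = ∫ ω, prodKer H q (labelVec X v c ω) ∂(Measure.pi fun _ : L => P) := by
  rw [labelInt, labelLaw, integral_map (measurable_labelVec h.measX v c).aemeasurable
    (measurable_prodKer h.measH).aestronglyMeasurable]

/-- A product of `q` kernels has a moment of order r/q, and this gives the exponent 1 - q/r in
`decErr`. The moved vertices may occupy only two nodes because the mixing coefficient allows at most
two observations in its first group. -/
lemma enorm_labelInt_sub_le (h : DegenerateSample P X H m β) (hq : 1 ≤ q) {r : ℝ} (hqr : q ≤ r)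
    {v : Fin q × Bool → ι} (hv : ∀ e, v (e, false) ≠ v (e, true)) (c c' : Fin q × Bool → L)
    (s : Finset (Fin q × Bool)) {l l' : L} (hs : ∀ u ∈ s, c u = l) (hl' : ∀ u, c u ≠ l')
    (hne : l ≠ l') (hc' : ∀ u, c' u = if u ∈ s then l' else c u)
    {i j : ι} (hij : ∀ u ∈ s, v u = i ∨ v u = j)
    (hfar : ∀ u ∈ s, ∀ u', u' ∉ s → c u' = l → ENNReal.ofReal m < edist (v u) (v u')) :
    ‖labelInt P X H q v c - labelInt P X H q v c'‖ₑ ≤ 2 * decErr P X H β r q := by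
  classical
  obtain rfl : c' = fun u => if u ∈ s then l' else c u := funext hc'
  have := isProbabilityMeasure_labelLaw (P := P) h.measX v c
  have := isProbabilityMeasure_labelLaw (P := P) h.measX v fun u => if u ∈ s then l' else c u
  have hq0 : (0 : ℝ) < q := by exact_mod_cast hq
  have hr : 0 < r := hq0.trans_le hqr
  have hcard : (s.image v).card ≤ 2 := by
    have : s.image v ⊆ {i, j} := by
      intro x hx
      obtain ⟨u, hu, rfl⟩ := Finset.mem_image.mp hx
      simpa using hij u hu
    exact (Finset.card_le_card this).trans Finset.card_le_two
  have hTV := tvClose_labelLaw h.measX v c s hs hl' hne (h.mix (s.image v)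
    ((Finset.univ.filter fun u => u ∉ s ∧ c u = l).image v) hcard (by
      intro a ha b hb
      obtain ⟨u, hu, rfl⟩ := Finset.mem_image.mp ha
      obtain ⟨u', hu', rfl⟩ := Finset.mem_image.mp hb
      simp only [Finset.mem_filter, Finset.mem_univ, true_and] at hu'
      exact hfar u hu u' hu'.1 hu'.2))
  have := hTV.enorm_integral_sub_le (measurable_prodKer h.measH) (p := r / q)
    (by rwa [one_le_div hq0]) (eLpNorm_prodKer_le h.measX h.measH hq hv c hr)
    (eLpNorm_prodKer_le h.measX h.measH hq hv _ hr)
  rwa [one_div_div] at this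

lemma integrable_prodKer (h : DegenerateSample P X H m β) (hq : 1 ≤ q) {r : ℝ} (hqr : q ≤ r)
    (hK : kernelNorm P X H (ENNReal.ofReal r) ≠ ⊤)
    {v : Fin q × Bool → ι} (hv : ∀ e, v (e, false) ≠ v (e, true)) (c : Fin q × Bool → L) :
    Integrable (prodKer H q) (labelLaw P X v c) := by
  have := isProbabilityMeasure_labelLaw (P := P) h.measX v c
  have hq0 : (0 : ℝ) < q := by exact_mod_cast hq
  rw [← memLp_one_iff_integrable]
  refine MemLp.mono_exponent (q := ENNReal.ofReal (r / q))
    ⟨(measurable_prodKer h.measH).aestronglyMeasurable, ?_⟩ (by simpa using (one_le_div hq0).mpr hqr)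
  exact (eLpNorm_prodKer_le h.measX h.measH hq hv c (hq0.trans_le hqr)).trans_lt
    (ENNReal.pow_lt_top (lt_top_iff_ne_top.mpr hK))

lemma enorm_labelInt_le (h : DegenerateSample P X H m β) (hq : 1 ≤ q) {r : ℝ} (hqr : q ≤ r)
    {v : Fin q × Bool → ι} (hv : ∀ e, v (e, false) ≠ v (e, true)) (c : Fin q × Bool → L) :
    ‖labelInt P X H q v c‖ₑ ≤ kernelNorm P X H (ENNReal.ofReal r) ^ q := by
  have := isProbabilityMeasure_labelLaw (P := P) h.measX v c
  have hq0 : (0 : ℝ) < q := by exact_mod_cast hq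
  calc ‖labelInt P X H q v c‖ₑ ≤ eLpNorm (prodKer H q) 1 (labelLaw P X v c) := by
        rw [eLpNorm_one_eq_lintegral_enorm]; exact enorm_integral_le_lintegral_enorm _
    _ ≤ eLpNorm (prodKer H q) (ENNReal.ofReal (r / q)) (labelLaw P X v c) :=
        eLpNorm_le_eLpNorm_of_exponent_le (by simpa using (one_le_div hq0).mpr hqr)
          (measurable_prodKer h.measH).aestronglyMeasurable
    _ ≤ _ := eLpNorm_prodKer_le h.measX h.measH hq hv c (hq0.trans_le hqr)

lemma integral_kernel_eval_eq_zero (h : DegenerateSample P X H m β) {i j : ι} (hij : i ≠ j) (l : L) :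
    ∀ᵐ ω ∂(Measure.pi fun _ : L => P), ∫ a, H (X i a) (X j (ω l)) ∂P = 0 := by
  have h1 : ∀ᵐ ω ∂P, ∫ a, H (X i a) (X j ω) ∂P = 0 :=
    ae_of_ae_map (h.measX j).aemeasurable (h.deg j i hij.symm)
  exact (measurePreserving_eval (fun _ : L => P) l).quasiMeasurePreserving.ae h1

/-- A vertex with a label of its own makes the expectation vanish. -/
lemma labelInt_eq_zero (h : DegenerateSample P X H m β) {v : Fin q × Bool → ι}
    (hv : ∀ e, v (e, false) ≠ v (e, true)) {c : Fin q × Bool → L} {u₀ : Fin q × Bool}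
    (hu : ∀ u, u ≠ u₀ → c u ≠ c u₀) : labelInt P X H q v c = 0 := by
  classical
  rw [labelInt_eq h]
  -- Without integrability the integral is zero by convention, so no moment assumption enters.
  by_cases hi : Integrable (fun ω => prodKer H q (labelVec X v c ω)) (Measure.pi fun _ : L => P)
  swap
  · exact integral_undef hi
  obtain ⟨e₀, b₀⟩ := u₀
  rw [integral_pi_update (c (e₀, b₀)) hi]
  have hvne : v (e₀, b₀) ≠ v (e₀, !b₀) := by
    cases b₀
    · exact hv e₀
    · exact (hv e₀).symm
  refine integral_eq_zero_of_ae ?_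
  filter_upwards [integral_kernel_eval_eq_zero h hvne (c (e₀, !b₀))] with ω hω
  -- Only one kernel depends on the copy that holds the lonely vertex. Integrating that copy first
  -- exposes the degenerate conditional mean.
  have key : ∀ a, prodKer H q (labelVec X v c (Function.update ω (c (e₀, b₀)) a))
      = H (X (v (e₀, b₀)) a) (X (v (e₀, !b₀)) (ω (c (e₀, !b₀)))) *
        ∏ e ∈ Finset.univ.erase e₀,
          H (labelVec X v c ω (e, false)) (labelVec X v c ω (e, true)) := by
    intro a
    rw [prodKer, ← Finset.mul_prod_erase _ _ (Finset.mem_univ e₀)]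
    congr 1
    · cases b₀
      · simp [labelVec, hu (e₀, true) (by simp)]
      · rw [h.symm]
        simp [labelVec, hu (e₀, false) (by simp)]
    · refine Finset.prod_congr rfl fun e he => ?_
      have hne : e ≠ e₀ := Finset.ne_of_mem_erase he
      simp [labelVec, hu (e, false) (by simp [hne]), hu (e, true) (by simp [hne])]
  simp_rw [key]
  rw [integral_mul_const, hω, zero_mul]
  rfl

/-- A vertex far from the rest of its copy is moved to a fresh copy, where it is alone and
degeneracy gives zero. -/
lemma enorm_labelInt_le_of_isolated (h : DegenerateSample P X H m β) (hq : 1 ≤ q) {r : ℝ}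
    (hqr : q ≤ r) {v : Fin q × Bool → ι} (hv : ∀ e, v (e, false) ≠ v (e, true))
    (c : Fin q × Bool → L) {l' : L} (hl' : ∀ u, c u ≠ l') (u₀ : Fin q × Bool)
    (hfar : ∀ u, u ≠ u₀ → c u = c u₀ → ENNReal.ofReal m < edist (v u₀) (v u)) :
    ‖labelInt P X H q v c‖ₑ ≤ 2 * decErr P X H β r q := by
  have h1 := enorm_labelInt_sub_le h hq hqr hv c (fun u => if u ∈ ({u₀} : Finset _) then l' else c u)
    {u₀} (l := c u₀) (l' := l') (by simp) hl' (hl' u₀) (fun u => rfl) (i := v u₀) (j := v u₀)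
    (by simp) (by simpa using hfar)
  rwa [labelInt_eq_zero h hv (c := fun u => if u ∈ ({u₀} : Finset _) then l' else c u)
    (u₀ := u₀), sub_zero] at h1
  intro u hu
  simpa [hu] using hl' u

lemma labelInt_const (h : DegenerateSample P X H m β) (v : Fin q × Bool → ι) (l : L) :
    labelInt P X H q v (fun _ => l) = ∫ ω, ∏ e, H (X (v (e, false)) ω) (X (v (e, true)) ω) ∂P := by
  rw [labelInt_eq h]
  have hm : Measurable fun ω => ∏ e, H (X (v (e, false)) ω) (X (v (e, true)) ω) :=
    Finset.measurable_fun_prod _ fun e _ => measurable_kernel h.measX h.measH _ _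
  conv_rhs => rw [← (measurePreserving_eval (fun _ : L => P) l).map_eq]
  rw [integral_map (measurable_pi_apply l).aemeasurable hm.aestronglyMeasurable]
  rfl

/-- The product of the two means is itself an integral over labelled vertices, so a covariance
becomes the difference of two labellings of the same vertices. -/
lemma labelInt_four_split (h : DegenerateSample P X H m β) (v : Fin 4 × Bool → ι)
    (c : Fin 4 × Bool → L) {l l' : L} (hl : l ≠ l') (h0 : ∀ b, c (0, b) = l) (h1 : ∀ b, c (1, b) = l)
    (h2 : ∀ b, c (2, b) = l') (h3 : ∀ b, c (3, b) = l') :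
    labelInt P X H 4 v c
      = (∫ ω, H (X (v (0, false)) ω) (X (v (0, true)) ω) *
          H (X (v (1, false)) ω) (X (v (1, true)) ω) ∂P) *
        ∫ ω, H (X (v (2, false)) ω) (X (v (2, true)) ω) *
          H (X (v (3, false)) ω) (X (v (3, true)) ω) ∂P := by
  rw [labelInt_eq h, ← integral_prod_mul, ← map_pi_pair hl, integral_map]
  · simp only [prodKer, Fin.prod_univ_four, labelVec, h0, h1, h2, h3]
    simp only [mul_assoc]
  · exact ((measurable_pi_apply l).prodMk (measurable_pi_apply l')).aemeasurable
  · have hk := fun i j => measurable_kernel (X := X) h.measX h.measH i j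
    exact ((((hk _ _).mul (hk _ _)).comp measurable_fst).mul
      (((hk _ _).mul (hk _ _)).comp measurable_snd)).aestronglyMeasurable

lemma measurable_gam (h : DegenerateSample P X H m β) (i j : ι) :
    Measurable (Function.uncurry (Gam P X H i j)) := by
  have hm : Measurable fun z : (Pt d × Pt d) × Ω => H (X i z.2) z.1.1 * H (X j z.2) z.1.2 :=
    (h.measH.comp (((h.measX i).comp measurable_snd).prodMk
      (measurable_fst.comp measurable_fst))).mul
    (h.measH.comp (((h.measX j).comp measurable_snd).prodMk
      (measurable_snd.comp measurable_fst)))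
  exact hm.stronglyMeasurable.integral_prod_right'.measurable

/-- Two pairs of neighbours in copies of their own leave a product of two `Gam` functions. -/
lemma enorm_labelInt_four_le_gamNorm (h : DegenerateSample P X H m β) {v : Fin 4 × Bool → ι}
    {c : Fin 4 × Bool → L} {l l' : L} (hl : l ≠ l')
    (h0 : c (0, false) = l) (h1 : c (1, false) = l) (h2 : c (2, false) = l')
    (h3 : c (3, false) = l') (hcl : ∀ e, c (e, true) ≠ l) (hcl' : ∀ e, c (e, true) ≠ l')
    (h01 : c (0, true) ≠ c (1, true)) (h23 : c (2, true) ≠ c (3, true))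
    (n01 : v (1, false) ∈ nbhd m (v (0, false))) (n23 : v (3, false) ∈ nbhd m (v (2, false)))
    (f01 : ENNReal.ofReal m < edist (v (0, true)) (v (1, true)))
    (f23 : ENNReal.ofReal m < edist (v (2, true)) (v (3, true))) :
    ‖labelInt P X H 4 v c‖ₑ ≤ gamNorm P X H m 2 ^ 2 := by
  rw [labelInt_eq h]
  set π := Measure.pi fun _ : L => P with hπ
  by_cases hi : Integrable (fun ω => prodKer H 4 (labelVec X v c ω)) π
  swap
  · rw [integral_undef hi]; simp
  set G₁ : (L → Ω) → ℝ := fun ω => Gam P X H (v (0, false)) (v (1, false))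
    (X (v (0, true)) (ω (c (0, true)))) (X (v (1, true)) (ω (c (1, true)))) with hG₁
  set G₂ : (L → Ω) → ℝ := fun ω => Gam P X H (v (2, false)) (v (3, false))
    (X (v (2, true)) (ω (c (2, true)))) (X (v (3, true)) (ω (c (3, true)))) with hG₂
  have hinner : ∀ ω, ∫ a, prodKer H 4 (labelVec X v c (Function.update ω l a)) ∂P
      = G₁ ω * (H (X (v (2, false)) (ω l')) (X (v (2, true)) (ω (c (2, true)))) *
        H (X (v (3, false)) (ω l')) (X (v (3, true)) (ω (c (3, true))))) := by
    intro ω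
    simp only [hG₁, Gam]
    rw [← integral_mul_const]
    refine integral_congr_ae (Eventually.of_forall fun a => ?_)
    simp [prodKer, Fin.prod_univ_four, labelVec, h0, h1, h2, h3, hcl, hl.symm, mul_assoc]
  have hi1 := (integrable_pi_update l hi).integral_prod_left
  simp_rw [hinner] at hi1
  have hfull : ∫ ω, prodKer H 4 (labelVec X v c ω) ∂π = ∫ ω, G₁ ω * G₂ ω ∂π := by
    rw [integral_pi_update l hi]
    simp_rw [hinner]
    rw [integral_pi_update l' hi1]
    refine integral_congr_ae (Eventually.of_forall fun ω => ?_)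
    simp only [hG₁, hG₂, Gam]
    rw [← integral_const_mul]
    refine integral_congr_ae (Eventually.of_forall fun a => ?_)
    simp [hcl']
  have bG₁ : eLpNorm G₁ 2 π ≤ gamNorm P X H m 2 := by
    have e := eLpNorm_pi_pair (P := P) h.measX (measurable_gam h (v (0, false)) (v (1, false)))
      (i := v (0, true)) (j := v (1, true)) h01 2
    exact e.le.trans <| le_iSup_of_le _ <| le_iSup_of_le _ <| le_iSup_of_le _ <|
      le_iSup_of_le _ <| le_iSup_of_le n01 <| le_iSup_of_le f01 le_rfl
  have bG₂ : eLpNorm G₂ 2 π ≤ gamNorm P X H m 2 := by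
    have e := eLpNorm_pi_pair (P := P) h.measX (measurable_gam h (v (2, false)) (v (3, false)))
      (i := v (2, true)) (j := v (3, true)) h23 2
    exact e.le.trans <| le_iSup_of_le _ <| le_iSup_of_le _ <| le_iSup_of_le _ <|
      le_iSup_of_le _ <| le_iSup_of_le n23 <| le_iSup_of_le f23 le_rfl
  have hmG : ∀ i j k k' (a b : L), Measurable fun ω : L → Ω =>
      Gam P X H i j (X k (ω a)) (X k' (ω b)) := fun i j k k' a b =>
    (measurable_gam h i j).comp (((h.measX k).comp (measurable_pi_apply a)).prodMk
      ((h.measX k').comp (measurable_pi_apply b)))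
  rw [hfull]
  calc ‖∫ ω, G₁ ω * G₂ ω ∂π‖ₑ ≤ eLpNorm (fun ω => G₁ ω * G₂ ω) 1 π := by
        rw [eLpNorm_one_eq_lintegral_enorm]; exact enorm_integral_le_lintegral_enorm _
    _ ≤ eLpNorm G₁ 2 π * eLpNorm G₂ 2 π :=
        eLpNorm_smul_le_mul_eLpNorm (p := 2) (q := 2) (r := 1) (φ := G₁) (f := G₂)
          (hmG _ _ _ _ _ _).aestronglyMeasurable (hmG _ _ _ _ _ _).aestronglyMeasurable
    _ ≤ _ := by rw [sq]; exact mul_le_mul' bG₁ bG₂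

lemma enorm_labelInt_two_indep_le (h : DegenerateSample P X H m β) {i k : ι} (hik : i ≠ k)
    {v : Fin 2 × Bool → ι} (hv : ∀ e, v (e, false) = i) (hv' : ∀ e, v (e, true) = k)
    {c : Fin 2 × Bool → L} {l l' : L} (hl : l ≠ l') (hc : ∀ e, c (e, false) = l)
    (hc' : ∀ e, c (e, true) = l') :
    ‖labelInt P X H 2 v c‖ₑ ≤ indepKernelNorm P X H 2 ^ 2 := by
  rw [labelInt_eq h]
  have := eLpNorm_fin_prod_le (μ := Measure.pi fun _ : L => P) (q := 2) (by norm_num)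
    (f := fun _ ω => H (X i (ω l)) (X k (ω l')))
    (fun _ => h.measH.comp (((h.measX i).comp (measurable_pi_apply l)).prodMk
      ((h.measX k).comp (measurable_pi_apply l')))) (r := 2) (by norm_num)
    (M := indepKernelNorm P X H 2) (fun _ => by
      rw [ENNReal.ofReal_ofNat]
      exact (eLpNorm_pi_pair (P := P) h.measX h.measH hl 2).le.trans <|
        le_iSup_of_le _ <| le_iSup_of_le _ <| le_iSup_of_le hik le_rfl)
  refine le_trans ?_ this
  norm_num
  rw [eLpNorm_one_eq_lintegral_enorm]
  refine (enorm_integral_le_lintegral_enorm _).trans (le_of_eq ?_)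
  refine lintegral_congr fun ω => ?_
  simp [prodKer, labelVec, hv, hv', hc, hc', sq]

end LabelInt

/-! ### Counting tuples by their proximity graph -/

section Counting

variable {ι : Type*} {N : ι → ι → Prop}

/-- A list of nodes built from right to left, in which all but `r` nodes are close to a node that
is already there. -/
inductive Grown (N : ι → ι → Prop) : ℕ → List ι → Prop
  | nil : Grown N 0 []
  | root {r : ℕ} {l : List ι} (x : ι) : Grown N r l → Grown N (r + 1) (x :: l)
  | attach {r : ℕ} {l : List ι} (x y : ι) : y ∈ l → N y x → Grown N r l → Grown N r (x :: l)

lemma Grown.le_length {r : ℕ} {l : List ι} (h : Grown N r l) : r ≤ l.length := by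
  induction h with
  | nil => simp
  | root x _ ih => simp; omega
  | attach x y _ _ _ ih => simp; omega

-- A new entry is either a root, with n choices, or attached to one of the `q` earlier entries, with
-- `η` choices each. The factor 1 + q per step accumulates to the factorial.
open Classical in
lemma card_grown_le [Fintype ι] {η : ℕ} (hη : ∀ i, (Finset.univ.filter fun j => N i j).card ≤ η)
    (q r : ℕ) :
    (Finset.univ.filter fun t : Fin q → ι => Grown N r (List.ofFn t)).card
      ≤ q.factorial * (Fintype.card ι ^ r * η ^ (q - r)) := by
  induction q generalizing r with
  | zero =>
    rcases Nat.eq_zero_or_pos r with rfl | hr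
    · refine (Finset.card_le_univ _).trans (by simp)
    · rw [Finset.filter_false_of_mem]
      · simp
      · intro t _ h
        have := h.le_length
        simp at this
        omega
  | succ q ih =>
    by_cases hrq : q + 1 < r
    · rw [Finset.filter_false_of_mem]
      · simp
      · intro t _ h
        have := h.le_length
        simp at this
        omega
    set A : ℕ → Finset (Fin q → ι) := fun r =>
      Finset.univ.filter fun t : Fin q → ι => Grown N r (List.ofFn t) with hA
    set rootSet : Finset (Fin (q + 1) → ι) := if r = 0 then ∅ else
      (Finset.univ ×ˢ A (r - 1)).image fun z => Fin.cons z.1 z.2 with hroot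
    set attSet : Fin q → Finset (Fin (q + 1) → ι) := fun a =>
      ((A r).sigma fun s => Finset.univ.filter fun x => N (s a) x).image
        fun z => Fin.cons z.2 z.1 with hatt
    have hsub : (Finset.univ.filter fun t : Fin (q + 1) → ι => Grown N r (List.ofFn t))
        ⊆ rootSet ∪ Finset.univ.biUnion attSet := by
      intro t ht
      simp only [Finset.mem_filter, Finset.mem_univ, true_and] at ht
      have ht0 : t = Fin.cons (t 0) (Fin.tail t) := (Fin.cons_self_tail t).symm
      rw [ht0, List.ofFn_cons] at ht
      rw [Finset.mem_union, Finset.mem_biUnion]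
      generalize hl : List.ofFn (Fin.tail t) = l at ht
      cases ht with
      | root x h =>
        left
        simp only [hroot, Nat.succ_ne_zero, if_false, Finset.mem_image, Finset.mem_product,
          Finset.mem_univ, true_and, Prod.exists, hA, Finset.mem_filter]
        exact ⟨t 0, Fin.tail t, by rw [hl]; exact h, ht0.symm⟩
      | attach x y hy hN h =>
        right
        rw [← hl, List.mem_ofFn] at hy
        obtain ⟨a, ha⟩ := hy
        refine ⟨a, Finset.mem_univ _, ?_⟩
        simp only [hatt, hA, Finset.mem_image, Finset.mem_sigma, Finset.mem_filter,
          Finset.mem_univ, true_and, Sigma.exists]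
        exact ⟨Fin.tail t, t 0, ⟨by rw [hl]; exact h, by rw [ha]; exact hN⟩, ht0.symm⟩
    have hrc : rootSet.card ≤ q.factorial * (Fintype.card ι ^ r * η ^ (q + 1 - r)) := by
      rcases Nat.eq_zero_or_pos r with rfl | hr
      · simp [hroot]
      · obtain ⟨r, rfl⟩ : ∃ r', r = r' + 1 := ⟨r - 1, by omega⟩
        simp only [hroot, Nat.succ_ne_zero, if_false]
        refine Finset.card_image_le.trans ?_
        rw [Finset.card_product, Finset.card_univ]
        refine (Nat.mul_le_mul_left _ (ih r)).trans (le_of_eq ?_)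
        rw [show q + 1 - (r + 1) = q - r by omega]
        ring
    have hac : ∀ a, (attSet a).card ≤ q.factorial * (Fintype.card ι ^ r * η ^ (q + 1 - r)) := by
      intro a
      refine Finset.card_image_le.trans ?_
      rw [Finset.card_sigma]
      calc ∑ s ∈ A r, (Finset.univ.filter fun x => N (s a) x).card
          ≤ ∑ _s ∈ A r, η := Finset.sum_le_sum fun s _ => hη _
        _ = (A r).card * η := by rw [Finset.sum_const, smul_eq_mul]
        _ ≤ _ := by
          by_cases hr : r ≤ q
          · refine (Nat.mul_le_mul_right _ (ih r)).trans (le_of_eq ?_)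
            rw [show q + 1 - r = (q - r) + 1 by omega, pow_succ]
            ring
          · have : A r = ∅ := by
              rw [hA]
              refine Finset.filter_false_of_mem fun t _ h => ?_
              have := h.le_length
              simp at this
              omega
            simp [this]
    calc _ ≤ (rootSet ∪ Finset.univ.biUnion attSet).card := Finset.card_le_card hsub
      _ ≤ rootSet.card + ∑ a, (attSet a).card :=
          (Finset.card_union_le _ _).trans (Nat.add_le_add_left Finset.card_biUnion_le _)
      _ ≤ q.factorial * (Fintype.card ι ^ r * η ^ (q + 1 - r))
          + ∑ _a : Fin q, q.factorial * (Fintype.card ι ^ r * η ^ (q + 1 - r)) :=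
          Nat.add_le_add hrc (Finset.sum_le_sum fun a _ => hac a)
      _ = _ := by
          rw [Finset.sum_const, Finset.card_univ, Fintype.card_fin, smul_eq_mul, Nat.factorial_succ]
          ring

variable {V : Type*}

/-- Every vertex of the tuple has a neighbour. -/
def NoIsolated (N : ι → ι → Prop) (v : V → ι) : Prop := ∀ u, ∃ w, w ≠ u ∧ N (v u) (v w)

/-- Some vertex of the tuple has two neighbours. -/
def HasFork (N : ι → ι → Prop) (v : V → ι) : Prop :=
  ∃ u w w', w ≠ u ∧ w' ≠ u ∧ w ≠ w' ∧ N (v u) (v w) ∧ N (v u) (v w')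

/-- Greedy exploration: attach a vertex near the current list if one exists; otherwise open a root
at an unvisited vertex and attach a neighbour of it, which cannot have been visited either. Every
root thus brings two vertices. The number `k` is a surplus of attached vertices in the starting list
that is never lost. -/
lemma exists_grown_of_noIsolated [Fintype V] (hN' : ∀ x y, N x y → N y x) {v : V → ι}
    (hv : NoIsolated N v)
    (k r : ℕ) (l : List V) (hl : l.Nodup) (hg : Grown N r (l.map v)) (hr : 2 * r + k ≤ l.length) :
    ∃ (r' : ℕ) (l' : List V), l'.Nodup ∧ (∀ u, u ∈ l') ∧ Grown N r' (l'.map v) ∧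
      2 * r' + k ≤ l'.length := by
  by_cases hfull : ∀ u, u ∈ l
  · exact ⟨r, l, hl, hfull, hg, hr⟩
  push Not at hfull
  have hlen : ∀ l' : List V, l'.Nodup → l'.length ≤ Fintype.card V := fun l' h => h.length_le_card
  by_cases hatt : ∃ u, u ∉ l ∧ ∃ w ∈ l, N (v w) (v u)
  · obtain ⟨u, hu, w, hw, hN⟩ := hatt
    have hnd : (u :: l).Nodup := List.nodup_cons.mpr ⟨hu, hl⟩
    have hterm := hlen _ hnd
    exact exists_grown_of_noIsolated hN' hv k r (u :: l) hnd
      (Grown.attach _ _ (List.mem_map_of_mem hw) hN hg) (by simp; omega)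
  · push Not at hatt
    obtain ⟨u, hu⟩ := hfull
    obtain ⟨w, hwu, hN⟩ := hv u
    have hw : w ∉ l := fun hwl => hatt u hu w hwl (hN' _ _ hN)
    have hnd : (w :: u :: l).Nodup := by
      simp [hl, hu, hw, hwu]
    have hterm := hlen _ hnd
    exact exists_grown_of_noIsolated hN' hv k (r + 1) (w :: u :: l) hnd
      (Grown.attach _ (v u) (by simp) hN (Grown.root _ hg)) (by simp; omega)
termination_by Fintype.card V - l.length
decreasing_by all_goals (simp at *; omega)

/-- A constant in the bounds on the numbers of tuples. -/
def countConst (q : ℕ) : ℕ := q ^ q * ((q + 1) * q.factorial)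

-- A tuple is recovered from the order of exploration and the grown list. There are at most q^q
-- orders and R + 1 numbers of roots, and `η ≤ n` reduces every number of roots to the maximal one.
open Classical in
lemma card_le_of_exists_grown [Fintype ι] [Fintype V] {η : ℕ}
    (hη : ∀ i, (Finset.univ.filter fun j => N i j).card ≤ η) (hηn : η ≤ Fintype.card ι) {q R : ℕ}
    (hq : Fintype.card V = q) (hR : R ≤ q) (S : Finset (V → ι))
    (hS : ∀ v ∈ S, ∃ (r : ℕ) (l : List V), l.Nodup ∧ (∀ u, u ∈ l) ∧ Grown N r (l.map v) ∧ r ≤ R) :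
    S.card ≤ countConst q * (Fintype.card ι ^ R * η ^ (q - R)) := by
  set T : ℕ → Finset (Fin q → ι) := fun r =>
    Finset.univ.filter fun t : Fin q → ι => Grown N r (List.ofFn t) with hT
  set B : (Fin q → V) → ℕ → Finset (V → ι) := fun e r =>
    if Function.Surjective e then Finset.univ.filter fun v => v ∘ e ∈ T r else ∅ with hB
  have hsub : S ⊆ Finset.univ.biUnion fun e => (Finset.range (R + 1)).biUnion (B e) := by
    intro v hv
    obtain ⟨r, l, hnd, hfull, hg, hr⟩ := hS v hv
    have hlen : l.length = q := by
      rw [← hq, ← Finset.card_univ, ← List.toFinset_card_of_nodup hnd]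
      congr 1
      ext u
      simp [hfull u]
    subst hlen
    simp only [Finset.mem_biUnion, Finset.mem_univ, true_and, Finset.mem_range]
    refine ⟨l.get, r, by omega, ?_⟩
    have hs : Function.Surjective l.get := fun u => by
      obtain ⟨i, hi⟩ := List.mem_iff_get.mp (hfull u)
      exact ⟨i, hi⟩
    simp only [hB, hs, if_true, hT, Finset.mem_filter, Finset.mem_univ, true_and]
    have : List.ofFn (v ∘ l.get) = l.map v := by
      rw [← List.map_ofFn, List.ofFn_get]
    rwa [this]
  have hTc : ∀ r ≤ R, (T r).card ≤ q.factorial * (Fintype.card ι ^ R * η ^ (q - R)) := by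
    intro r hr
    refine (card_grown_le hη q r).trans (Nat.mul_le_mul_left _ ?_)
    calc Fintype.card ι ^ r * η ^ (q - r)
        = Fintype.card ι ^ r * (η ^ (R - r) * η ^ (q - R)) := by
          rw [← pow_add]; congr 2; omega
      _ ≤ Fintype.card ι ^ r * (Fintype.card ι ^ (R - r) * η ^ (q - R)) := by gcongr
      _ = _ := by rw [← mul_assoc, ← pow_add]; congr 2; omega
  have hBc : ∀ e, ∀ r ≤ R, (B e r).card ≤ q.factorial * (Fintype.card ι ^ R * η ^ (q - R)) := by
    intro e r hr
    simp only [hB]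
    split_ifs with he
    · refine le_trans ?_ (hTc r hr)
      refine Finset.card_le_card_of_injOn (fun v => v ∘ e) (fun v hv => ?_) ?_
      · simpa using hv
      · intro v _ v' _ hvv
        exact he.injective_comp_right hvv
    · simp
  calc S.card ≤ _ := Finset.card_le_card hsub
    _ ≤ ∑ e : Fin q → V, ∑ r ∈ Finset.range (R + 1), (B e r).card :=
        Finset.card_biUnion_le.trans (Finset.sum_le_sum fun e _ => Finset.card_biUnion_le)
    _ ≤ ∑ _e : Fin q → V, ∑ _r ∈ Finset.range (R + 1),
          q.factorial * (Fintype.card ι ^ R * η ^ (q - R)) :=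
        Finset.sum_le_sum fun e _ => Finset.sum_le_sum fun r hr =>
          hBc e r (by simp at hr; omega)
    _ = q ^ q * ((R + 1) * (q.factorial * (Fintype.card ι ^ R * η ^ (q - R)))) := by
        simp [hq]
    _ ≤ q ^ q * ((q + 1) * (q.factorial * (Fintype.card ι ^ R * η ^ (q - R)))) := by gcongr
    _ = _ := by rw [countConst]; ring

-- Two vertices per root, so 2R vertices have at most R roots.
open Classical in
lemma card_noIsolated_le [Fintype ι] [Fintype V] {η : ℕ} (hN' : ∀ x y, N x y → N y x)
    (hη : ∀ i, (Finset.univ.filter fun j => N i j).card ≤ η) (hηn : η ≤ Fintype.card ι) {R : ℕ}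
    (hq : Fintype.card V = 2 * R) (S : Finset (V → ι)) (hS : ∀ v ∈ S, NoIsolated N v) :
    S.card ≤ countConst (2 * R) * (Fintype.card ι ^ R * η ^ R) := by
  have := card_le_of_exists_grown hη hηn hq (R := R) (by omega) S fun v hv => by
    obtain ⟨r, l, h1, h2, h3, h4⟩ := exists_grown_of_noIsolated hN' (hS v hv) 0 0 []
      List.nodup_nil Grown.nil (by simp)
    have := h1.length_le_card
    exact ⟨r, l, h1, h2, h3, by omega⟩
  rwa [show 2 * R - R = R by omega] at this

-- Starting at a fork puts three vertices under one root. This surplus of one lowers the number of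
-- roots from R + 1 to R.
open Classical in
lemma card_noIsolated_hasFork_le [Fintype ι] [Fintype V] {η : ℕ} (hN' : ∀ x y, N x y → N y x)
    (hη : ∀ i, (Finset.univ.filter fun j => N i j).card ≤ η) (hηn : η ≤ Fintype.card ι) {R : ℕ}
    (hq : Fintype.card V = 2 * R + 2) (S : Finset (V → ι))
    (hS : ∀ v ∈ S, NoIsolated N v ∧ HasFork N v) :
    S.card ≤ countConst (2 * R + 2) * (Fintype.card ι ^ R * η ^ (R + 2)) := by
  have := card_le_of_exists_grown hη hηn hq (R := R) (by omega) S fun v hv => by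
    obtain ⟨hno, u, w, w', hw, hw', hne, hN1, hN2⟩ := hS v hv
    obtain ⟨r, l, h1, h2, h3, h4⟩ := exists_grown_of_noIsolated hN' hno 1 1 [w', w, u]
      (by simp [hw, hw', hne.symm])
      (Grown.attach _ (v u) (by simp) hN2 (Grown.attach _ (v u) (by simp) hN1
        (Grown.root _ Grown.nil))) (by simp)
    have := h1.length_le_card
    exact ⟨r, l, h1, h2, h3, by omega⟩
  rwa [show 2 * R + 2 - R = R + 2 by omega] at this

end Counting

/-! ### Moments of single kernels and of row sums -/

section SampleBounds

variable {Ω : Type*} [MeasurableSpace Ω] {P : Measure Ω}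
  {d : ℕ} {ι : Type*} [Fintype ι] [EMetricSpace ι] {X : ι → Ω → Pt d} {H : Pt d → Pt d → ℝ}
  {m : ℝ} {β : ℝ≥0∞} {r K b G ε₁ ε₂ ε₄ : ℝ} {η : ℕ}

/-- Two nodes are close when their distance is at most `m`. -/
def Near (m : ℝ) (i j : ι) : Prop := edist i j ≤ ENNReal.ofReal m

lemma Near.symm {i j : ι} (h : Near m i j) : Near m j i := by
  rw [Near, edist_comm]; exact h

lemma near_refl (i : ι) : Near m i i := by simp [Near]

lemma ne_of_not_near {i j : ι} (h : ¬ Near m i j) : i ≠ j := fun e => h (e ▸ near_refl i)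

open Classical in
/-- The nodes close to `i`. -/
def nearFin (m : ℝ) (i : ι) : Finset ι := Finset.univ.filter fun j => Near m i j

open Classical in
/-- The nodes that are not close to `i`. -/
def farFin (m : ℝ) (i : ι) : Finset ι := Finset.univ.filter fun j => ¬ Near m i j

@[simp] lemma mem_nearFin {i j : ι} : j ∈ nearFin m i ↔ Near m i j := by simp [nearFin]

@[simp] lemma mem_farFin {i j : ι} : j ∈ farFin m i ↔ ¬ Near m i j := by simp [farFin]

/-- A degenerate sample with numerical bounds on its neighbourhoods, the moments of the kernel and
the errors of decoupling one, two and four kernels. -/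
structure BoundedSample (P : Measure Ω) (X : ι → Ω → Pt d) (H : Pt d → Pt d → ℝ) (m : ℝ)
    (β : ℝ≥0∞) (r K b G ε₁ ε₂ ε₄ : ℝ) (η : ℕ) : Prop extends DegenerateSample P X H m β where
  four_le : 4 ≤ r
  K_nonneg : 0 ≤ K
  b_nonneg : 0 ≤ b
  G_nonneg : 0 ≤ G
  ε₁_nonneg : 0 ≤ ε₁
  ε₂_nonneg : 0 ≤ ε₂
  ε₄_nonneg : 0 ≤ ε₄
  kernel_le : kernelNorm P X H (ENNReal.ofReal 4) ≤ ENNReal.ofReal K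
  indep_le : indepKernelNorm P X H 2 ≤ ENNReal.ofReal b
  gam_le : gamNorm P X H m 2 ≤ ENNReal.ofReal G
  err₁_le : decErr P X H β r 1 ≤ ENNReal.ofReal ε₁
  err₂_le : decErr P X H β r 2 ≤ ENNReal.ofReal ε₂
  err₄_le : decErr P X H β r 4 ≤ ENNReal.ofReal ε₄
  card_near_le : ∀ i : ι, (nearFin m i).card ≤ η
  η_le : η ≤ Fintype.card ι

variable [IsProbabilityMeasure P]

lemma abs_le_of_enorm_le {x y : ℝ} (hy : 0 ≤ y) (h : ‖x‖ₑ ≤ ENNReal.ofReal y) : |x| ≤ y := by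
  rw [Real.enorm_eq_ofReal_abs] at h
  exact (ENNReal.ofReal_le_ofReal_iff hy).mp h

lemma abs_le_two_mul_of_enorm_le {x y : ℝ} {z : ℝ≥0∞} (hy : 0 ≤ y) (h : ‖x‖ₑ ≤ 2 * z)
    (hz : z ≤ ENNReal.ofReal y) : |x| ≤ 2 * y := by
  refine abs_le_of_enorm_le (by linarith) (h.trans ?_)
  rw [ENNReal.ofReal_mul (by norm_num), ENNReal.ofReal_ofNat]
  gcongr

lemma abs_le_pow_of_enorm_le {x y : ℝ} {z : ℝ≥0∞} {q : ℕ} (hy : 0 ≤ y) (h : ‖x‖ₑ ≤ z ^ q)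
    (hz : z ≤ ENNReal.ofReal y) : |x| ≤ y ^ q := by
  refine abs_le_of_enorm_le (by positivity) (h.trans ?_)
  rw [ENNReal.ofReal_pow hy]
  gcongr

namespace BoundedSample

lemma abs_labelInt_le {L : Type*} [Fintype L] [DecidableEq L]
    (h : BoundedSample P X H m β r K b G ε₁ ε₂ ε₄ η) {q : ℕ} (hq : 1 ≤ q) (hq4 : q ≤ 4)
    {v : Fin q × Bool → ι} (hv : ∀ e, v (e, false) ≠ v (e, true)) (c : Fin q × Bool → L) :
    |labelInt P X H q v c| ≤ K ^ q :=
  abs_le_pow_of_enorm_le h.K_nonneg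
    (enorm_labelInt_le h.toDegenerateSample hq (r := 4) (by exact_mod_cast hq4) hv c) h.kernel_le

lemma memLp_kernel (h : BoundedSample P X H m β r K b G ε₁ ε₂ ε₄ η) {i j : ι} (hij : i ≠ j) :
    MemLp (fun ω => H (X i ω) (X j ω)) 4 P := by
  refine ⟨(measurable_kernel h.measX h.measH i j).aestronglyMeasurable, ?_⟩
  have h1 : eLpNorm (fun ω => H (X i ω) (X j ω)) 4 P ≤ kernelNorm P X H 4 :=
    le_trans (le_max_left _ _) (le_iSup_of_le i <| le_iSup_of_le j <| le_iSup_of_le hij le_rfl)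
  have h2 := h.kernel_le
  rw [ENNReal.ofReal_ofNat] at h2
  exact (h1.trans h2).trans_lt ENNReal.ofReal_lt_top

lemma memLp_kernel_two (h : BoundedSample P X H m β r K b G ε₁ ε₂ ε₄ η) {i j : ι} (hij : i ≠ j) :
    MemLp (fun ω => H (X i ω) (X j ω)) 2 P :=
  (h.memLp_kernel hij).mono_exponent (by norm_num)

lemma integral_kernel_pow_four_le (h : BoundedSample P X H m β r K b G ε₁ ε₂ ε₄ η) {i j : ι}
    (hij : i ≠ j) : ∫ ω, H (X i ω) (X j ω) ^ 4 ∂P ≤ K ^ 4 := by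
  have h1 := h.abs_labelInt_le (q := 4) (by norm_num) le_rfl
    (v := fun u => if u.2 then j else i) (by simpa using hij) (fun _ => (0 : Fin 1))
  rw [labelInt_const h.toDegenerateSample] at h1
  simpa using (le_abs_self _).trans h1

lemma integral_kernel_sq_le (h : BoundedSample P X H m β r K b G ε₁ ε₂ ε₄ η) {i j : ι}
    (hij : i ≠ j) : ∫ ω, H (X i ω) (X j ω) ^ 2 ∂P ≤ K ^ 2 := by
  have h1 := h.abs_labelInt_le (q := 2) (by norm_num) (by norm_num)
    (v := fun u => if u.2 then j else i) (by simpa using hij) (fun _ => (0 : Fin 1))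
  rw [labelInt_const h.toDegenerateSample] at h1
  simpa using (le_abs_self _).trans h1

/-- For far nodes the dependent second moment is comparable with the one at independent copies. This
is where `b` replaces `K`, saving a power of `K` in the final rate. -/
lemma integral_kernel_sq_le_of_far (h : BoundedSample P X H m β r K b G ε₁ ε₂ ε₄ η) {i j : ι}
    (hij : ¬ Near m i j) : ∫ ω, H (X i ω) (X j ω) ^ 2 ∂P ≤ b ^ 2 + 2 * ε₂ := by
  have hne := ne_of_not_near hij
  set v : Fin 2 × Bool → ι := fun u => if u.2 then j else i with hv
  have hvne : ∀ e, v (e, false) ≠ v (e, true) := by simpa [hv] using hne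
  have h1 := enorm_labelInt_sub_le h.toDegenerateSample (q := 2) (by norm_num)
    (r := r) (by have := h.four_le; norm_num; linarith) hvne (fun _ => (0 : Fin 2))
    (fun u => if u.2 then 0 else 1) (Finset.univ.filter fun u => u.2 = false) (l := 0) (l' := 1)
    (by simp) (by simp) (by simp) (by decide) (i := i) (j := i) (by simp [hv]) (by
      intro u hu u' hu' _
      simp at hu hu'
      simpa [hv, hu, hu', Near] using hij)
  have h2 := abs_le_two_mul_of_enorm_le h.ε₂_nonneg h1 h.err₂_le
  have h3 := abs_le_pow_of_enorm_le h.b_nonneg (enorm_labelInt_two_indep_le h.toDegenerateSample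
    hne (v := v) (c := fun u => if u.2 then (0 : Fin 2) else 1) (l := 1) (l' := 0)
    (by simp [hv]) (by simp [hv]) (by simp) (by simp) (by simp)) h.indep_le
  rw [labelInt_const h.toDegenerateSample] at h2
  simp only [Fin.prod_univ_two, hv] at h2 h3
  simp only [if_true, Bool.false_eq_true, if_false, ← sq] at h2
  have := abs_le.mp h2
  have := abs_le.mp h3
  linarith

/-- The first-order part of the statistic at the node `i`, without the close nodes. -/
def _root_.DegenerateUStat.rowSum (X : ι → Ω → Pt d) (H : Pt d → Pt d → ℝ) (m : ℝ) (i : ι)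
    (ω : Ω) : ℝ := ∑ k ∈ farFin m i, H (X i ω) (X k ω)

lemma rowSum_memLp (h : BoundedSample P X H m β r K b G ε₁ ε₂ ε₄ η) (i : ι) :
    MemLp (rowSum X H m i) 4 P :=
  memLp_finsetSum _ fun k hk => h.memLp_kernel (ne_of_not_near (by simpa using hk))

-- Expanding the power gives one vertex per factor besides the common node `i`, which is far from
-- all of them. An isolated vertex leaves a mixing error; the other tuples have at most R roots. The
-- bound `M` for a single product is kept free, since it is `b`-type for second and `K`-type for
-- fourth moments.
open Classical in
lemma integral_rowSum_pow_le (h : BoundedSample P X H m β r K b G ε₁ ε₂ ε₄ η) (i : ι) {R : ℕ}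
    (hR : 1 ≤ R) (hR2 : R ≤ 2) {ε M : ℝ} (hε : 0 ≤ ε) (hM0 : 0 ≤ M)
    (herr : decErr P X H β r (2 * R) ≤ ENNReal.ofReal ε)
    (hM : ∀ κ : Fin (2 * R) → ι, (∀ e, ¬ Near m i (κ e)) →
      |∫ ω, ∏ e, H (X i ω) (X (κ e) ω) ∂P| ≤ M) :
    ∫ ω, rowSum X H m i ω ^ (2 * R) ∂P ≤ 2 * (Fintype.card ι : ℝ) ^ (2 * R) * ε
      + countConst (2 * R) * ((Fintype.card ι : ℝ) ^ R * (η : ℝ) ^ R) * M := by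
  have hr := h.four_le
  have hexp : ∀ ω, rowSum X H m i ω ^ (2 * R) = ∑ κ ∈ Fintype.piFinset
      (fun _ : Fin (2 * R) => farFin m i), ∏ e, H (X i ω) (X (κ e) ω) := by
    intro ω
    have := Finset.prod_univ_sum (fun _ : Fin (2 * R) => farFin m i)
      (fun _ k => H (X i ω) (X k ω))
    rw [rowSum, ← this]
    simp
  set T := Fintype.piFinset (fun _ : Fin (2 * R) => farFin m i) with hT
  have hfar : ∀ κ ∈ T, ∀ e, ¬ Near m i (κ e) := fun κ hκ e => by
    have := Fintype.mem_piFinset.mp hκ e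
    simpa using this
  set v : (Fin (2 * R) → ι) → Fin (2 * R) × Bool → ι := fun κ u => if u.2 then κ u.1 else i with hv
  have hvne : ∀ κ ∈ T, ∀ e, v κ (e, false) ≠ v κ (e, true) := fun κ hκ e => by
    simpa [hv] using ne_of_not_near (hfar κ hκ e)
  have hlab : ∀ κ, labelInt P X H (2 * R) (v κ) (fun _ => (0 : Fin 2))
      = ∫ ω, ∏ e, H (X i ω) (X (κ e) ω) ∂P := fun κ => by
    rw [labelInt_const h.toDegenerateSample]
    simp [hv]
  have hint : ∀ κ ∈ T, Integrable (fun ω => ∏ e, H (X i ω) (X (κ e) ω)) P := by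
    intro κ hκ
    have h0 := integrable_prodKer h.toDegenerateSample (q := 2 * R) (by omega) (r := 4)
      (by exact_mod_cast (by omega : 2 * R ≤ 4)) (ne_top_of_le_ne_top ENNReal.ofReal_ne_top
        h.kernel_le) (hvne κ hκ) (fun _ => ())
    rw [labelLaw, integrable_map_measure h0.1 (measurable_labelVec h.measX _ _).aemeasurable] at h0
    rw [← (measurePreserving_eval (fun _ : Unit => P) ()).integrable_comp
      (Finset.measurable_fun_prod _ fun e _ =>
        measurable_kernel h.measX h.measH _ _).aestronglyMeasurable]
    refine h0.congr (Eventually.of_forall fun ω => ?_)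
    simp [prodKer, labelVec, hv]
  simp_rw [hexp]
  rw [integral_finsetSum _ hint]
  have hterm : ∀ κ ∈ T, ∫ ω, ∏ e, H (X i ω) (X (κ e) ω) ∂P
      ≤ 2 * ε + if NoIsolated (Near m) κ then M else 0 := by
    intro κ hκ
    split_ifs with hno
    · exact (le_abs_self _).trans ((hM κ (hfar κ hκ)).trans (by linarith))
    · rw [NoIsolated] at hno
      push Not at hno
      obtain ⟨e₀, he₀⟩ := hno
      rw [add_zero, ← hlab κ]
      refine (le_abs_self _).trans (abs_le_two_mul_of_enorm_le hε
        (enorm_labelInt_le_of_isolated h.toDegenerateSample (by omega) (r := r) ?_ (hvne κ hκ) _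
          (l' := 1) (by simp) (e₀, true) ?_) herr)
      · refine le_trans ?_ hr
        exact_mod_cast (by omega : 2 * R ≤ 4)
      -- The remaining vertices are copies of the node `i`, far by the choice of the index set, or
      -- other entries of the tuple, far by isolation.
      · rintro ⟨e, bb⟩ hu _
        cases bb
        · have := fun hh : Near m (κ e₀) i => hfar κ hκ e₀ hh.symm
          simpa [hv, Near] using this
        · have := he₀ e (by simpa using hu)
          simpa [hv, Near] using this
  refine (Finset.sum_le_sum hterm).trans ?_
  rw [Finset.sum_add_distrib, Finset.sum_const, nsmul_eq_mul, ← Finset.sum_filter, Finset.sum_const,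
    nsmul_eq_mul]
  have hc1 : (T.card : ℝ) ≤ (Fintype.card ι : ℝ) ^ (2 * R) := by
    have : T.card ≤ Fintype.card ι ^ (2 * R) := by
      refine (Finset.card_le_univ _).trans (by simp)
    exact_mod_cast this
  have hc2 : ((T.filter fun κ => NoIsolated (Near m) κ).card : ℝ)
      ≤ countConst (2 * R) * ((Fintype.card ι : ℝ) ^ R * (η : ℝ) ^ R) := by
    have := card_noIsolated_le (N := Near m) (η := η) (fun x y => Near.symm)
      (by simpa [nearFin] using h.card_near_le) h.η_le (R := R) (by simp)
      (T.filter fun κ => NoIsolated (Near m) κ) (by simp)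
    exact_mod_cast this
  have h1 := mul_le_mul_of_nonneg_right hc1 (by linarith : 0 ≤ 2 * ε)
  have h2 := mul_le_mul_of_nonneg_right hc2 hM0
  linarith

lemma integral_rowSum_sq_le (h : BoundedSample P X H m β r K b G ε₁ ε₂ ε₄ η) (i : ι) :
    ∫ ω, rowSum X H m i ω ^ 2 ∂P ≤ 2 * (Fintype.card ι : ℝ) ^ 2 * ε₂
      + countConst 2 * (Fintype.card ι * η) * (b ^ 2 + 2 * ε₂) := by
  have h0 := h.ε₂_nonneg
  have := h.integral_rowSum_pow_le i (R := 1) le_rfl (by norm_num) h.ε₂_nonneg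
    (M := b ^ 2 + 2 * ε₂) (by positivity) h.err₂_le ?_
  · simpa using this
  change ∀ κ : Fin 2 → ι, _
  intro κ hκ
  change |∫ ω, ∏ e : Fin 2, H (X i ω) (X (κ e) ω) ∂P| ≤ _
  simp only [Fin.prod_univ_two]
  have i1 := (h.memLp_kernel_two (ne_of_not_near (hκ 0))).integrable_sq
  have i2 := (h.memLp_kernel_two (ne_of_not_near (hκ 1))).integrable_sq
  refine abs_integral_le_integral_abs.trans ?_
  calc ∫ ω, |H (X i ω) (X (κ 0) ω) * H (X i ω) (X (κ 1) ω)| ∂P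
      ≤ ∫ ω, (H (X i ω) (X (κ 0) ω) ^ 2 + H (X i ω) (X (κ 1) ω) ^ 2) / 2 ∂P := by
        refine integral_mono_of_nonneg (Eventually.of_forall fun _ => abs_nonneg _)
          ((i1.add i2).div_const 2) (Eventually.of_forall fun ω => ?_)
        show |H (X i ω) (X (κ 0) ω) * H (X i ω) (X (κ 1) ω)| ≤ _
        rw [abs_le]
        constructor <;> nlinarith [sq_nonneg (H (X i ω) (X (κ 0) ω) + H (X i ω) (X (κ 1) ω)),
          sq_nonneg (H (X i ω) (X (κ 0) ω) - H (X i ω) (X (κ 1) ω))]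
    _ ≤ b ^ 2 + 2 * ε₂ := by
        rw [integral_div, integral_add i1 i2]
        have := h.integral_kernel_sq_le_of_far (hκ 0)
        have := h.integral_kernel_sq_le_of_far (hκ 1)
        linarith

lemma integral_rowSum_pow_four_le (h : BoundedSample P X H m β r K b G ε₁ ε₂ ε₄ η) (i : ι) :
    ∫ ω, rowSum X H m i ω ^ 4 ∂P ≤ 2 * (Fintype.card ι : ℝ) ^ 4 * ε₄
      + countConst 4 * ((Fintype.card ι : ℝ) ^ 2 * (η : ℝ) ^ 2) * K ^ 4 := by
  refine h.integral_rowSum_pow_le i (R := 2) (by norm_num) le_rfl h.ε₄_nonneg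
    (by have := h.K_nonneg; positivity) h.err₄_le fun κ hκ => ?_
  have h1 := h.abs_labelInt_le (q := 4) (by norm_num) le_rfl
    (v := fun u => if u.2 then κ u.1 else i) (by
      intro e; simpa using ne_of_not_near (hκ e)) (fun _ => (0 : Fin 1))
  rw [labelInt_const h.toDegenerateSample] at h1
  simpa using h1

end BoundedSample

end SampleBounds

/-! ### The covariance of two products over quadruples -/

section Covariance

variable {Ω : Type*} [MeasurableSpace Ω] {P : Measure Ω}
  {d : ℕ} {ι : Type*} [Fintype ι] [EMetricSpace ι] {X : ι → Ω → Pt d} {H : Pt d → Pt d → ℝ}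
  {m : ℝ} {β : ℝ≥0∞} {r K b G ε₁ ε₂ ε₄ : ℝ} {η : ℕ} [IsProbabilityMeasure P]

/-- The labels that put the first two kernels into one copy and the last two into another. -/
def splitLabel (u : Fin 4 × Bool) : Fin 4 := if u.1 = 0 ∨ u.1 = 1 then 1 else 0

lemma eq_of_not_hasFork {ι V : Type*} {N : ι → ι → Prop} {v : V → ι} (hv : ¬ HasFork N v)
    {u w w' : V} (hw : w ≠ u) (hw' : w' ≠ u) (h : N (v u) (v w)) (h' : N (v u) (v w')) : w = w' := by
  by_contra hne
  exact hv ⟨u, w, w', hw, hw', hne, h, h'⟩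

namespace BoundedSample

/-- Without forks, two near vertices have no other near vertex, so together they form a group far
from everything else and can be moved as one. -/
lemma abs_labelInt_sub_le_of_pair (h : BoundedSample P X H m β r K b G ε₁ ε₂ ε₄ η)
    {v : Fin 4 × Bool → ι} (hv : ∀ e, v (e, false) ≠ v (e, true))
    (hU : ¬ HasFork (Near m) v) (u₁ u₂ : Fin 4 × Bool) (hu : u₁ ≠ u₂)
    (hN : Near m (v u₁) (v u₂)) (c c' : Fin 4 × Bool → Fin 4) (l l' : Fin 4) (h1 : c u₁ = l)
    (h2 : c u₂ = l) (hl' : ∀ u, c u ≠ l') (hll : l ≠ l')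
    (hc' : ∀ u, c' u = if u = u₁ ∨ u = u₂ then l' else c u) :
    |labelInt P X H 4 v c - labelInt P X H 4 v c'| ≤ 2 * ε₄ := by
  have hr := h.four_le
  refine abs_le_two_mul_of_enorm_le h.ε₄_nonneg
    (enorm_labelInt_sub_le h.toDegenerateSample (by norm_num) (r := r) (by exact_mod_cast hr) hv c c'
      {u₁, u₂} (l := l) (l' := l') ?_ hl' hll (by simpa using hc') (i := v u₁) (j := v u₂) ?_ ?_)
    h.err₄_le
  · intro u hu
    rcases Finset.mem_insert.mp hu with rfl | hu
    · exact h1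
    · rw [Finset.mem_singleton.mp hu, h2]
  · intro u hu
    rcases Finset.mem_insert.mp hu with rfl | hu
    · exact Or.inl rfl
    · rw [Finset.mem_singleton.mp hu]; exact Or.inr rfl
  · intro u hu' u' hu'' _
    simp only [Finset.mem_insert, Finset.mem_singleton, not_or] at hu' hu''
    rw [← not_le]
    intro hle
    rcases hu' with rfl | rfl
    · exact hu''.2 (eq_of_not_hasFork hU hu''.1 hu.symm hle hN)
    · exact hu''.1 (eq_of_not_hasFork hU hu''.2 hu hle hN.symm)

lemma abs_labelInt_le_of_isolated (h : BoundedSample P X H m β r K b G ε₁ ε₂ ε₄ η)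
    {v : Fin 4 × Bool → ι} (hv : ∀ e, v (e, false) ≠ v (e, true)) (c : Fin 4 × Bool → Fin 4)
    (l' : Fin 4) (hl' : ∀ u, c u ≠ l') (u₀ : Fin 4 × Bool)
    (hfar : ∀ u, u ≠ u₀ → c u = c u₀ → ¬ Near m (v u₀) (v u)) :
    |labelInt P X H 4 v c| ≤ 2 * ε₄ := by
  have hr := h.four_le
  exact abs_le_two_mul_of_enorm_le h.ε₄_nonneg
    (enorm_labelInt_le_of_isolated h.toDegenerateSample (by norm_num) (r := r)
      (by exact_mod_cast hr) hv c hl' u₀ (fun u hu hc => not_le.mp (hfar u hu hc))) h.err₄_le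

-- The proximity graph on the eight vertices decides. An isolated vertex makes both integrals small.
-- A fork without isolated vertices is paid for by fourth moments. Otherwise the graph is a perfect
-- matching containing the two given anchor edges, and the third and fourth entries i.e. the `true`
-- vertices are matched among themselves in one of three ways.
open Classical in
lemma abs_labelInt_sub_split_le (h : BoundedSample P X H m β r K b G ε₁ ε₂ ε₄ η)
    {v : Fin 4 × Bool → ι} (hfar : ∀ e, ¬ Near m (v (e, false)) (v (e, true)))
    (h01 : Near m (v (0, false)) (v (1, false))) (h23 : Near m (v (2, false)) (v (3, false))) :
    |labelInt P X H 4 v (fun _ => (0 : Fin 4)) - labelInt P X H 4 v splitLabel|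
      ≤ 8 * ε₄ + (if NoIsolated (Near m) v ∧ HasFork (Near m) v then 2 * K ^ 4 else 0)
        + ((if Near m (v (0, true)) (v (2, true)) ∧ Near m (v (1, true)) (v (3, true))
            then G ^ 2 else 0)
          + (if Near m (v (0, true)) (v (3, true)) ∧ Near m (v (1, true)) (v (2, true))
            then G ^ 2 else 0)) := by
  have hv : ∀ e, v (e, false) ≠ v (e, true) := fun e => ne_of_not_near (hfar e)
  have he := h.ε₄_nonneg
  have hG : 0 ≤ G ^ 2 := sq_nonneg _
  have hK : 0 ≤ K ^ 4 := pow_nonneg h.K_nonneg 4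
  have hg1 : 0 ≤ (if Near m (v (0, true)) (v (2, true)) ∧ Near m (v (1, true)) (v (3, true))
            then G ^ 2 else 0) := by split_ifs <;> simp [hG]
  have hg2 : 0 ≤ (if Near m (v (0, true)) (v (3, true)) ∧ Near m (v (1, true)) (v (2, true))
            then G ^ 2 else 0) := by split_ifs <;> simp [hG]
  by_cases hno : NoIsolated (Near m) v
  swap
  · have hno' := hno
    rw [NoIsolated] at hno'
    push Not at hno'
    obtain ⟨u₀, hu₀⟩ := hno'
    have b1 := h.abs_labelInt_le_of_isolated hv (fun _ => 0) 1 (by simp) u₀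
      (fun u hu _ => hu₀ u hu)
    have b2 := h.abs_labelInt_le_of_isolated hv splitLabel 2 (by decide) u₀
      (fun u hu _ => hu₀ u hu)
    rw [if_neg (fun hh => hno hh.1)]
    refine (abs_sub _ _).trans ?_
    linarith
  by_cases hfork : HasFork (Near m) v
  · have b1 := h.abs_labelInt_le (by norm_num) le_rfl hv (fun _ => (0 : Fin 4))
    have b2 := h.abs_labelInt_le (by norm_num) le_rfl hv splitLabel
    rw [if_pos ⟨hno, hfork⟩]
    refine (abs_sub _ _).trans ?_
    linarith
  rw [if_neg (fun hh => hfork hh.2)]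
  have uniq : ∀ {u w w' : Fin 4 × Bool}, w ≠ u → w' ≠ u → Near m (v u) (v w) → Near m (v u) (v w') →
      w = w' := eq_of_not_hasFork hfork
  have hcross : ∀ u₁ u₂ w : Fin 4 × Bool, u₁ ≠ u₂ → Near m (v u₁) (v u₂) → w ≠ u₁ → w ≠ u₂ →
      ¬ Near m (v w) (v u₁) := by
    intro u₁ u₂ w hu hN hw1 hw2 hN'
    exact hw2 (uniq hw1 hu.symm hN'.symm hN)
  -- The anchors are the `false` vertices. They are already matched with each other, so a `true`
  -- vertex near one of them would create a fork.
  have notanchor : ∀ e e' : Fin 4, ¬ Near m (v (e, true)) (v (e', false)) := by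
    intro e e' hN
    have h10 := h01.symm
    have h32 := h23.symm
    have aux : ∀ a a' : Fin 4, a ≠ a' → Near m (v (a, false)) (v (a', false)) →
        Near m (v (e, true)) (v (a, false)) → False := by
      intro a a' haa hN1 hN2
      have := uniq (u := (a, false)) (w := (e, true)) (w' := (a', false)) (by simp)
        (by simpa using haa.symm) hN2.symm hN1
      simp at this
    fin_cases e'
    · exact aux 0 1 (by decide) h01 hN
    · exact aux 1 0 (by decide) h10 hN
    · exact aux 2 3 (by decide) h23 hN
    · exact aux 3 2 (by decide) h32 hN
  have partner : ∀ e : Fin 4, ∃ e' : Fin 4, e' ≠ e ∧ Near m (v (e, true)) (v (e', true)) := by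
    intro e
    obtain ⟨⟨e', bb⟩, hne, hN⟩ := hno (e, true)
    cases bb
    · exact absurd hN (notanchor e e')
    · exact ⟨e', by simpa using hne, hN⟩
  -- If the partner of vertex (0, true) belongs to the other quadruple, then that vertex is isolated
  -- within its own copy and the split integral is small.
  have ziso : (∃ e', (e' = 2 ∨ e' = 3) ∧ Near m (v (0, true)) (v (e', true))) →
      |labelInt P X H 4 v splitLabel| ≤ 2 * ε₄ := by
    rintro ⟨e', he', hN⟩
    refine h.abs_labelInt_le_of_isolated hv splitLabel 2 (by decide) (0, true) ?_
    intro u hu hc hN'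
    have := uniq (u := (0, true)) (w := u) (w' := (e', true)) hu
      (by rcases he' with rfl | rfl <;> simp) hN' hN
    subst this
    rcases he' with rfl | rfl <;> simp [splitLabel] at hc
  -- The two matchings that cross between the quadruples, treated together: `a` is the index of the
  -- partner of (0, true) and `a'` that of the partner of (1, true).
  have hlast : ∀ a a' : Fin 4, (a = 2 ∧ a' = 3 ∨ a = 3 ∧ a' = 2) →
      Near m (v (0, true)) (v (a, true)) → Near m (v (1, true)) (v (a', true)) ∧
        |labelInt P X H 4 v (fun _ => (0 : Fin 4))| ≤ 6 * ε₄ + G ^ 2 := by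
    intro a a' haa hN
    have hN1 : Near m (v (1, true)) (v (a', true)) := by
      obtain ⟨e', hne, hN'⟩ := partner 1
      have h1 : e' ≠ 0 := by
        rintro rfl
        have := uniq (u := (0, true)) (w := (1, true)) (w' := (a, true)) (by simp)
          (by rcases haa with ⟨rfl, _⟩ | ⟨rfl, _⟩ <;> simp) hN'.symm hN
        rcases haa with ⟨rfl, _⟩ | ⟨rfl, _⟩ <;> simp at this
      have h2 : e' ≠ a := by
        rintro rfl
        have := uniq (u := (e', true)) (w := (1, true)) (w' := (0, true))
          (by simpa using hne.symm) (by simpa using h1.symm) hN'.symm hN.symm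
        simp at this
      have : e' = a' := by
        rcases haa with ⟨rfl, rfl⟩ | ⟨rfl, rfl⟩ <;> omega
      rwa [this] at hN'
    refine ⟨hN1, ?_⟩
    set c1 : Fin 4 × Bool → Fin 4 := fun u => if u = (0, false) ∨ u = (1, false) then 1 else 0
      with hc1
    set c2 : Fin 4 × Bool → Fin 4 := fun u => if u = (2, false) ∨ u = (3, false) then 2 else c1 u
      with hc2
    -- Three moves place the four matched pairs in four different copies. Each anchor pair then
    -- averages two kernels into a `Gam` function evaluated at two far nodes from different copies.
    set c3 : Fin 4 × Bool → Fin 4 := fun u => if u = (0, true) ∨ u = (a, true) then 3 else c2 u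
      with hc3
    have b1 := h.abs_labelInt_sub_le_of_pair hv hfork (0, false) (1, false) (by simp) h01
      (fun _ => 0) c1 0 1 rfl rfl (by simp) (by simp) (fun u => rfl)
    have b2 := h.abs_labelInt_sub_le_of_pair hv hfork (2, false) (3, false) (by simp) h23
      c1 c2 0 2 (by decide) (by decide) (by decide) (by decide) (fun u => rfl)
    have b3 := h.abs_labelInt_sub_le_of_pair hv hfork (0, true) (a, true)
      (by rcases haa with ⟨rfl, _⟩ | ⟨rfl, _⟩ <;> simp) hN
      c2 c3 0 3 (by decide) (by rcases haa with ⟨rfl, _⟩ | ⟨rfl, _⟩ <;> decide) (by decide)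
      (by decide) (fun u => rfl)
    have b4 : |labelInt P X H 4 v c3| ≤ G ^ 2 := by
      refine abs_le_pow_of_enorm_le h.G_nonneg (enorm_labelInt_four_le_gamNorm h.toDegenerateSample
        (l := 1) (l' := 2) (by decide) ?_ ?_ ?_ ?_ ?_ ?_ ?_ ?_ h01 h23 ?_ ?_) h.gam_le
      · rcases haa with ⟨rfl, _⟩ | ⟨rfl, _⟩ <;> decide
      · rcases haa with ⟨rfl, _⟩ | ⟨rfl, _⟩ <;> decide
      · rcases haa with ⟨rfl, _⟩ | ⟨rfl, _⟩ <;> decide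
      · rcases haa with ⟨rfl, _⟩ | ⟨rfl, _⟩ <;> decide
      · rcases haa with ⟨rfl, _⟩ | ⟨rfl, _⟩ <;> decide
      · rcases haa with ⟨rfl, _⟩ | ⟨rfl, _⟩ <;> decide
      · rcases haa with ⟨rfl, _⟩ | ⟨rfl, _⟩ <;> decide
      · rcases haa with ⟨rfl, _⟩ | ⟨rfl, _⟩ <;> decide
      · rw [← not_le]
        exact hcross (1, true) (a', true) (0, true)
          (by rcases haa with ⟨_, rfl⟩ | ⟨_, rfl⟩ <;> simp) hN1 (by simp)
          (by rcases haa with ⟨_, rfl⟩ | ⟨_, rfl⟩ <;> simp)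
      · rw [← not_le]
        rcases haa with ⟨rfl, rfl⟩ | ⟨rfl, rfl⟩
        · exact hcross (3, true) (1, true) (2, true) (by simp) hN1.symm (by simp) (by simp)
        · exact hcross (3, true) (0, true) (2, true) (by simp) hN.symm (by simp) (by simp)
    rw [abs_le] at b1 b2 b3 b4 ⊢
    constructor <;> linarith [b1.1, b1.2, b2.1, b2.2, b3.1, b3.2, b4.1, b4.2]
  obtain ⟨e', hne, hN⟩ := partner 0
  have hcases : e' = 1 ∨ e' = 2 ∨ e' = 3 := by omega
  rcases hcases with rfl | rfl | rfl
  -- The matching stays inside the quadruples. Two moves from the joint law and one from the split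
  -- law lead to the same labelling `c2`, so the two integrals differ only by mixing errors.
  · set c1 : Fin 4 × Bool → Fin 4 := fun u => if u = (0, false) ∨ u = (1, false) then 2 else 0
      with hc1
    set c2 : Fin 4 × Bool → Fin 4 := fun u => if u = (0, true) ∨ u = (1, true) then 1 else c1 u
      with hc2
    have b1 := h.abs_labelInt_sub_le_of_pair hv hfork (0, false) (1, false) (by simp) h01
      (fun _ => 0) c1 0 2 rfl rfl (by simp) (by simp) (fun u => rfl)
    have b2 := h.abs_labelInt_sub_le_of_pair hv hfork (0, true) (1, true) (by simp) hN
      c1 c2 0 1 (by decide) (by decide) (by decide) (by decide) (fun u => rfl)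
    have b3 := h.abs_labelInt_sub_le_of_pair hv hfork (0, false) (1, false) (by simp) h01
      splitLabel c2 1 2 (by decide) (by decide) (by decide) (by decide) (by decide)
    rw [abs_le] at b1 b2 b3 ⊢
    constructor <;> linarith [b1.1, b1.2, b2.1, b2.2, b3.1, b3.2]
  · obtain ⟨hN1, hb⟩ := hlast 2 3 (Or.inl ⟨rfl, rfl⟩) hN
    have hz := ziso ⟨2, Or.inl rfl, hN⟩
    rw [if_pos ⟨hN, hN1⟩]
    refine (abs_sub _ _).trans ?_
    linarith
  · obtain ⟨hN1, hb⟩ := hlast 3 2 (Or.inr ⟨rfl, rfl⟩) hN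
    have hz := ziso ⟨3, Or.inr rfl, hN⟩
    rw [if_pos (c := Near m (v (0, true)) (v (3, true)) ∧ Near m (v (1, true)) (v (2, true)))
      ⟨hN, hN1⟩]
    refine (abs_sub _ _).trans ?_
    linarith

end BoundedSample

end Covariance

/-! ### Cauchy–Schwarz inequalities -/

section CauchySchwarz

variable {Ω : Type*} [MeasurableSpace Ω] {P : Measure Ω}

lemma integral_abs_mul_le_sqrt {f g : Ω → ℝ} (hf : MemLp f 2 P) (hg : MemLp g 2 P) :
    ∫ ω, |f ω * g ω| ∂P ≤ √(∫ ω, f ω ^ 2 ∂P) * √(∫ ω, g ω ^ 2 ∂P) := by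
  have h := integral_mul_le_Lp_mul_Lq_of_nonneg (μ := P) (p := 2) (q := 2)
    (Real.holderConjugate_iff.mpr ⟨by norm_num, by norm_num⟩) (f := fun ω => |f ω|)
    (g := fun ω => |g ω|) (Eventually.of_forall fun _ => abs_nonneg _)
    (Eventually.of_forall fun _ => abs_nonneg _) (by rw [ENNReal.ofReal_ofNat]; exact hf.abs)
    (by rw [ENNReal.ofReal_ofNat]; exact hg.abs)
  simp only [← abs_mul] at h
  refine h.trans (le_of_eq ?_)
  rw [Real.sqrt_eq_rpow, Real.sqrt_eq_rpow]
  simp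

lemma integral_abs_le_sqrt [IsProbabilityMeasure P] {f : Ω → ℝ} (hf : MemLp f 2 P) :
    ∫ ω, |f ω| ∂P ≤ √(∫ ω, f ω ^ 2 ∂P) := by
  have h := integral_abs_mul_le_sqrt hf (memLp_const (1 : ℝ) (μ := P))
  simpa using h

lemma memLp_two_mul {f g : Ω → ℝ} (hf : MemLp f 4 P) (hg : MemLp g 4 P) :
    MemLp (fun ω => f ω * g ω) 2 P := by
  have : ENNReal.HolderTriple 4 4 2 := ⟨by
    rw [← two_mul, show (4 : ℝ≥0∞) = 2 * 2 by norm_num, ENNReal.mul_inv (by simp) (by simp),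
      ← mul_assoc, ENNReal.mul_inv_cancel (by simp) (by simp), one_mul]⟩
  exact hg.mul hf

lemma integral_sub_mean_sq_eq [IsProbabilityMeasure P] {f : Ω → ℝ} (hf : MemLp f 2 P) :
    ∫ ω, (f ω - ∫ a, f a ∂P) ^ 2 ∂P = variance f P :=
  (variance_eq_integral hf.aemeasurable).symm

end CauchySchwarz

/-! ### Variances of the sum over quadruples and of the near part -/

section Variance

lemma sum_ite_const {α : Type*} (s : Finset α) (p : α → Prop) [DecidablePred p] (c : ℝ) :
    ∑ x ∈ s, (if p x then c else 0) = (s.filter p).card * c := by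
  rw [← Finset.sum_filter, Finset.sum_const, nsmul_eq_mul]

variable {Ω : Type*} [MeasurableSpace Ω] {P : Measure Ω}
  {d : ℕ} {ι : Type*} [Fintype ι] [EMetricSpace ι] {X : ι → Ω → Pt d} {H : Pt d → Pt d → ℝ}
  {m : ℝ} {β : ℝ≥0∞} {r K b G ε₁ ε₂ ε₄ : ℝ} {η : ℕ} [IsProbabilityMeasure P]

open Classical in
/-- The pairs of close nodes. -/
def nearPairs (ι : Type*) [Fintype ι] [EMetricSpace ι] (m : ℝ) : Finset (ι × ι) :=
  Finset.univ.filter fun p => Near m p.1 p.2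

open Classical in
/-- The pairs of different close nodes. -/
def properPairs (ι : Type*) [Fintype ι] [EMetricSpace ι] (m : ℝ) : Finset (ι × ι) :=
  Finset.univ.filter fun p => Near m p.1 p.2 ∧ p.1 ≠ p.2

open Classical in
/-- The quadruples `(i, j, k, l)` with `i`, `j` close, `i`, `k` not close and `j`, `l` not close. -/
def quads (ι : Type*) [Fintype ι] [EMetricSpace ι] (m : ℝ) : Finset (ι × ι × ι × ι) :=
  Finset.univ.filter fun t => Near m t.1 t.2.1 ∧ ¬ Near m t.1 t.2.2.1 ∧ ¬ Near m t.2.1 t.2.2.2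

/-- The product of two kernels that belongs to a quadruple. -/
def quadTerm (X : ι → Ω → Pt d) (H : Pt d → Pt d → ℝ) (t : ι × ι × ι × ι) (ω : Ω) : ℝ :=
  H (X t.1 ω) (X t.2.2.1 ω) * H (X t.2.1 ω) (X t.2.2.2 ω)

/-- The sum of all products of two kernels over quadruples. -/
def quadSum (X : ι → Ω → Pt d) (H : Pt d → Pt d → ℝ) (m : ℝ) (ω : Ω) : ℝ :=
  ∑ t ∈ quads ι m, quadTerm X H t ω

/-- The sum of the kernel over pairs of different close nodes. -/
def nearSum (X : ι → Ω → Pt d) (H : Pt d → Pt d → ℝ) (m : ℝ) (ω : Ω) : ℝ :=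
  ∑ p ∈ properPairs ι m, H (X p.1 ω) (X p.2 ω)

/-- The eight vertices of two quadruples. -/
def quadVec (z : (ι × ι × ι × ι) × ι × ι × ι × ι) (u : Fin 4 × Bool) : ι :=
  if u.2 then ![z.1.2.2.1, z.1.2.2.2, z.2.2.2.1, z.2.2.2.2] u.1
  else ![z.1.1, z.1.2.1, z.2.1, z.2.2.1] u.1

/-- The four vertices of two pairs. -/
def pairVec (z : (ι × ι) × ι × ι) (u : Fin 2 × Bool) : ι :=
  if u.2 then ![z.1.2, z.2.2] u.1 else ![z.1.1, z.2.1] u.1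

/-- The proximity graph of the two quadruples has no isolated vertex and is no perfect matching. -/
def QuadBad (m : ℝ) (z : (ι × ι × ι × ι) × ι × ι × ι × ι) : Prop :=
  NoIsolated (Near m) (quadVec z) ∧ HasFork (Near m) (quadVec z)

/-- The third and fourth entries of the two quadruples are close in the given order. -/
def QuadMatch (m : ℝ) (z : (ι × ι × ι × ι) × ι × ι × ι × ι) : Prop :=
  Near m z.1.2.2.1 z.2.2.2.1 ∧ Near m z.1.2.2.2 z.2.2.2.2

/-- The third and fourth entries of the two quadruples are close in the opposite order. -/
def QuadCross (m : ℝ) (z : (ι × ι × ι × ι) × ι × ι × ι × ι) : Prop :=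
  Near m z.1.2.2.1 z.2.2.2.2 ∧ Near m z.1.2.2.2 z.2.2.2.1

/-- The proximity graph of the two pairs has no isolated vertex and is no perfect matching. -/
def PairBad (m : ℝ) (z : (ι × ι) × ι × ι) : Prop :=
  NoIsolated (Near m) (pairVec z) ∧ HasFork (Near m) (pairVec z)

lemma quadVec_injective : Function.Injective (quadVec (ι := ι)) := by
  rintro ⟨⟨i, j, k, l⟩, i', j', k', l'⟩ ⟨⟨a, b, c, e⟩, a', b', c', e'⟩ h
  have := fun u => congrFun h u
  have h1 := this (0, false)
  have h2 := this (1, false)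
  have h3 := this (2, false)
  have h4 := this (3, false)
  have h5 := this (0, true)
  have h6 := this (1, true)
  have h7 := this (2, true)
  have h8 := this (3, true)
  simp [quadVec] at h1 h2 h3 h4 h5 h6 h7 h8
  simp [*]

lemma pairVec_injective : Function.Injective (pairVec (ι := ι)) := by
  rintro ⟨⟨i, j⟩, i', j'⟩ ⟨⟨a, b⟩, a', b'⟩ h
  have := fun u => congrFun h u
  have h1 := this (0, false)
  have h2 := this (1, false)
  have h3 := this (0, true)
  have h4 := this (1, true)
  simp [pairVec] at h1 h2 h3 h4
  simp [*]

namespace BoundedSample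

lemma card_nearPairs_le (h : BoundedSample P X H m β r K b G ε₁ ε₂ ε₄ η) :
    (nearPairs ι m).card ≤ Fintype.card ι * η := by
  classical
  have : nearPairs ι m ⊆ (Finset.univ.sigma fun i : ι => nearFin m i).image
      fun z => (z.1, z.2) := by
    rintro ⟨i, j⟩ hp
    simpa [nearPairs] using hp
  refine (Finset.card_le_card this).trans (Finset.card_image_le.trans ?_)
  rw [Finset.card_sigma]
  refine (Finset.sum_le_sum fun i _ => h.card_near_le i).trans ?_
  simp

lemma card_quads_le (h : BoundedSample P X H m β r K b G ε₁ ε₂ ε₄ η) :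
    (quads ι m).card ≤ Fintype.card ι ^ 3 * η := by
  classical
  have h1 : (quads ι m).card ≤ (nearPairs ι m ×ˢ (Finset.univ : Finset (ι × ι))).card := by
    refine Finset.card_le_card_of_injOn (fun t => ((t.1, t.2.1), t.2.2)) (fun t ht => ?_) ?_
    · have : t ∈ quads ι m := ht
      simp only [quads, Finset.mem_filter] at this
      simp [nearPairs, this.2.1]
    · rintro ⟨i, j, k, l⟩ _ ⟨i', j', k', l'⟩ _ hh
      simp at hh
      simp [hh]
  refine h1.trans ?_
  rw [Finset.card_product, Finset.card_univ, Fintype.card_prod]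
  refine (Nat.mul_le_mul_right _ h.card_nearPairs_le).trans (le_of_eq (by ring))

lemma memLp_quadTerm (h : BoundedSample P X H m β r K b G ε₁ ε₂ ε₄ η) {t : ι × ι × ι × ι}
    (ht : t ∈ quads ι m) : MemLp (quadTerm X H t) 2 P := by
  simp only [quads, Finset.mem_filter] at ht
  exact memLp_two_mul (h.memLp_kernel (ne_of_not_near ht.2.2.1))
    (h.memLp_kernel (ne_of_not_near ht.2.2.2))

lemma memLp_quadSum (h : BoundedSample P X H m β r K b G ε₁ ε₂ ε₄ η) :
    MemLp (quadSum X H m) 2 P :=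
  memLp_finsetSum _ fun _ ht => h.memLp_quadTerm ht

lemma memLp_nearSum (h : BoundedSample P X H m β r K b G ε₁ ε₂ ε₄ η) :
    MemLp (nearSum X H m) 2 P :=
  memLp_finsetSum _ fun p hp => h.memLp_kernel_two (by
    simp only [properPairs, Finset.mem_filter] at hp
    exact hp.2.2)

lemma covariance_quadTerm (h : BoundedSample P X H m β r K b G ε₁ ε₂ ε₄ η)
    {t t' : ι × ι × ι × ι} (ht : t ∈ quads ι m) (ht' : t' ∈ quads ι m) :
    cov[quadTerm X H t, quadTerm X H t'; P]
      = labelInt P X H 4 (quadVec (t, t')) (fun _ => (0 : Fin 4))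
        - labelInt P X H 4 (quadVec (t, t')) splitLabel := by
  rw [covariance_eq_sub (h.memLp_quadTerm ht) (h.memLp_quadTerm ht'),
    labelInt_const h.toDegenerateSample, labelInt_four_split h.toDegenerateSample _ splitLabel
      (l := 1) (l' := 0) (by decide) (by decide) (by decide) (by decide) (by decide)]
  simp [quadVec, quadTerm, Fin.prod_univ_four, mul_assoc]

-- Each covariance is bounded according to its proximity graph, and the three classes are counted.
-- For eight vertices the fork count is n³η⁵; a crossing matching consists of four near pairs, which
-- gives (nη)⁴.
open Classical in
lemma variance_quadSum_le (h : BoundedSample P X H m β r K b G ε₁ ε₂ ε₄ η) :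
    variance (quadSum X H m) P ≤ 8 * ((Fintype.card ι : ℝ) ^ 3 * η) ^ 2 * ε₄
      + 2 * (countConst 8 * ((Fintype.card ι : ℝ) ^ 3 * (η : ℝ) ^ 5)) * K ^ 4
      + 2 * ((Fintype.card ι : ℝ) * η) ^ 4 * G ^ 2 := by
  have hvar : variance (quadSum X H m) P
      = ∑ z ∈ quads ι m ×ˢ quads ι m, cov[quadTerm X H z.1, quadTerm X H z.2; P] := by
    have h1 : quadSum X H m = ∑ t ∈ quads ι m, quadTerm X H t := by
      ext ω; simp [quadSum]
    rw [h1, variance_sum' fun t ht => h.memLp_quadTerm ht, Finset.sum_product]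
  set TT := quads ι m ×ˢ quads ι m with hTT
  have hG : 0 ≤ G ^ 2 := sq_nonneg _
  have hK : 0 ≤ K ^ 4 := pow_nonneg h.K_nonneg 4
  have hterm : ∀ z ∈ TT, cov[quadTerm X H z.1, quadTerm X H z.2; P]
      ≤ 8 * ε₄ + (if QuadBad m z then 2 * K ^ 4 else 0)
        + ((if QuadMatch m z then G ^ 2 else 0) + (if QuadCross m z then G ^ 2 else 0)) := by
    rintro ⟨t, t'⟩ hz
    obtain ⟨ht, ht'⟩ := Finset.mem_product.mp hz
    rw [h.covariance_quadTerm ht ht']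
    simp only [quads, Finset.mem_filter, Finset.mem_univ, true_and] at ht ht'
    refine (le_abs_self _).trans ?_
    have := h.abs_labelInt_sub_split_le (v := quadVec (t, t')) ?_ ?_ ?_
    · refine this.trans (add_le_add (add_le_add le_rfl ?_) (add_le_add ?_ ?_)) <;>
        exact le_of_eq (if_congr Iff.rfl rfl rfl)
    · intro e
      fin_cases e
      · simpa [quadVec] using ht.2.1
      · simpa [quadVec] using ht.2.2
      · simpa [quadVec] using ht'.2.1
      · simpa [quadVec] using ht'.2.2
    · simpa [quadVec] using ht.1
    · simpa [quadVec] using ht'.1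
  have hcardTT : (TT.card : ℝ) ≤ ((Fintype.card ι : ℝ) ^ 3 * η) ^ 2 := by
    rw [hTT, Finset.card_product, ← sq]
    have := h.card_quads_le
    have : (quads ι m).card ^ 2 ≤ (Fintype.card ι ^ 3 * η) ^ 2 := Nat.pow_le_pow_left this 2
    exact_mod_cast this
  have hcardbad : ((TT.filter (QuadBad m)).card : ℝ)
      ≤ countConst 8 * ((Fintype.card ι : ℝ) ^ 3 * (η : ℝ) ^ 5) := by
    have h1 := card_noIsolated_hasFork_le (N := Near m) (η := η) (fun x y => Near.symm)
      (by simpa [nearFin] using h.card_near_le) h.η_le (R := 3) (V := Fin 4 × Bool) (by simp)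
      ((TT.filter (QuadBad m)).image quadVec) (by
        intro v hv
        obtain ⟨z, hz, rfl⟩ := Finset.mem_image.mp hv
        exact (Finset.mem_filter.mp hz).2)
    rw [Finset.card_image_of_injective _ quadVec_injective] at h1
    exact_mod_cast h1
  -- Two anchor pairs and two cross pairs determine the two quadruples, in either order of matching.
  have hpairs : ∀ p : (ι × ι × ι × ι) × ι × ι × ι × ι → Prop,
      (∀ z, p z → QuadMatch m z) ∨ (∀ z, p z → QuadCross m z) →
      ((TT.filter p).card : ℝ) ≤ ((Fintype.card ι : ℝ) * η) ^ 4 := by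
    intro p hp
    have h1 : (TT.filter p).card ≤ ((nearPairs ι m ×ˢ nearPairs ι m) ×ˢ
        (nearPairs ι m ×ˢ nearPairs ι m)).card := by
      rcases hp with hp | hp
      · refine Finset.card_le_card_of_injOn (fun z => (((z.1.1, z.1.2.1), (z.2.1, z.2.2.1)),
          ((z.1.2.2.1, z.2.2.2.1), (z.1.2.2.2, z.2.2.2.2)))) (fun z hz => ?_) ?_
        · have hz' : z ∈ TT.filter p := hz
          rw [Finset.mem_filter, hTT, Finset.mem_product] at hz'
          have hz2 := hp z hz'.2
          simp only [quads, Finset.mem_filter, Finset.mem_univ, true_and] at hz'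
          simp [nearPairs, hz'.1.1.1, hz'.1.2.1, hz2.1, hz2.2]
        · rintro ⟨⟨i, j, k, l⟩, i', j', k', l'⟩ _ ⟨⟨a, b, c, e⟩, a', b', c', e'⟩ _ hh
          simp at hh
          simp [hh]
      · refine Finset.card_le_card_of_injOn (fun z => (((z.1.1, z.1.2.1), (z.2.1, z.2.2.1)),
          ((z.1.2.2.1, z.2.2.2.2), (z.1.2.2.2, z.2.2.2.1)))) (fun z hz => ?_) ?_
        · have hz' : z ∈ TT.filter p := hz
          rw [Finset.mem_filter, hTT, Finset.mem_product] at hz'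
          have hz2 := hp z hz'.2
          simp only [quads, Finset.mem_filter, Finset.mem_univ, true_and] at hz'
          simp [nearPairs, hz'.1.1.1, hz'.1.2.1, hz2.1, hz2.2]
        · rintro ⟨⟨i, j, k, l⟩, i', j', k', l'⟩ _ ⟨⟨a, b, c, e⟩, a', b', c', e'⟩ _ hh
          simp at hh
          simp [hh]
    have h2 : (TT.filter p).card ≤ (Fintype.card ι * η) ^ 4 := by
      refine h1.trans ?_
      simp only [Finset.card_product]
      have h3 := h.card_nearPairs_le
      calc _ = (nearPairs ι m).card ^ 4 := by ring
        _ ≤ _ := Nat.pow_le_pow_left h3 4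
    exact_mod_cast h2
  rw [hvar]
  refine (Finset.sum_le_sum hterm).trans ?_
  simp only [Finset.sum_add_distrib, sum_ite_const, Finset.sum_const, nsmul_eq_mul]
  have := h.ε₄_nonneg
  have b1 := mul_le_mul_of_nonneg_right hcardTT (by linarith : 0 ≤ 8 * ε₄)
  have b2 := mul_le_mul_of_nonneg_right hcardbad (by linarith : 0 ≤ 2 * K ^ 4)
  have b3 := mul_le_mul_of_nonneg_right (hpairs (QuadMatch m) (Or.inl fun _ hh => hh)) hG
  have b4 := mul_le_mul_of_nonneg_right (hpairs (QuadCross m) (Or.inr fun _ hh => hh)) hG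
  linarith

/-- The labels of two independent pairs. -/
def _root_.DegenerateUStat.pairLabel (u : Fin 2 × Bool) : Fin 2 := u.1

lemma labelInt_two_split (h : BoundedSample P X H m β r K b G ε₁ ε₂ ε₄ η) (v : Fin 2 × Bool → ι) :
    labelInt P X H 2 v pairLabel
      = (∫ ω, H (X (v (0, false)) ω) (X (v (0, true)) ω) ∂P) *
        ∫ ω, H (X (v (1, false)) ω) (X (v (1, true)) ω) ∂P := by
  rw [labelInt_eq h.toDegenerateSample, ← integral_prod_mul,
    ← map_pi_pair (L := Fin 2) (l := 0) (l' := 1) (by simp), integral_map]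
  · simp only [prodKer, Fin.prod_univ_two, labelVec, pairLabel]
  · exact ((measurable_pi_apply _).prodMk (measurable_pi_apply _)).aemeasurable
  · have hk := fun i j => measurable_kernel (X := X) h.measX h.measH i j
    exact (((hk _ _).comp measurable_fst).mul ((hk _ _).comp measurable_snd)).aestronglyMeasurable

lemma covariance_kernel (h : BoundedSample P X H m β r K b G ε₁ ε₂ ε₄ η) {p p' : ι × ι}
    (hp : p.1 ≠ p.2) (hp' : p'.1 ≠ p'.2) :
    cov[fun ω => H (X p.1 ω) (X p.2 ω), fun ω => H (X p'.1 ω) (X p'.2 ω); P]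
      = labelInt P X H 2 (pairVec (p, p')) (fun _ => (0 : Fin 2))
        - labelInt P X H 2 (pairVec (p, p')) pairLabel := by
  rw [covariance_eq_sub (h.memLp_kernel_two hp) (h.memLp_kernel_two hp'),
    labelInt_const h.toDegenerateSample, h.labelInt_two_split]
  simp [pairVec]

-- Two near pairs with no edge between them decouple as groups of two. Any edge between them creates
-- a fork on four vertices, which leaves at most a multiple of nη³ configurations.
open Classical in
lemma variance_nearSum_le (h : BoundedSample P X H m β r K b G ε₁ ε₂ ε₄ η) :
    variance (nearSum X H m) P ≤ 2 * ((Fintype.card ι : ℝ) * η) ^ 2 * ε₂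
      + 2 * (countConst 4 * ((Fintype.card ι : ℝ) * (η : ℝ) ^ 3)) * K ^ 2 := by
  have hr := h.four_le
  have hprop : ∀ p ∈ properPairs ι m, p.1 ≠ p.2 := fun p hp => by
    simp only [properPairs, Finset.mem_filter] at hp
    exact hp.2.2
  have hvar : variance (nearSum X H m) P = ∑ z ∈ properPairs ι m ×ˢ properPairs ι m,
      cov[fun ω => H (X z.1.1 ω) (X z.1.2 ω), fun ω => H (X z.2.1 ω) (X z.2.2 ω); P] := by
    have h1 : nearSum X H m = ∑ p ∈ properPairs ι m, fun ω => H (X p.1 ω) (X p.2 ω) := by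
      ext ω; simp [nearSum]
    rw [h1, variance_sum' fun p hp => h.memLp_kernel_two (hprop p hp), Finset.sum_product]
  set TT := properPairs ι m ×ˢ properPairs ι m with hTT
  have hK : 0 ≤ K ^ 2 := pow_nonneg h.K_nonneg 2
  have hε := h.ε₂_nonneg
  have hterm : ∀ z ∈ TT,
      cov[fun ω => H (X z.1.1 ω) (X z.1.2 ω), fun ω => H (X z.2.1 ω) (X z.2.2 ω); P]
      ≤ 2 * ε₂ + (if PairBad m z then 2 * K ^ 2 else 0) := by
    rintro ⟨p, p'⟩ hz
    obtain ⟨hp, hp'⟩ := Finset.mem_product.mp hz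
    rw [h.covariance_kernel (hprop p hp) (hprop p' hp')]
    have hne : ∀ e, pairVec (p, p') (e, false) ≠ pairVec (p, p') (e, true) := by
      intro e
      fin_cases e
      · simpa [pairVec] using hprop p hp
      · simpa [pairVec] using hprop p' hp'
    simp only [properPairs, Finset.mem_filter, Finset.mem_univ, true_and] at hp hp'
    refine (le_abs_self _).trans ?_
    by_cases hcross : ∀ bb bb', ¬ Near m (pairVec (p, p') (1, bb)) (pairVec (p, p') (0, bb'))
    · have h1 := enorm_labelInt_sub_le h.toDegenerateSample (q := 2) (by norm_num) (r := r)
        (by norm_num; linarith) hne (fun _ => (0 : Fin 2)) pairLabel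
        (Finset.univ.filter fun u => u.1 = 1) (l := 0) (l' := 1) (by simp) (by simp) (by simp)
        (by decide) (i := p'.1) (j := p'.2) (by
          rintro ⟨e, bb⟩ hu
          simp at hu
          subst hu
          cases bb <;> simp [pairVec]) (by
          rintro ⟨e, bb⟩ hu ⟨e', bb'⟩ hu' _
          simp at hu hu'
          have : e' = 0 := by omega
          subst hu this
          exact not_le.mp (hcross bb bb'))
      have h2 := abs_le_two_mul_of_enorm_le h.ε₂_nonneg h1 h.err₂_le
      refine h2.trans ?_
      split_ifs <;> linarith
    · push Not at hcross
      obtain ⟨bb, bb', hN⟩ := hcross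
      have hin : ∀ e c c', Near m (pairVec (p, p') (e, c)) (pairVec (p, p') (e, c')) := by
        intro e c c'
        fin_cases e <;> cases c <;> cases c' <;>
          simp [pairVec, near_refl, hp.1, hp.1.symm, hp'.1, hp'.1.symm]
      -- Each vertex is near the other end of its own pair. The vertex on the connecting edge has
      -- this neighbour and a second one in the other pair.
      have hb : PairBad m (p, p') := by
        refine ⟨fun u => ⟨(u.1, !u.2), ?_, hin _ _ _⟩, (1, bb), (1, !bb), (0, bb'), ?_, ?_, ?_,
          hin _ _ _, hN⟩
        · rintro hh
          have := congrArg Prod.snd hh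
          simp at this
        · simp
        · simp
        · simp
      rw [if_pos hb]
      have b1 := h.abs_labelInt_le (q := 2) (by norm_num) (by norm_num) hne (fun _ => (0 : Fin 2))
      have b2 := h.abs_labelInt_le (q := 2) (by norm_num) (by norm_num) hne pairLabel
      refine (abs_sub _ _).trans ?_
      linarith
  have hcardTT : (TT.card : ℝ) ≤ ((Fintype.card ι : ℝ) * η) ^ 2 := by
    rw [hTT, Finset.card_product, ← sq]
    have h1 : (properPairs ι m).card ≤ (nearPairs ι m).card := by
      refine Finset.card_le_card fun p hp => ?_
      simp only [properPairs, nearPairs, Finset.mem_filter, Finset.mem_univ, true_and] at hp ⊢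
      exact hp.1
    have : (properPairs ι m).card ^ 2 ≤ (Fintype.card ι * η) ^ 2 :=
      Nat.pow_le_pow_left (h1.trans h.card_nearPairs_le) 2
    exact_mod_cast this
  have hcardbad : ((TT.filter (PairBad m)).card : ℝ)
      ≤ countConst 4 * ((Fintype.card ι : ℝ) * (η : ℝ) ^ 3) := by
    have h1 := card_noIsolated_hasFork_le (N := Near m) (η := η) (fun x y => Near.symm)
      (by simpa [nearFin] using h.card_near_le) h.η_le (R := 1) (V := Fin 2 × Bool) (by simp)
      ((TT.filter (PairBad m)).image pairVec) (by
        intro v hv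
        obtain ⟨z, hz, rfl⟩ := Finset.mem_image.mp hv
        exact (Finset.mem_filter.mp hz).2)
    rw [Finset.card_image_of_injective _ pairVec_injective, pow_one] at h1
    exact_mod_cast h1
  rw [hvar]
  refine (Finset.sum_le_sum hterm).trans ?_
  simp only [Finset.sum_add_distrib, sum_ite_const, Finset.sum_const, nsmul_eq_mul]
  have b1 := mul_le_mul_of_nonneg_right hcardTT (by linarith : 0 ≤ 2 * ε₂)
  have b2 := mul_le_mul_of_nonneg_right hcardbad (by linarith : 0 ≤ 2 * K ^ 2)
  linarith

end BoundedSample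

end Variance

/-! ### Splitting the statistic around a node, and the moments of the pieces -/

section Decomposition

variable {Ω : Type*} [MeasurableSpace Ω] {P : Measure Ω}
  {d : ℕ} {ι : Type*} [Fintype ι] [EMetricSpace ι] {X : ι → Ω → Pt d} {H : Pt d → Pt d → ℝ}
  {m : ℝ} {β : ℝ≥0∞} {r K b G ε₁ ε₂ ε₄ : ℝ} {η : ℕ}

open Classical in
/-- The kernel at two nodes that are not close, and zero at close nodes. -/
def farKer (X : ι → Ω → Pt d) (H : Pt d → Pt d → ℝ) (m : ℝ) (i j : ι) (ω : Ω) : ℝ :=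
  if Near m i j then 0 else H (X i ω) (X j ω)

/-- The sum of the kernel over the pairs of nodes that are not close. -/
def farSum (X : ι → Ω → Pt d) (H : Pt d → Pt d → ℝ) (m : ℝ) (ω : Ω) : ℝ :=
  ∑ i, rowSum X H m i ω

/-- The part of `farSum` that does not involve the nodes close to `i`. -/
def awaySum (X : ι → Ω → Pt d) (H : Pt d → Pt d → ℝ) (m : ℝ) (i : ι) (ω : Ω) : ℝ :=
  ∑ j ∈ farFin m i, ∑ l ∈ farFin m i, farKer X H m j l ω

/-- The part of `farSum` in which both nodes are close to `i`. -/
def localSum (X : ι → Ω → Pt d) (H : Pt d → Pt d → ℝ) (m : ℝ) (i : ι) (ω : Ω) : ℝ :=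
  ∑ j ∈ nearFin m i, ∑ l ∈ nearFin m i, farKer X H m j l ω

/-- The part of `farSum` that involves a node close to `i`. -/
def touchSum (X : ι → Ω → Pt d) (H : Pt d → Pt d → ℝ) (m : ℝ) (i : ι) (ω : Ω) : ℝ :=
  2 * ∑ j ∈ nearFin m i, rowSum X H m j ω - localSum X H m i ω

lemma farKer_of_not_near {i j : ι} (hij : ¬ Near m i j) :
    farKer X H m i j = fun ω => H (X i ω) (X j ω) := by
  ext ω; simp [farKer, hij]

lemma farKer_of_near {i j : ι} (hij : Near m i j) : farKer X H m i j = fun _ => 0 := by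
  ext ω; simp [farKer, hij]

lemma rowSum_eq_sum_farKer (i : ι) (ω : Ω) : rowSum X H m i ω = ∑ k, farKer X H m i k ω := by
  classical
  rw [rowSum, farFin, Finset.sum_filter]
  refine Finset.sum_congr rfl fun k _ => ?_
  by_cases h : Near m i k <;> simp [farKer, h]

lemma sum_near_add_sum_far (i : ι) (f : ι → ℝ) :
    ∑ j, f j = ∑ j ∈ nearFin m i, f j + ∑ j ∈ farFin m i, f j := by
  classical
  rw [nearFin, farFin, Finset.sum_filter_add_sum_filter_not]

/-- Inclusion–exclusion over whether each index is near `i`: by symmetry of the kernel the two mixed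
parts agree, so doubling the rows of near nodes counts the local part once too often. -/
lemma farSum_eq (hsymm : ∀ x y, H x y = H y x) (i : ι) (ω : Ω) :
    farSum X H m ω = awaySum X H m i ω + touchSum X H m i ω := by
  classical
  have hs : ∀ j l, farKer X H m j l ω = farKer X H m l j ω := by
    intro j l
    by_cases h : Near m j l
    · simp [farKer, h, h.symm]
    · have h' : ¬ Near m l j := fun hh => h hh.symm
      simp only [farKer, h, h', if_false]
      exact hsymm _ _
  have h1 : ∀ s : Finset ι, ∑ j ∈ s, ∑ l, farKer X H m j l ω
      = ∑ j ∈ s, ∑ l ∈ nearFin m i, farKer X H m j l ω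
        + ∑ j ∈ s, ∑ l ∈ farFin m i, farKer X H m j l ω := fun s => by
    rw [← Finset.sum_add_distrib]
    exact Finset.sum_congr rfl fun j _ => sum_near_add_sum_far i _
  have h2 : ∑ j ∈ farFin m i, ∑ l ∈ nearFin m i, farKer X H m j l ω
      = ∑ j ∈ nearFin m i, ∑ l ∈ farFin m i, farKer X H m j l ω := by
    rw [Finset.sum_comm]
    exact Finset.sum_congr rfl fun j _ => Finset.sum_congr rfl fun l _ => hs _ _
  simp only [farSum, touchSum, awaySum, localSum, rowSum_eq_sum_farKer]
  rw [sum_near_add_sum_far (m := m) i, h1 (nearFin m i), h1 (farFin m i), h2]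
  ring

lemma uStat_eq (ω : Ω) : uStat X H ω = farSum X H m ω + nearSum X H m ω := by
  classical
  have h1 : nearSum X H m ω = ∑ i, ∑ k,
      if Near m i k ∧ i ≠ k then H (X i ω) (X k ω) else 0 := by
    rw [nearSum, properPairs, Finset.sum_filter, ← Finset.univ_product_univ, Finset.sum_product]
  rw [h1, farSum, ← Finset.sum_add_distrib, uStat]
  refine Finset.sum_congr rfl fun i _ => ?_
  rw [rowSum_eq_sum_farKer, ← Finset.sum_add_distrib, Finset.sum_filter]
  refine Finset.sum_congr rfl fun k _ => ?_
  by_cases hN : Near m i k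
  · by_cases hik : k = i
    · subst hik; simp [farKer, hN]
    · simp [farKer, hN, hik, Ne.symm hik]
  · have := ne_of_not_near hN
    simp [farKer, hN, this.symm]

/-- The products of rows of near nodes, once expanded, are indexed by `quads`. This identifies the
quantity whose fluctuation Stein's method requires. -/
lemma sum_rowSum_mul_touchSum (ω : Ω) :
    ∑ i, rowSum X H m i ω * touchSum X H m i ω
      = 2 * quadSum X H m ω - ∑ i, rowSum X H m i ω * localSum X H m i ω := by
  classical
  have h1 : quadSum X H m ω = ∑ i, ∑ j ∈ nearFin m i, rowSum X H m i ω * rowSum X H m j ω := by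
    simp only [rowSum_eq_sum_farKer, Finset.sum_mul_sum]
    rw [quadSum, quads, Finset.sum_filter, ← Finset.univ_product_univ, Finset.sum_product]
    refine Finset.sum_congr rfl fun i _ => ?_
    rw [nearFin, Finset.sum_filter, ← Finset.univ_product_univ, Finset.sum_product]
    refine Finset.sum_congr rfl fun j _ => ?_
    by_cases hN : Near m i j
    · rw [if_pos hN, ← Finset.univ_product_univ, Finset.sum_product]
      refine Finset.sum_congr rfl fun k _ => Finset.sum_congr rfl fun l _ => ?_
      by_cases h1 : Near m i k <;> by_cases h2 : Near m j l <;>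
        simp [farKer, quadTerm, hN, h1, h2]
    · rw [if_neg hN]
      exact Finset.sum_eq_zero fun k _ => by simp [hN]
  rw [h1, Finset.mul_sum, ← Finset.sum_sub_distrib]
  refine Finset.sum_congr rfl fun i _ => ?_
  rw [touchSum, ← Finset.mul_sum]
  ring

lemma sum_pow_four_le {α : Type*} (s : Finset α) (f : α → ℝ) :
    (∑ x ∈ s, f x) ^ 4 ≤ (s.card : ℝ) ^ 3 * ∑ x ∈ s, f x ^ 4 := by
  have h1 : (∑ x ∈ s, f x) ^ 2 ≤ s.card * ∑ x ∈ s, f x ^ 2 := sq_sum_le_card_mul_sum_sq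
  have h2 : (∑ x ∈ s, f x ^ 2) ^ 2 ≤ s.card * ∑ x ∈ s, (f x ^ 2) ^ 2 := sq_sum_le_card_mul_sum_sq
  have h3 : ((∑ x ∈ s, f x) ^ 2) ^ 2 ≤ (s.card * ∑ x ∈ s, f x ^ 2) ^ 2 :=
    pow_le_pow_left₀ (sq_nonneg _) h1 2
  have h4 : (s.card : ℝ) ^ 2 * (∑ x ∈ s, f x ^ 2) ^ 2
      ≤ (s.card : ℝ) ^ 2 * (s.card * ∑ x ∈ s, (f x ^ 2) ^ 2) :=
    mul_le_mul_of_nonneg_left h2 (by positivity)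
  calc (∑ x ∈ s, f x) ^ 4 = ((∑ x ∈ s, f x) ^ 2) ^ 2 := by ring
    _ ≤ _ := h3
    _ = (s.card : ℝ) ^ 2 * (∑ x ∈ s, f x ^ 2) ^ 2 := by ring
    _ ≤ _ := h4
    _ = (s.card : ℝ) ^ 3 * ∑ x ∈ s, f x ^ 4 := by
        simp only [← pow_mul]
        ring

variable [IsProbabilityMeasure P]

namespace BoundedSample

lemma memLp_farKer (h : BoundedSample P X H m β r K b G ε₁ ε₂ ε₄ η) (i j : ι) :
    MemLp (farKer X H m i j) 4 P := by
  by_cases hN : Near m i j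
  · rw [farKer_of_near hN]; exact memLp_const 0
  · rw [farKer_of_not_near hN]; exact h.memLp_kernel (ne_of_not_near hN)

lemma memLp_awaySum (h : BoundedSample P X H m β r K b G ε₁ ε₂ ε₄ η) (i : ι) :
    MemLp (awaySum X H m i) 4 P :=
  memLp_finsetSum _ fun j _ => memLp_finsetSum _ fun l _ => h.memLp_farKer j l

lemma memLp_localSum (h : BoundedSample P X H m β r K b G ε₁ ε₂ ε₄ η) (i : ι) :
    MemLp (localSum X H m i) 4 P :=
  memLp_finsetSum _ fun j _ => memLp_finsetSum _ fun l _ => h.memLp_farKer j l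

lemma memLp_farSum (h : BoundedSample P X H m β r K b G ε₁ ε₂ ε₄ η) :
    MemLp (farSum X H m) 4 P :=
  memLp_finsetSum _ fun i _ => h.rowSum_memLp i

lemma memLp_touchSum (h : BoundedSample P X H m β r K b G ε₁ ε₂ ε₄ η) (i : ι) :
    MemLp (touchSum X H m i) 4 P :=
  ((memLp_finsetSum _ fun j _ => h.rowSum_memLp j).const_mul 2).sub (h.memLp_localSum i)

lemma integral_farKer_sq_le (h : BoundedSample P X H m β r K b G ε₁ ε₂ ε₄ η) (i j : ι) :
    ∫ ω, farKer X H m i j ω ^ 2 ∂P ≤ K ^ 2 := by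
  by_cases hN : Near m i j
  · rw [farKer_of_near hN]; simp [sq_nonneg]
  · rw [farKer_of_not_near hN]; exact h.integral_kernel_sq_le (ne_of_not_near hN)

lemma integral_farKer_pow_four_le (h : BoundedSample P X H m β r K b G ε₁ ε₂ ε₄ η) (i j : ι) :
    ∫ ω, farKer X H m i j ω ^ 4 ∂P ≤ K ^ 4 := by
  have hK := h.K_nonneg
  by_cases hN : Near m i j
  · rw [farKer_of_near hN]; simp; positivity
  · rw [farKer_of_not_near hN]; exact h.integral_kernel_pow_four_le (ne_of_not_near hN)

lemma _root_.DegenerateUStat.integrable_pow_four {f : Ω → ℝ} (hf : MemLp f 4 P) :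
    Integrable (fun ω => f ω ^ 4) P := by
  have := hf.integrable_norm_pow (by norm_num)
  refine this.congr (Eventually.of_forall fun ω => ?_)
  simp [Even.pow_abs (by decide : Even 4)]

lemma _root_.DegenerateUStat.integrable_sq_of_four {f : Ω → ℝ} (hf : MemLp f 4 P) :
    Integrable (fun ω => f ω ^ 2) P :=
  (hf.mono_exponent (p := 2) (by norm_num)).integrable_sq

lemma localSum_eq (i : ι) (ω : Ω) : localSum X H m i ω
    = ∑ z ∈ nearFin m i ×ˢ nearFin m i, farKer X H m z.1 z.2 ω := by
  rw [Finset.sum_product]; rfl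

lemma card_local_le (h : BoundedSample P X H m β r K b G ε₁ ε₂ ε₄ η) (i : ι) :
    ((nearFin m i ×ˢ nearFin m i).card : ℝ) ≤ (η : ℝ) ^ 2 := by
  rw [Finset.card_product]
  have : (nearFin m i).card * (nearFin m i).card ≤ η ^ 2 := by
    rw [sq]; exact Nat.mul_le_mul (h.card_near_le i) (h.card_near_le i)
  exact_mod_cast this

lemma integral_localSum_sq_le (h : BoundedSample P X H m β r K b G ε₁ ε₂ ε₄ η) (i : ι) :
    ∫ ω, localSum X H m i ω ^ 2 ∂P ≤ ((η : ℝ) ^ 2 * K) ^ 2 := by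
  set s := nearFin m i ×ˢ nearFin m i with hs
  have hint : ∀ z ∈ s, Integrable (fun ω => farKer X H m z.1 z.2 ω ^ 2) P := fun z _ =>
    integrable_sq_of_four (h.memLp_farKer z.1 z.2)
  calc ∫ ω, localSum X H m i ω ^ 2 ∂P
      ≤ ∫ ω, (s.card : ℝ) * ∑ z ∈ s, farKer X H m z.1 z.2 ω ^ 2 ∂P := by
        refine integral_mono (integrable_sq_of_four (h.memLp_localSum i))
          ((integrable_finsetSum _ hint).const_mul _) fun ω => ?_
        simp only [localSum_eq]
        exact sq_sum_le_card_mul_sum_sq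
    _ = (s.card : ℝ) * ∑ z ∈ s, ∫ ω, farKer X H m z.1 z.2 ω ^ 2 ∂P := by
        rw [integral_const_mul, integral_finsetSum _ hint]
    _ ≤ (s.card : ℝ) * ∑ z ∈ s, K ^ 2 := by
        gcongr with z _
        exact h.integral_farKer_sq_le _ _
    _ = (s.card : ℝ) ^ 2 * K ^ 2 := by
        rw [Finset.sum_const, nsmul_eq_mul]; ring
    _ ≤ ((η : ℝ) ^ 2) ^ 2 * K ^ 2 := by
        have := h.card_local_le i
        gcongr
    _ = _ := by ring

lemma integral_localSum_pow_four_le (h : BoundedSample P X H m β r K b G ε₁ ε₂ ε₄ η) (i : ι) :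
    ∫ ω, localSum X H m i ω ^ 4 ∂P ≤ ((η : ℝ) ^ 2 * K) ^ 4 := by
  have hK := h.K_nonneg
  set s := nearFin m i ×ˢ nearFin m i with hs
  have hint : ∀ z ∈ s, Integrable (fun ω => farKer X H m z.1 z.2 ω ^ 4) P := fun z _ =>
    integrable_pow_four (h.memLp_farKer z.1 z.2)
  calc ∫ ω, localSum X H m i ω ^ 4 ∂P
      ≤ ∫ ω, (s.card : ℝ) ^ 3 * ∑ z ∈ s, farKer X H m z.1 z.2 ω ^ 4 ∂P := by
        refine integral_mono (integrable_pow_four (h.memLp_localSum i))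
          ((integrable_finsetSum _ hint).const_mul _) fun ω => ?_
        simp only [localSum_eq]
        exact sum_pow_four_le _ _
    _ = (s.card : ℝ) ^ 3 * ∑ z ∈ s, ∫ ω, farKer X H m z.1 z.2 ω ^ 4 ∂P := by
        rw [integral_const_mul, integral_finsetSum _ hint]
    _ ≤ (s.card : ℝ) ^ 3 * ∑ z ∈ s, K ^ 4 := by
        gcongr with z _
        exact h.integral_farKer_pow_four_le _ _
    _ = (s.card : ℝ) ^ 4 * K ^ 4 := by
        rw [Finset.sum_const, nsmul_eq_mul]; ring
    _ ≤ ((η : ℝ) ^ 2) ^ 4 * K ^ 4 := by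
        have := h.card_local_le i
        gcongr
    _ = _ := by ring

/-- Power-mean inequality over at most `η` rows. The constants come from (2x - y)⁴ ≤ 128x⁴ + 8y⁴. -/
lemma integral_touchSum_pow_four_le (h : BoundedSample P X H m β r K b G ε₁ ε₂ ε₄ η) (i : ι)
    {a₄ : ℝ} (ha : ∀ j, ∫ ω, rowSum X H m j ω ^ 4 ∂P ≤ a₄) (ha0 : 0 ≤ a₄) :
    ∫ ω, touchSum X H m i ω ^ 4 ∂P ≤ 128 * (η : ℝ) ^ 4 * a₄ + 8 * ((η : ℝ) ^ 2 * K) ^ 4 := by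
  have hint : ∀ j ∈ nearFin m i, Integrable (fun ω => rowSum X H m j ω ^ 4) P := fun j _ =>
    integrable_pow_four (h.rowSum_memLp j)
  have hc : ((nearFin m i).card : ℝ) ≤ η := by exact_mod_cast h.card_near_le i
  have hI := (integrable_finsetSum _ hint).const_mul (((nearFin m i).card : ℝ) ^ 3)
  calc ∫ ω, touchSum X H m i ω ^ 4 ∂P
      ≤ ∫ ω, (128 * (((nearFin m i).card : ℝ) ^ 3 * ∑ j ∈ nearFin m i, rowSum X H m j ω ^ 4)
          + 8 * localSum X H m i ω ^ 4) ∂P := by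
        refine integral_mono (integrable_pow_four (h.memLp_touchSum i))
          ((hI.const_mul 128).add ((integrable_pow_four (h.memLp_localSum i)).const_mul 8))
          fun ω => ?_
        have h1 := sum_pow_four_le (nearFin m i) fun j => rowSum X H m j ω
        have h2 : ∀ x y : ℝ, (2 * x - y) ^ 4 ≤ 128 * x ^ 4 + 8 * y ^ 4 := by
          intro x y
          have e1 : (2 * x - y) ^ 2 ≤ 2 * ((2 * x) ^ 2 + y ^ 2) := by nlinarith [sq_nonneg (2 * x + y)]
          have e2 : ((2 * x - y) ^ 2) ^ 2 ≤ (2 * ((2 * x) ^ 2 + y ^ 2)) ^ 2 :=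
            pow_le_pow_left₀ (sq_nonneg _) e1 2
          nlinarith [sq_nonneg ((2 * x) ^ 2 - y ^ 2)]
        have h3 := h2 (∑ j ∈ nearFin m i, rowSum X H m j ω) (localSum X H m i ω)
        show touchSum X H m i ω ^ 4 ≤ _
        rw [touchSum]
        linarith
    _ = 128 * (((nearFin m i).card : ℝ) ^ 3 * ∑ j ∈ nearFin m i, ∫ ω, rowSum X H m j ω ^ 4 ∂P)
          + 8 * ∫ ω, localSum X H m i ω ^ 4 ∂P := by
        rw [integral_add (hI.const_mul 128) ((integrable_pow_four (h.memLp_localSum i)).const_mul 8),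
          integral_const_mul, integral_const_mul, integral_const_mul, integral_finsetSum _ hint]
    _ ≤ 128 * (((nearFin m i).card : ℝ) ^ 3 * ∑ j ∈ nearFin m i, a₄)
          + 8 * ((η : ℝ) ^ 2 * K) ^ 4 := by
        gcongr with j _
        · exact ha j
        · exact h.integral_localSum_pow_four_le i
    _ = 128 * ((nearFin m i).card : ℝ) ^ 4 * a₄ + 8 * ((η : ℝ) ^ 2 * K) ^ 4 := by
        rw [Finset.sum_const, nsmul_eq_mul]; ring
    _ ≤ _ := by gcongr

/-- One node is decoupled from everything else at once. Only a single kernel needs a moment because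
the other factor is bounded, so the exponent is 1 - 1/r. -/
lemma _root_.DegenerateUStat.enorm_integral_kernel_mul_le {T : Type*} [MeasurableSpace T]
    (h : DegenerateSample P X H m β) {i k : ι} (hne : i ≠ k) {W : Ω → T} (mW : Measurable W)
    {ev : T → Pt d} (mev : Measurable ev) (hev : ∀ ω, ev (W ω) = X k ω)
    {Φ : T → ℝ} (mΦ : Measurable Φ) {M : ℝ} (hM : ∀ y, |Φ y| ≤ M)
    (hTV : TVClose (P.map fun ω => (X i ω, W ω)) ((P.map (X i)).prod (P.map W)) β)
    {r : ℝ} (hr : 1 ≤ r) :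
    ‖∫ ω, H (X i ω) (X k ω) * Φ (W ω) ∂P‖ₑ
      ≤ 2 * (β ^ (1 - 1 / r) * (ENNReal.ofReal M * kernelNorm P X H (ENNReal.ofReal r))) := by
  have mX := h.measX i
  have mker : Measurable fun z : Pt d × T => H z.1 (ev z.2) :=
    h.measH.comp (measurable_fst.prodMk (mev.comp measurable_snd))
  have mF : Measurable fun z : Pt d × T => H z.1 (ev z.2) * Φ z.2 :=
    mker.mul (mΦ.comp measurable_snd)
  have := Measure.isProbabilityMeasure_map (μ := P) mX.aemeasurable
  have := Measure.isProbabilityMeasure_map (μ := P) mW.aemeasurable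
  have : IsProbabilityMeasure (P.map fun ω => (X i ω, W ω)) :=
    Measure.isProbabilityMeasure_map (mX.prodMk mW).aemeasurable
  have hbd : ∀ μ : Measure (Pt d × T),
      eLpNorm (fun z : Pt d × T => H z.1 (ev z.2)) (ENNReal.ofReal r) μ
        ≤ kernelNorm P X H (ENNReal.ofReal r) →
      eLpNorm (fun z : Pt d × T => H z.1 (ev z.2) * Φ z.2) (ENNReal.ofReal r) μ
        ≤ ENNReal.ofReal M * kernelNorm P X H (ENNReal.ofReal r) := by
    intro μ hμ
    refine (eLpNorm_le_mul_eLpNorm_of_ae_le_mul (c := M)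
      (g := fun z : Pt d × T => H z.1 (ev z.2)) (Eventually.of_forall fun z => ?_) _).trans
      (mul_le_mul' le_rfl hμ)
    rw [norm_mul, mul_comm]
    exact mul_le_mul_of_nonneg_right (hM _) (norm_nonneg _)
  have hb1 := hbd (P.map fun ω => (X i ω, W ω)) (by
    rw [eLpNorm_map_measure mker.aestronglyMeasurable (mX.prodMk mW).aemeasurable]
    have e : ((fun z : Pt d × T => H z.1 (ev z.2)) ∘ fun ω => (X i ω, W ω))
        = fun ω => H (X i ω) (X k ω) := by
      ext ω; simp [hev]
    rw [e]
    exact le_trans (le_max_left _ _) (le_iSup_of_le i <| le_iSup_of_le k <|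
      le_iSup_of_le hne le_rfl))
  have hb2 := hbd ((P.map (X i)).prod (P.map W)) (by
    have e : (P.map W).map ev = P.map (X k) := by
      rw [Measure.map_map mev mW]; congr 1; ext1 ω; exact hev ω
    have e2 : indepPair P X i k
        = ((P.map (X i)).prod (P.map W)).map (Prod.map id ev) := by
      rw [indepPair, ← e, ← Measure.map_prod_map _ _ measurable_id mev, Measure.map_id]
    have e3 : eLpNorm (fun z : Pt d × T => H z.1 (ev z.2))
        (ENNReal.ofReal r) ((P.map (X i)).prod (P.map W))
        = eLpNorm (Function.uncurry H) (ENNReal.ofReal r) (indepPair P X i k) := by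
      rw [e2, eLpNorm_map_measure h.measH.aestronglyMeasurable
        (measurable_id.prodMap mev).aemeasurable]
      rfl
    rw [e3]
    exact le_trans (le_max_right _ _) (le_iSup_of_le i <| le_iSup_of_le k <|
      le_iSup_of_le hne le_rfl))
  have hmain := hTV.enorm_integral_sub_le mF (p := r) hr hb1 hb2
  -- Under the product law the node `i` is integrated first. The bounded factor does not depend on
  -- it, and degeneracy at `X k` gives zero.
  have hzero : ∫ z : Pt d × T, H z.1 (ev z.2) * Φ z.2 ∂((P.map (X i)).prod (P.map W)) = 0 := by
    by_cases hi : Integrable (fun z : Pt d × T => H z.1 (ev z.2) * Φ z.2)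
      ((P.map (X i)).prod (P.map W))
    swap
    · exact integral_undef hi
    rw [integral_prod_symm _ hi]
    refine integral_eq_zero_of_ae ?_
    have h1 : ∀ᵐ y ∂(P.map W), ∫ ω, H (X i ω) (ev y) ∂P = 0 := by
      have mdeg : Measurable fun x => ∫ ω, H (X i ω) x ∂P :=
        (h.measH.comp ((mX.comp measurable_snd).prodMk measurable_fst) :
          Measurable fun z : Pt d × Ω =>
            H (X i z.2) z.1).stronglyMeasurable.integral_prod_right'.measurable
      refine (ae_map_iff mW.aemeasurable
        ((mdeg.comp mev) (measurableSet_singleton 0))).mpr ?_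
      simp only [Function.comp_apply, hev]
      exact ae_of_ae_map (h.measX k).aemeasurable (h.deg k i hne.symm)
    filter_upwards [h1] with y hy
    have e4 : ∫ x, H x (ev y) ∂(P.map (X i)) = ∫ ω, H (X i ω) (ev y) ∂P :=
      integral_map mX.aemeasurable
        (h.measH.comp (measurable_id.prodMk measurable_const)).aestronglyMeasurable
    simp only [integral_mul_const, e4, hy, zero_mul, Pi.zero_apply]
  rw [hzero, sub_zero, integral_map (mX.prodMk mW).aemeasurable mF.aestronglyMeasurable] at hmain
  simpa only [hev] using hmain

/-- Decoupling one node from a bounded function of the nodes that are not close to it. -/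
lemma abs_integral_kernel_mul_le (h : BoundedSample P X H m β r K b G ε₁ ε₂ ε₄ η) {i k : ι}
    (hik : ¬ Near m i k) {φ : ℝ → ℝ} (hφ : Measurable φ) {M : ℝ} (hM : ∀ x, |φ x| ≤ M) :
    |∫ ω, H (X i ω) (X k ω) * φ (awaySum X H m i ω) ∂P| ≤ 2 * (M * ε₁) := by
  classical
  have hr := h.four_le
  have hM0 : 0 ≤ M := (abs_nonneg _).trans (hM 0)
  set W : Ω → ({j // j ∈ farFin m i} → Pt d) := fun ω j => X j ω with hW
  have mW : Measurable W := measurable_pi_lambda _ fun u => h.measX _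
  have hk : k ∈ farFin m i := mem_farFin.mpr hik
  -- The away part is written as a function of the far observations alone, so that it is measurable
  -- with respect to the second group of the mixing condition.
  set Ψ : ({j // j ∈ farFin m i} → Pt d) → ℝ := fun y =>
    ∑ j : {j // j ∈ farFin m i}, ∑ l : {j // j ∈ farFin m i},
      if Near m (j : ι) (l : ι) then 0 else H (y j) (y l) with hΨ
  have mΨ : Measurable Ψ := by
    refine Finset.measurable_fun_sum _ fun j _ => Finset.measurable_fun_sum _ fun l _ => ?_
    split_ifs
    · exact measurable_const
    · have m1 : Measurable fun y : {j // j ∈ farFin m i} → Pt d => (y j, y l) :=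
        (measurable_pi_apply j).prodMk (measurable_pi_apply l)
      exact h.measH.comp m1
  have hΨW : ∀ ω, Ψ (W ω) = awaySum X H m i ω := by
    intro ω
    simp only [hΨ, hW, awaySum]
    rw [← Finset.sum_coe_sort (farFin m i)]
    refine Finset.sum_congr rfl fun j _ => ?_
    rw [← Finset.sum_coe_sort (farFin m i)]
    exact Finset.sum_congr rfl fun l _ => rfl
  have hTV : TVClose (P.map fun ω => (X i ω, W ω)) ((P.map (X i)).prod (P.map W)) β := by
    refine tvClose_map_prod P (h.measX i) mW (measurable_sigmaOf {i} (by simp))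
      (measurable_sigmaOf_pi (farFin m i) fun u => u.2) (h.mix {i} (farFin m i) (by simp) ?_)
    intro a ha j hj
    rw [Finset.mem_singleton] at ha
    subst ha
    exact not_le.mp (mem_farFin.mp hj)
  have hmain := enorm_integral_kernel_mul_le h.toDegenerateSample (ne_of_not_near hik) mW
    (measurable_pi_apply (⟨k, hk⟩ : {j // j ∈ farFin m i})) (fun ω => rfl) (hφ.comp mΨ)
    (fun y => hM _) hTV (r := r) (by linarith)
  simp only [Function.comp_apply, hΨW] at hmain
  refine abs_le_two_mul_of_enorm_le (mul_nonneg hM0 h.ε₁_nonneg) hmain ?_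
  have herr := h.err₁_le
  simp only [decErr, Nat.cast_one, pow_one] at herr
  rw [ENNReal.ofReal_mul hM0]
  calc _ = ENNReal.ofReal M * (β ^ (1 - 1 / r) * kernelNorm P X H (ENNReal.ofReal r)) := by ring
    _ ≤ _ := by gcongr

lemma _root_.DegenerateUStat.integrable_mul_comp {g Y : Ω → ℝ}
    (hg : MemLp g 4 P) (hY : AEStronglyMeasurable Y P) {φ : ℝ → ℝ} (hφ : Measurable φ) {M : ℝ}
    (hM : ∀ x, |φ x| ≤ M) : Integrable (fun ω => g ω * φ (Y ω)) P := by
  refine (hg.integrable (by norm_num)).mul_bdd (c := M)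
    (hφ.comp_aemeasurable hY.aemeasurable).aestronglyMeasurable (Eventually.of_forall fun ω => ?_)
  exact hM _

lemma abs_integral_rowSum_mul_le (h : BoundedSample P X H m β r K b G ε₁ ε₂ ε₄ η) (i : ι)
    {φ : ℝ → ℝ} (hφ : Measurable φ) {M : ℝ} (hM : ∀ x, |φ x| ≤ M) :
    |∫ ω, rowSum X H m i ω * φ (awaySum X H m i ω) ∂P| ≤ Fintype.card ι * (2 * (M * ε₁)) := by
  have hM0 : 0 ≤ M := (abs_nonneg _).trans (hM 0)
  have h1 : ∫ ω, rowSum X H m i ω * φ (awaySum X H m i ω) ∂P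
      = ∑ k ∈ farFin m i, ∫ ω, H (X i ω) (X k ω) * φ (awaySum X H m i ω) ∂P := by
    rw [← integral_finsetSum]
    · simp only [rowSum, Finset.sum_mul]
    · intro k hk
      exact integrable_mul_comp (h.memLp_kernel (ne_of_not_near (by simpa using hk)))
        (h.memLp_awaySum i).1 hφ hM
  rw [h1]
  refine (Finset.abs_sum_le_sum_abs _ _).trans ?_
  refine (Finset.sum_le_sum fun k hk => h.abs_integral_kernel_mul_le (by simpa using hk) hφ hM).trans
    ?_
  rw [Finset.sum_const, nsmul_eq_mul]
  have : ((farFin m i).card : ℝ) ≤ Fintype.card ι := by exact_mod_cast Finset.card_le_univ _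
  have := h.ε₁_nonneg
  gcongr

lemma abs_integral_farSum_le (h : BoundedSample P X H m β r K b G ε₁ ε₂ ε₄ η) :
    |∫ ω, farSum X H m ω ∂P| ≤ (Fintype.card ι : ℝ) ^ 2 * (2 * ε₁) := by
  have h1 : ∫ ω, farSum X H m ω ∂P = ∑ i, ∫ ω, rowSum X H m i ω ∂P := by
    rw [← integral_finsetSum]
    · rfl
    · exact fun i _ => (h.rowSum_memLp i).integrable (by norm_num)
  rw [h1]
  refine (Finset.abs_sum_le_sum_abs _ _).trans ?_
  have h2 : ∀ i, |∫ ω, rowSum X H m i ω ∂P| ≤ Fintype.card ι * (2 * ε₁) := fun i => by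
    have := h.abs_integral_rowSum_mul_le i (φ := fun _ => 1) measurable_const (M := 1) (by simp)
    simpa using this
  refine (Finset.sum_le_sum fun i _ => h2 i).trans (le_of_eq ?_)
  rw [Finset.sum_const, nsmul_eq_mul, Finset.card_univ]
  ring

/-- In every expanded term the node `i` is far from the three others, so it is an isolated vertex of
a product of two kernels. -/
lemma abs_integral_rowSum_mul_awaySum_le (h : BoundedSample P X H m β r K b G ε₁ ε₂ ε₄ η) (i : ι) :
    |∫ ω, rowSum X H m i ω * awaySum X H m i ω ∂P| ≤ (Fintype.card ι : ℝ) ^ 3 * (2 * ε₂) := by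
  have hr := h.four_le
  have hε := h.ε₂_nonneg
  have hint : ∀ k ∈ farFin m i, ∀ j l, Integrable
      (fun ω => H (X i ω) (X k ω) * farKer X H m j l ω) P := fun k hk j l =>
    (memLp_two_mul (h.memLp_kernel (ne_of_not_near (by simpa using hk)))
      (h.memLp_farKer j l)).integrable (by norm_num)
  have h1 : ∫ ω, rowSum X H m i ω * awaySum X H m i ω ∂P = ∑ k ∈ farFin m i, ∑ j ∈ farFin m i,
      ∑ l ∈ farFin m i, ∫ ω, H (X i ω) (X k ω) * farKer X H m j l ω ∂P := by
    have e : ∀ ω, rowSum X H m i ω * awaySum X H m i ω = ∑ k ∈ farFin m i, ∑ j ∈ farFin m i,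
        ∑ l ∈ farFin m i, H (X i ω) (X k ω) * farKer X H m j l ω := fun ω => by
      rw [rowSum, awaySum, Finset.sum_mul]
      refine Finset.sum_congr rfl fun k _ => ?_
      rw [Finset.mul_sum]
      exact Finset.sum_congr rfl fun j _ => Finset.mul_sum _ _ _
    simp_rw [e]
    rw [integral_finsetSum _ fun k hk => integrable_finsetSum _ fun j _ =>
      integrable_finsetSum _ fun l _ => hint k hk j l]
    refine Finset.sum_congr rfl fun k hk => ?_
    rw [integral_finsetSum _ fun j _ => integrable_finsetSum _ fun l _ => hint k hk j l]
    refine Finset.sum_congr rfl fun j _ => ?_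
    rw [integral_finsetSum _ fun l _ => hint k hk j l]
  have h2 : ∀ k ∈ farFin m i, ∀ j ∈ farFin m i, ∀ l ∈ farFin m i,
      |∫ ω, H (X i ω) (X k ω) * farKer X H m j l ω ∂P| ≤ 2 * ε₂ := by
    intro k hk j hj l hl
    rw [mem_farFin] at hk hj hl
    by_cases hN : Near m j l
    · simp [farKer_of_near hN, hε]
    · have h3 := enorm_labelInt_le_of_isolated h.toDegenerateSample (q := 2) (by norm_num) (r := r)
        (by norm_num; linarith) (v := pairVec ((i, k), (j, l))) (by
          intro e
          fin_cases e
          · simpa [pairVec] using ne_of_not_near hk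
          · simpa [pairVec] using ne_of_not_near hN) (fun _ => (0 : Fin 2)) (l' := 1) (by simp)
        (0, false) (by
          rintro ⟨e, bb⟩ hu _
          have : ¬ Near m i (pairVec ((i, k), (j, l)) (e, bb)) := by
            fin_cases e <;> cases bb
            · simp at hu
            · simpa [pairVec] using hk
            · simpa [pairVec] using hj
            · simpa [pairVec] using hl
          exact not_le.mp this)
      have h4 := abs_le_two_mul_of_enorm_le hε h3 h.err₂_le
      rw [labelInt_const h.toDegenerateSample] at h4
      rw [farKer_of_not_near hN]
      simpa [pairVec, Fin.prod_univ_two] using h4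
  rw [h1]
  have hc : ((farFin m i).card : ℝ) ≤ Fintype.card ι := by exact_mod_cast Finset.card_le_univ _
  calc |∑ k ∈ farFin m i, ∑ j ∈ farFin m i,
      ∑ l ∈ farFin m i, ∫ ω, H (X i ω) (X k ω) * farKer X H m j l ω ∂P|
      ≤ ∑ k ∈ farFin m i, ∑ j ∈ farFin m i, ∑ l ∈ farFin m i, (2 * ε₂) :=
        (Finset.abs_sum_le_sum_abs _ _).trans (Finset.sum_le_sum fun k hk =>
          (Finset.abs_sum_le_sum_abs _ _).trans (Finset.sum_le_sum fun j hj =>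
            (Finset.abs_sum_le_sum_abs _ _).trans (Finset.sum_le_sum fun l hl =>
              h2 k hk j hj l hl)))
    _ = ((farFin m i).card : ℝ) ^ 3 * (2 * ε₂) := by
        simp only [Finset.sum_const, nsmul_eq_mul]; ring
    _ ≤ _ := by gcongr

end BoundedSample

end Decomposition

/-! ### Stein's exchange for the far part -/

/-- First order Taylor expansion of a function with Lipschitz derivative. -/
lemma abs_taylor_le {f f' : ℝ → ℝ} (hf : ∀ x, HasDerivAt f (f' x) x) (hL : LipschitzWith 20 f')
    (x y : ℝ) : |f y - f x - f' x * (y - x)| ≤ 20 * (y - x) ^ 2 := by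
  have hd : ∀ t ∈ Set.uIcc x y, HasDerivWithinAt (fun t => f t - f' x * t) (f' t - f' x)
      (Set.uIcc x y) t := fun t _ =>
    ((hf t).sub (by simpa using (hasDerivAt_id t).const_mul (f' x))).hasDerivWithinAt
  have hb : ∀ t ∈ Set.uIcc x y, ‖f' t - f' x‖ ≤ 20 * |y - x| := fun t ht => by
    have h1 := hL.dist_le_mul t x
    simp only [Real.dist_eq, NNReal.coe_ofNat] at h1
    rw [Real.norm_eq_abs]
    have h2 : |t - x| ≤ |y - x| := Set.abs_sub_left_of_mem_uIcc ht
    linarith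
  have h := (convex_uIcc x y).norm_image_sub_le_of_norm_hasDerivWithin_le hd hb
    Set.left_mem_uIcc Set.right_mem_uIcc
  rw [Real.norm_eq_abs, Real.norm_eq_abs] at h
  calc |f y - f x - f' x * (y - x)| = |f y - f' x * y - (f x - f' x * x)| := by congr 1; ring
    _ ≤ 20 * |y - x| * |y - x| := h
    _ = 20 * (y - x) ^ 2 := by rw [mul_assoc, ← sq, sq_abs]

/-- The pointwise form of Stein's exchange: the left hand side compares `f' u - u f u` with a sum
in which each summand is decoupled. -/
lemma abs_stein_exchange_le {ι : Type*} [Fintype ι] {f f' : ℝ → ℝ}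
    (hf : ∀ x, HasDerivAt f (f' x) x) (hf' : ∀ x, |f' x| ≤ 20) (hL : LipschitzWith 20 f')
    {s U Q q : ℝ} (hs : 0 < s) {A B D R : ι → ℝ} (hU : U = ∑ i, A i) (hUi : ∀ i, U = B i + D i)
    (hQ : ∑ i, A i * D i = 2 * Q - ∑ i, A i * R i) :
    |f' (U / s) - U / s * f (U / s) + s⁻¹ * ∑ i, A i * f (B i / s)|
      ≤ 20 * (s⁻¹) ^ 2 * (|s ^ 2 - 2 * q| + 2 * |Q - q| + ∑ i, |A i * R i|)
        + 20 * (s⁻¹) ^ 3 * ∑ i, |A i * D i ^ 2| := by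
  have hs0 : s ≠ 0 := hs.ne'
  set e : ι → ℝ := fun i => f (B i / s) - f (U / s) - f' (U / s) * (B i / s - U / s) with he
  have hei : ∀ i, |e i| ≤ 20 * (s⁻¹) ^ 2 * D i ^ 2 := fun i => by
    have h := abs_taylor_le hf hL (U / s) (B i / s)
    have h2 : B i / s - U / s = -(s⁻¹ * D i) := by rw [hUi i]; field_simp; ring
    calc |e i| ≤ 20 * (B i / s - U / s) ^ 2 := h
      _ = _ := by rw [h2]; ring
  -- The Taylor remainders are split off exactly: the linear terms assemble into Σ A_i D_i, and
  -- adding and subtracting `q` separates the fluctuation of `Q` from the mismatch of its mean with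
  -- s².
  have key : f' (U / s) - U / s * f (U / s) + s⁻¹ * ∑ i, A i * f (B i / s)
      = f' (U / s) * ((s⁻¹) ^ 2 * ((s ^ 2 - 2 * q) - 2 * (Q - q) + ∑ i, A i * R i))
        + s⁻¹ * ∑ i, A i * e i := by
    have h1 : ∑ i, A i * f (B i / s) = ∑ i, A i * e i + U * f (U / s)
        - f' (U / s) * (s⁻¹ * (2 * Q - ∑ i, A i * R i)) := by
      rw [← hQ, hU, Finset.sum_mul, Finset.mul_sum, Finset.mul_sum, ← Finset.sum_add_distrib,
        ← Finset.sum_sub_distrib, ← hU]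
      refine Finset.sum_congr rfl fun i _ => ?_
      have h2 : B i / s - U / s = -(s⁻¹ * D i) := by rw [hUi i]; field_simp; ring
      simp only [he, h2]
      ring
    rw [h1]
    field_simp
    ring
  have h3 : |∑ i, A i * e i| ≤ 20 * (s⁻¹) ^ 2 * ∑ i, |A i * D i ^ 2| := by
    rw [Finset.mul_sum]
    refine (Finset.abs_sum_le_sum_abs _ _).trans (Finset.sum_le_sum fun i _ => ?_)
    rw [abs_mul, abs_mul, abs_of_nonneg (sq_nonneg (D i))]
    have := mul_le_mul_of_nonneg_left (hei i) (abs_nonneg (A i))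
    linarith
  have h4 : |(s ^ 2 - 2 * q) - 2 * (Q - q) + ∑ i, A i * R i|
      ≤ |s ^ 2 - 2 * q| + 2 * |Q - q| + ∑ i, |A i * R i| := by
    have e1 := abs_add_le ((s ^ 2 - 2 * q) - 2 * (Q - q)) (∑ i, A i * R i)
    have e2 := abs_sub (s ^ 2 - 2 * q) (2 * (Q - q))
    have e3 : |2 * (Q - q)| = 2 * |Q - q| := by rw [abs_mul, abs_of_pos (two_pos)]
    have e4 := Finset.abs_sum_le_sum_abs (fun i => A i * R i) Finset.univ
    linarith
  rw [key]
  refine (abs_add_le _ _).trans (add_le_add ?_ ?_)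
  · rw [abs_mul, abs_mul, abs_of_nonneg (sq_nonneg s⁻¹), mul_assoc]
    gcongr
    exact hf' _
  · rw [abs_mul, abs_of_pos (inv_pos.mpr hs)]
    calc s⁻¹ * |∑ i, A i * e i| ≤ s⁻¹ * (20 * (s⁻¹) ^ 2 * ∑ i, |A i * D i ^ 2|) := by gcongr
      _ = _ := by ring

section Stein

variable {Ω : Type*} [MeasurableSpace Ω] {P : Measure Ω} [IsProbabilityMeasure P]
  {d : ℕ} {ι : Type*} [Fintype ι] [EMetricSpace ι] {X : ι → Ω → Pt d} {H : Pt d → Pt d → ℝ}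
  {m : ℝ} {β : ℝ≥0∞} {r K b G ε₁ ε₂ ε₄ : ℝ} {η : ℕ}

lemma memLp_two_of_four {f : Ω → ℝ} (hf : MemLp f 4 P) : MemLp f 2 P :=
  hf.mono_exponent (by norm_num)

namespace BoundedSample

lemma integral_abs_rowSum_mul_localSum_le (h : BoundedSample P X H m β r K b G ε₁ ε₂ ε₄ η) {a₂ : ℝ}
    (ha₂ : ∀ i, ∫ ω, rowSum X H m i ω ^ 2 ∂P ≤ a₂) (i : ι) :
    ∫ ω, |rowSum X H m i ω * localSum X H m i ω| ∂P ≤ √a₂ * ((η : ℝ) ^ 2 * K) := by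
  have hK := h.K_nonneg
  refine (integral_abs_mul_le_sqrt (memLp_two_of_four (h.rowSum_memLp i))
    (memLp_two_of_four (h.memLp_localSum i))).trans ?_
  gcongr
  · exact ha₂ i
  · exact Real.sqrt_le_iff.mpr ⟨by positivity, h.integral_localSum_sq_le i⟩

lemma integral_abs_rowSum_mul_touchSum_sq_le (h : BoundedSample P X H m β r K b G ε₁ ε₂ ε₄ η)
    {a₂ D₄ : ℝ} (ha₂ : ∀ i, ∫ ω, rowSum X H m i ω ^ 2 ∂P ≤ a₂)
    (hD : ∀ i, ∫ ω, touchSum X H m i ω ^ 4 ∂P ≤ D₄) (i : ι) :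
    ∫ ω, |rowSum X H m i ω * touchSum X H m i ω ^ 2| ∂P ≤ √a₂ * √D₄ := by
  have h1 : MemLp (fun ω => touchSum X H m i ω ^ 2) 2 P := by
    simpa only [sq] using memLp_two_mul (h.memLp_touchSum i) (h.memLp_touchSum i)
  refine (integral_abs_mul_le_sqrt (memLp_two_of_four (h.rowSum_memLp i)) h1).trans ?_
  simp only [← pow_mul]
  gcongr
  · exact ha₂ i
  · exact hD i

/-- The second moment of the main part in terms of the mean of the sum over quadruples. -/
lemma abs_integral_farSum_sq_sub_le (h : BoundedSample P X H m β r K b G ε₁ ε₂ ε₄ η) {a₂ : ℝ}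
    (ha₂ : ∀ i, ∫ ω, rowSum X H m i ω ^ 2 ∂P ≤ a₂) :
    |∫ ω, farSum X H m ω ^ 2 ∂P - 2 * ∫ ω, quadSum X H m ω ∂P|
      ≤ (Fintype.card ι : ℝ) ^ 4 * (2 * ε₂)
        + Fintype.card ι * (√a₂ * ((η : ℝ) ^ 2 * K)) := by
  have hA := fun i => h.rowSum_memLp i
  have i1 : ∀ i, Integrable (fun ω => rowSum X H m i ω * awaySum X H m i ω) P := fun i =>
    (memLp_two_mul (hA i) (h.memLp_awaySum i)).integrable (by norm_num)
  have i2 : ∀ i, Integrable (fun ω => rowSum X H m i ω * localSum X H m i ω) P := fun i =>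
    (memLp_two_mul (hA i) (h.memLp_localSum i)).integrable (by norm_num)
  have i3 : Integrable (quadSum X H m) P := h.memLp_quadSum.integrable (by norm_num)
  -- One factor of the square is expanded into rows, and in the other the nodes near the current row
  -- are separated.
  have e : ∀ ω, farSum X H m ω ^ 2 = ∑ i, rowSum X H m i ω * awaySum X H m i ω
      + (2 * quadSum X H m ω - ∑ i, rowSum X H m i ω * localSum X H m i ω) := fun ω => by
    rw [← sum_rowSum_mul_touchSum, ← Finset.sum_add_distrib, sq]
    conv_lhs => enter [1]; rw [farSum]
    rw [Finset.sum_mul]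
    refine Finset.sum_congr rfl fun i _ => ?_
    rw [farSum_eq h.symm i]
    ring
  have e2 : ∫ ω, farSum X H m ω ^ 2 ∂P - 2 * ∫ ω, quadSum X H m ω ∂P
      = ∑ i, ∫ ω, rowSum X H m i ω * awaySum X H m i ω ∂P
        - ∑ i, ∫ ω, rowSum X H m i ω * localSum X H m i ω ∂P := by
    have i4 : Integrable (fun ω => 2 * quadSum X H m ω
        - ∑ i, rowSum X H m i ω * localSum X H m i ω) P :=
      (i3.const_mul 2).sub (integrable_finsetSum _ fun i _ => i2 i)
    simp_rw [e]
    rw [integral_add (integrable_finsetSum _ fun i _ => i1 i) i4,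
      integral_sub (i3.const_mul 2) (integrable_finsetSum _ fun i _ => i2 i),
      integral_const_mul, integral_finsetSum _ fun i _ => i1 i,
      integral_finsetSum _ fun i _ => i2 i]
    ring
  rw [e2]
  refine (abs_sub _ _).trans (add_le_add ?_ ?_)
  · refine (Finset.abs_sum_le_sum_abs _ _).trans ((Finset.sum_le_sum fun i _ =>
      h.abs_integral_rowSum_mul_awaySum_le i).trans (le_of_eq ?_))
    rw [Finset.sum_const, nsmul_eq_mul, Finset.card_univ]
    ring
  · refine (Finset.abs_sum_le_sum_abs _ _).trans ((Finset.sum_le_sum fun i _ =>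
      (abs_integral_le_integral_abs).trans (h.integral_abs_rowSum_mul_localSum_le ha₂ i)).trans
      (le_of_eq ?_))
    rw [Finset.sum_const, nsmul_eq_mul, Finset.card_univ]

/-- Stein's method for the main part of the statistic. -/
lemma abs_integral_stein_le (h : BoundedSample P X H m β r K b G ε₁ ε₂ ε₄ η) {a₂ D₄ v s : ℝ}
    (ha₂ : ∀ i, ∫ ω, rowSum X H m i ω ^ 2 ∂P ≤ a₂)
    (hD : ∀ i, ∫ ω, touchSum X H m i ω ^ 4 ∂P ≤ D₄)
    (hv : variance (quadSum X H m) P ≤ v) (hs : 0 < s)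
    {f f' : ℝ → ℝ} (hf : ∀ x, HasDerivAt f (f' x) x) (hf0 : ∀ x, |f x| ≤ 20)
    (hf' : ∀ x, |f' x| ≤ 20) (hL : LipschitzWith 20 f') :
    |∫ ω, (f' (farSum X H m ω / s) - farSum X H m ω / s * f (farSum X H m ω / s)) ∂P|
      ≤ 20 * (s⁻¹) ^ 2 * (|s ^ 2 - 2 * ∫ ω, quadSum X H m ω ∂P| + 2 * √v
            + Fintype.card ι * (√a₂ * ((η : ℝ) ^ 2 * K)))
        + 20 * (s⁻¹) ^ 3 * (Fintype.card ι * (√a₂ * √D₄))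
        + s⁻¹ * ((Fintype.card ι : ℝ) ^ 2 * (40 * ε₁)) := by
  set N : ℝ := (Fintype.card ι : ℝ) with hN
  set q := ∫ ω, quadSum X H m ω ∂P with hq
  have cf : Continuous f := continuous_iff_continuousAt.mpr fun x => (hf x).continuousAt
  have mφ : Measurable fun x => f (x / s) := (cf.comp (continuous_id.div_const s)).measurable
  have hA := fun i => h.rowSum_memLp i
  have iQ : Integrable (quadSum X H m) P := h.memLp_quadSum.integrable (by norm_num)
  have iAf : ∀ i, Integrable (fun ω => rowSum X H m i ω * f (awaySum X H m i ω / s)) P := fun i =>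
    integrable_mul_comp (hA i) (h.memLp_awaySum i).1 mφ (M := 20) fun x => hf0 _
  have iG : Integrable (fun ω => s⁻¹ * ∑ i, rowSum X H m i ω * f (awaySum X H m i ω / s)) P :=
    (integrable_finsetSum _ fun i _ => iAf i).const_mul _
  have iF : Integrable (fun ω => f' (farSum X H m ω / s)
      - farSum X H m ω / s * f (farSum X H m ω / s)) P := by
    refine Integrable.sub ?_ ?_
    · refine Integrable.of_bound (hL.continuous.comp_aestronglyMeasurable
        ((continuous_id.div_const s).comp_aestronglyMeasurable h.memLp_farSum.1)) 20 (Eventually.of_forall fun ω => hf' _)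
    · have := (integrable_mul_comp h.memLp_farSum h.memLp_farSum.1 mφ (M := 20)
        fun x => hf0 _).const_mul s⁻¹
      refine this.congr (Eventually.of_forall fun ω => ?_)
      simp only
      ring
  have iAR : ∀ i, Integrable (fun ω => |rowSum X H m i ω * localSum X H m i ω|) P := fun i =>
    ((memLp_two_mul (hA i) (h.memLp_localSum i)).integrable (by norm_num)).abs
  have iAD : ∀ i, Integrable (fun ω => |rowSum X H m i ω * touchSum X H m i ω ^ 2|) P := fun i => by
    have h1 : MemLp (fun ω => touchSum X H m i ω ^ 2) 2 P := by
      simpa only [sq] using memLp_two_mul (h.memLp_touchSum i) (h.memLp_touchSum i)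
    exact ((memLp_two_of_four (hA i)).integrable_mul h1).abs
  have iQq : Integrable (fun ω => |quadSum X H m ω - q|) P := (iQ.sub (integrable_const q)).abs
  have hQv : ∫ ω, |quadSum X H m ω - q| ∂P ≤ √v := by
    refine (integral_abs_le_sqrt (h.memLp_quadSum.sub (memLp_const q))).trans ?_
    refine Real.sqrt_le_sqrt (le_trans (le_of_eq ?_) hv)
    exact integral_sub_mean_sq_eq h.memLp_quadSum
  have i1 : Integrable (fun ω => |s ^ 2 - 2 * q| + 2 * |quadSum X H m ω - q|
      + ∑ i, |rowSum X H m i ω * localSum X H m i ω|) P :=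
    ((integrable_const _).add (iQq.const_mul 2)).add (integrable_finsetSum _ fun i _ => iAR i)
  have i2 : Integrable (fun ω => ∑ i, |rowSum X H m i ω * touchSum X H m i ω ^ 2|) P :=
    integrable_finsetSum _ fun i _ => iAD i
  have hpt := fun ω => abs_stein_exchange_le hf hf' hL (q := q) hs (U := farSum X H m ω) rfl
    (fun i => farSum_eq h.symm i ω) (sum_rowSum_mul_touchSum ω)
  have hmain := (abs_integral_le_integral_abs (μ := P)
    (f := fun ω => f' (farSum X H m ω / s) - farSum X H m ω / s * f (farSum X H m ω / s)
      + s⁻¹ * ∑ i, rowSum X H m i ω * f (awaySum X H m i ω / s))).trans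
    (integral_mono (iF.add iG).abs ((i1.const_mul (20 * (s⁻¹) ^ 2)).add
      (i2.const_mul (20 * (s⁻¹) ^ 3))) hpt)
  have i5 : Integrable (fun ω => |s ^ 2 - 2 * q| + 2 * |quadSum X H m ω - q|) P :=
    (integrable_const _).add (iQq.const_mul 2)
  rw [integral_add iF iG, integral_add' (i1.const_mul (20 * (s⁻¹) ^ 2))
    (i2.const_mul (20 * (s⁻¹) ^ 3)), integral_const_mul, integral_const_mul, integral_const_mul,
    integral_add i5
      (integrable_finsetSum _ fun i _ => iAR i),
    integral_add (integrable_const _) (iQq.const_mul 2), integral_const_mul,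
    integral_finsetSum _ fun i _ => iAR i, integral_finsetSum _ fun i _ => iAD i,
    integral_finsetSum _ fun i _ => iAf i] at hmain
  simp only [integral_const, probReal_univ, one_smul] at hmain
  have b1 : ∑ i, ∫ ω, |rowSum X H m i ω * localSum X H m i ω| ∂P
      ≤ N * (√a₂ * ((η : ℝ) ^ 2 * K)) := by
    refine (Finset.sum_le_sum fun i _ => h.integral_abs_rowSum_mul_localSum_le ha₂ i).trans
      (le_of_eq ?_)
    rw [Finset.sum_const, nsmul_eq_mul, Finset.card_univ]
  have b2 : ∑ i, ∫ ω, |rowSum X H m i ω * touchSum X H m i ω ^ 2| ∂P ≤ N * (√a₂ * √D₄) := by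
    refine (Finset.sum_le_sum fun i _ => h.integral_abs_rowSum_mul_touchSum_sq_le ha₂ hD i).trans
      (le_of_eq ?_)
    rw [Finset.sum_const, nsmul_eq_mul, Finset.card_univ]
  have b3 : |∑ i, ∫ ω, rowSum X H m i ω * f (awaySum X H m i ω / s) ∂P| ≤ N ^ 2 * (40 * ε₁) := by
    refine (Finset.abs_sum_le_sum_abs _ _).trans ((Finset.sum_le_sum fun i _ =>
      h.abs_integral_rowSum_mul_le i mφ (M := 20) fun x => hf0 _).trans (le_of_eq ?_))
    rw [Finset.sum_const, nsmul_eq_mul, Finset.card_univ]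
    ring
  have hsi : 0 < s⁻¹ := inv_pos.mpr hs
  set J := ∫ ω, (f' (farSum X H m ω / s) - farSum X H m ω / s * f (farSum X H m ω / s)) ∂P
  set T := ∑ i, ∫ ω, rowSum X H m i ω * f (awaySum X H m i ω / s) ∂P
  have hJ : |J| ≤ |J + s⁻¹ * T| + s⁻¹ * |T| := by
    have := abs_sub (J + s⁻¹ * T) (s⁻¹ * T)
    rwa [add_sub_cancel_right, abs_mul s⁻¹ T, abs_of_pos hsi] at this
  refine hJ.trans (add_le_add (hmain.trans ?_) ?_)
  · gcongr
  · gcongr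

end BoundedSample

end Stein

/-! ### From the far part to the standardised statistic -/

section WassersteinBound

variable {Ω : Type*} [MeasurableSpace Ω] {P : Measure Ω} [IsProbabilityMeasure P]

lemma abs_covariance_le {f g : Ω → ℝ} (hf : MemLp f 2 P) (hg : MemLp g 2 P) :
    |cov[f, g; P]| ≤ √(variance f P) * √(variance g P) := by
  rw [covariance, ← integral_sub_mean_sq_eq hf, ← integral_sub_mean_sq_eq hg]
  exact abs_integral_le_integral_abs.trans
    (integral_abs_mul_le_sqrt (hf.sub (memLp_const _)) (hg.sub (memLp_const _)))

lemma abs_variance_sub_variance_le {f g h : Ω → ℝ} (hf : MemLp f 2 P) (hg : MemLp g 2 P)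
    (hh : h = f - g) : |variance f P - variance h P|
      ≤ 2 * (√(variance f P) * √(variance g P)) + variance g P := by
  rw [hh, variance_sub hf hg]
  have h1 := abs_le.mp (abs_covariance_le hf hg)
  have h2 := variance_nonneg g P
  rw [abs_le]
  constructor <;> linarith

variable {d : ℕ} {ι : Type*} [Fintype ι] [EMetricSpace ι] {X : ι → Ω → Pt d} {H : Pt d → Pt d → ℝ}
  {m : ℝ} {β : ℝ≥0∞} {r K b G ε₁ ε₂ ε₄ : ℝ} {η : ℕ}

namespace BoundedSample

lemma memLp_uStat (h : BoundedSample P X H m β r K b G ε₁ ε₂ ε₄ η) : MemLp (uStat X H) 2 P := by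
  have : uStat X H = farSum X H m + nearSum X H m := funext fun ω => uStat_eq ω
  rw [this]
  exact (memLp_two_of_four h.memLp_farSum).add h.memLp_nearSum

/-- The variance changes little when the near part is dropped. For the far part it is the second
moment less a squared mean, the mean being a mixing error, and the second moment is close to twice
the mean of the sum over quadruples. -/
lemma abs_sdev_sq_sub_le (h : BoundedSample P X H m β r K b G ε₁ ε₂ ε₄ η) {a₂ w : ℝ}
    (ha₂ : ∀ i, ∫ ω, rowSum X H m i ω ^ 2 ∂P ≤ a₂) (hw : variance (nearSum X H m) P ≤ w) :
    |sdev P X H ^ 2 - 2 * ∫ ω, quadSum X H m ω ∂P|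
      ≤ 2 * (sdev P X H * √w) + w + ((Fintype.card ι : ℝ) ^ 2 * (2 * ε₁)) ^ 2
        + ((Fintype.card ι : ℝ) ^ 4 * (2 * ε₂) + Fintype.card ι * (√a₂ * ((η : ℝ) ^ 2 * K))) := by
  have h1 := abs_variance_sub_variance_le h.memLp_uStat h.memLp_nearSum (h := farSum X H m)
    (by ext ω; simp [uStat_eq (m := m)])
  have h2 := variance_eq_sub (memLp_two_of_four h.memLp_farSum)
  have h3 := h.abs_integral_farSum_sq_sub_le ha₂
  have h4 := h.abs_integral_farSum_le
  have h5 : sdev P X H ^ 2 = variance (uStat X H) P := Real.sq_sqrt (variance_nonneg _ _)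
  have h6 := sq_le_sq' (abs_le.mp h4).1 (abs_le.mp h4).2
  have h7 : sdev P X H * √(variance (nearSum X H m) P) ≤ sdev P X H * √w :=
    mul_le_mul_of_nonneg_left (Real.sqrt_le_sqrt hw) (Real.sqrt_nonneg _)
  have h8 := sq_nonneg (∫ ω, farSum X H m ω ∂P)
  change |_| ≤ 2 * (sdev P X H * _) + _ at h1
  rw [← h5] at h1
  simp only [Pi.pow_apply] at h2
  rw [abs_le] at h1 h3 ⊢
  constructor <;> linarith

/-- The distance of the standardised statistic to the normal law for one sample. -/
lemma abs_integral_stdUStat_sub_le (h : BoundedSample P X H m β r K b G ε₁ ε₂ ε₄ η)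
    {a₂ D₄ v w : ℝ} (ha₂ : ∀ i, ∫ ω, rowSum X H m i ω ^ 2 ∂P ≤ a₂)
    (hD : ∀ i, ∫ ω, touchSum X H m i ω ^ 4 ∂P ≤ D₄)
    (hv : variance (quadSum X H m) P ≤ v) (hw : variance (nearSum X H m) P ≤ w)
    (hs : 0 < sdev P X H) {g : ℝ → ℝ} (hg : LipschitzWith 1 g) :
    |∫ ω, g (stdUStat P X H ω) ∂P - ∫ x, g x ∂(gaussianReal 0 1)|
      ≤ (sdev P X H)⁻¹ * (√w + (Fintype.card ι : ℝ) ^ 2 * (2 * ε₁))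
        + (20 * ((sdev P X H)⁻¹) ^ 2 * (2 * (sdev P X H * √w) + w
              + ((Fintype.card ι : ℝ) ^ 2 * (2 * ε₁)) ^ 2 + (Fintype.card ι : ℝ) ^ 4 * (2 * ε₂)
              + 2 * √v + 2 * (Fintype.card ι * (√a₂ * ((η : ℝ) ^ 2 * K))))
          + 20 * ((sdev P X H)⁻¹) ^ 3 * (Fintype.card ι * (√a₂ * √D₄))
          + (sdev P X H)⁻¹ * ((Fintype.card ι : ℝ) ^ 2 * (40 * ε₁))) := by
  set s := sdev P X H with hsd
  have hU := memLp_two_of_four h.memLp_farSum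
  have iU : Integrable (fun ω => farSum X H m ω / s) P := (hU.integrable (by norm_num)).div_const s
  have iV : Integrable (nearSum X H m) P := h.memLp_nearSum.integrable (by norm_num)
  have iW : Integrable (stdUStat P X H) P :=
    ((h.memLp_uStat.integrable (by norm_num)).sub (integrable_const _)).div_const s
  have hstein := abs_integral_sub_gaussian_le iU
    (fun f f' hf hf0 hf' hL => h.abs_integral_stein_le ha₂ hD hv hs hf hf0 hf' hL) hg
  have hsq := h.abs_sdev_sq_sub_le ha₂ hw
  have hmean : ∫ ω, uStat X H ω ∂P = ∫ ω, farSum X H m ω ∂P + ∫ ω, nearSum X H m ω ∂P := by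
    rw [← integral_add (hU.integrable (by norm_num)) iV]
    exact integral_congr_ae (Eventually.of_forall uStat_eq)
  set eU := ∫ ω, farSum X H m ω ∂P with heU
  set eV := ∫ ω, nearSum X H m ω ∂P with heV
  have hsi : 0 < s⁻¹ := inv_pos.mpr hs
  have hpt : ∀ ω, |g (stdUStat P X H ω) - g (farSum X H m ω / s)|
      ≤ s⁻¹ * (|nearSum X H m ω - eV| + |eU|) := fun ω => by
    have h1 := hg.dist_le_mul (stdUStat P X H ω) (farSum X H m ω / s)
    simp only [Real.dist_eq, NNReal.coe_one, one_mul] at h1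
    refine h1.trans ?_
    have h2 : stdUStat P X H ω - farSum X H m ω / s = s⁻¹ * ((nearSum X H m ω - eV) - eU) := by
      rw [stdUStat, hmean, uStat_eq (m := m), ← hsd]
      field_simp
      ring
    rw [h2, abs_mul, abs_of_pos hsi]
    gcongr
    exact abs_sub _ _
  have iNe : Integrable (fun ω => |nearSum X H m ω - eV|) P := (iV.sub (integrable_const _)).abs
  have ig1 := integrable_comp_of_lipschitz iW hg
  have ig2 := integrable_comp_of_lipschitz iU hg
  have hdiff : |∫ ω, g (stdUStat P X H ω) ∂P - ∫ ω, g (farSum X H m ω / s) ∂P|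
      ≤ s⁻¹ * (√w + (Fintype.card ι : ℝ) ^ 2 * (2 * ε₁)) := by
    rw [← integral_sub ig1 ig2]
    refine abs_integral_le_integral_abs.trans ((integral_mono (ig1.sub ig2).abs
      ((iNe.add (integrable_const _)).const_mul _) hpt).trans ?_)
    have e1 : ∫ ω, s⁻¹ * (|nearSum X H m ω - eV| + |eU|) ∂P
        = s⁻¹ * (∫ ω, |nearSum X H m ω - eV| ∂P + |eU|) := by
      rw [integral_const_mul, integral_add iNe (integrable_const _)]
      simp
    refine (le_of_eq e1).trans ?_
    gcongr
    · refine (integral_abs_le_sqrt (h.memLp_nearSum.sub (memLp_const eV))).trans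
        (Real.sqrt_le_sqrt (le_trans (le_of_eq ?_) hw))
      exact integral_sub_mean_sq_eq h.memLp_nearSum
    · exact h.abs_integral_farSum_le
  have h4 := abs_add_le (∫ ω, g (stdUStat P X H ω) ∂P - ∫ ω, g (farSum X H m ω / s) ∂P)
    (∫ ω, g (farSum X H m ω / s) ∂P - ∫ x, g x ∂(gaussianReal 0 1))
  rw [sub_add_sub_cancel] at h4
  refine h4.trans (add_le_add hdiff (hstein.trans ?_))
  rw [← hsd] at hsq
  refine add_le_add_left (add_le_add_left (mul_le_mul_of_nonneg_left ?_ (by positivity)) _) _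
  linarith

end BoundedSample

end WassersteinBound

/-! ### Comparison of all error terms with the rate -/

section Rates

variable {a b c k₂ k₄ k₈ ρ σ K x G T : ℝ}

/-- The numerical relations between the parameters of a sample: `ρ ^ 2` is the sample size, `σ ^ 2`
the size of a neighbourhood and `T` the rate. -/
structure RateBounds (a ρ σ K x G T : ℝ) : Prop where
  a_pos : 0 < a
  one_le_σ : 1 ≤ σ
  σ_le : σ ≤ ρ
  a_le : a ≤ K
  x_nonneg : 0 ≤ x
  G_nonneg : 0 ≤ G
  T_eq : T = ρ ^ 2 * σ ^ 2 * x + σ ^ 7 / ρ * K ^ 2 + σ ^ 4 * G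
  T_le : T ≤ 1

namespace RateBounds

lemma ρ_pos (h : RateBounds a ρ σ K x G T) : 0 < ρ := by linarith [h.one_le_σ, h.σ_le]

lemma K_pos (h : RateBounds a ρ σ K x G T) : 0 < K := by linarith [h.a_pos, h.a_le]

lemma T_nonneg (h : RateBounds a ρ σ K x G T) : 0 ≤ T := by
  have := h.one_le_σ
  have := h.ρ_pos
  have := h.x_nonneg
  have := h.G_nonneg
  rw [h.T_eq]
  positivity

lemma first_le (h : RateBounds a ρ σ K x G T) : ρ ^ 2 * σ ^ 2 * x ≤ T := by
  have := h.one_le_σ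
  have := h.ρ_pos
  have := h.x_nonneg
  have := h.G_nonneg
  have h1 : 0 ≤ σ ^ 7 / ρ * K ^ 2 := by positivity
  have h2 : 0 ≤ σ ^ 4 * G := by positivity
  linarith [h.T_eq]

lemma second_le (h : RateBounds a ρ σ K x G T) : σ ^ 7 * K ^ 2 ≤ ρ * T := by
  have := h.one_le_σ
  have := h.ρ_pos
  have := h.x_nonneg
  have := h.G_nonneg
  have h1 : 0 ≤ ρ ^ 2 * σ ^ 2 * x := by positivity
  have h2 : 0 ≤ σ ^ 4 * G := by positivity
  have h3 : σ ^ 7 / ρ * K ^ 2 ≤ T := by linarith [h.T_eq]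
  calc σ ^ 7 * K ^ 2 = ρ * (σ ^ 7 / ρ * K ^ 2) := by field_simp
    _ ≤ ρ * T := by gcongr

lemma third_le (h : RateBounds a ρ σ K x G T) : σ ^ 4 * G ≤ T := by
  have := h.one_le_σ
  have := h.ρ_pos
  have := h.x_nonneg
  have h1 : 0 ≤ ρ ^ 2 * σ ^ 2 * x := by positivity
  have h2 : 0 ≤ σ ^ 7 / ρ * K ^ 2 := by positivity
  linarith [h.T_eq]

lemma size_mul_le (h : RateBounds a ρ σ K x G T) : ρ ^ 2 * x ≤ T := by
  have h1 := h.x_nonneg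
  have h2 := h.ρ_pos
  refine le_trans ?_ h.first_le
  have : (1 : ℝ) ≤ σ ^ 2 := one_le_pow₀ h.one_le_σ
  have h3 : 0 ≤ ρ ^ 2 * x := by positivity
  nlinarith

lemma x_le (h : RateBounds a ρ σ K x G T) : x ≤ 1 := by
  have h1 := h.size_mul_le.trans h.T_le
  have h2 : (1 : ℝ) ≤ ρ ^ 2 := one_le_pow₀ (h.one_le_σ.trans h.σ_le)
  nlinarith [h.x_nonneg]

lemma pow_mul_le (h : RateBounds a ρ σ K x G T) {k : ℕ} (hk : k ≤ 7) :
    σ ^ k * K ^ 2 ≤ ρ * T := by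
  refine le_trans ?_ h.second_le
  gcongr
  exact h.one_le_σ

/-- The rate contains the square of `K`. Where only the first power occurs, the lower bound a ≤ K
supplies the missing factor. -/
lemma pow_mul_le' (h : RateBounds a ρ σ K x G T) {k : ℕ} (hk : k ≤ 7) :
    σ ^ k * K ≤ a⁻¹ * (ρ * T) := by
  have h1 := h.a_pos
  have h2 := h.one_le_σ
  have h3 := h.K_pos
  have h4 := h.a_le
  rw [← div_eq_inv_mul, le_div_iff₀ h1]
  refine le_trans ?_ (h.pow_mul_le hk)
  calc σ ^ k * K * a ≤ σ ^ k * K * K := by gcongr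
    _ = _ := by ring

lemma sq_T_le (h : RateBounds a ρ σ K x G T) : T ^ 2 ≤ T := by
  nlinarith [h.T_nonneg, h.T_le]

lemma sqrt_nearVar_le (h : RateBounds a ρ σ K x G T) (hk : 1 ≤ k₄) :
    √(2 * (ρ ^ 2 * σ ^ 2) ^ 2 * (x ^ 2 / a ^ 2) + 2 * (k₄ * (ρ ^ 2 * (σ ^ 2) ^ 3)) * K ^ 2)
      ≤ (2 + 2 * k₄) / a * (ρ ^ 2 * T) := by
  have h1 := h.a_pos
  have h2 := h.one_le_σ
  have h3 := h.ρ_pos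
  have h4 := h.x_nonneg
  have h5 := h.K_pos
  have h6 := h.T_nonneg
  have hρ : 1 ≤ ρ := h.one_le_σ.trans h.σ_le
  have e : √(2 * (ρ ^ 2 * σ ^ 2) ^ 2 * (x ^ 2 / a ^ 2)
      + 2 * (k₄ * (ρ ^ 2 * (σ ^ 2) ^ 3)) * K ^ 2)
      ≤ 2 * (ρ ^ 2 * σ ^ 2 * (x / a)) + 2 * k₄ * (ρ * (σ ^ 3 * K)) := by
    rw [Real.sqrt_le_iff]
    refine ⟨by positivity, ?_⟩
    set y := ρ ^ 2 * σ ^ 2 * (x / a) with hy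
    set z := ρ * (σ ^ 3 * K) with hz
    have hy0 : 0 ≤ y := by positivity
    have hz0 : 0 ≤ z := by positivity
    have e1 : 2 * (ρ ^ 2 * σ ^ 2) ^ 2 * (x ^ 2 / a ^ 2)
      + 2 * (k₄ * (ρ ^ 2 * (σ ^ 2) ^ 3)) * K ^ 2 = 2 * y ^ 2 + 2 * k₄ * z ^ 2 := by
      simp only [hy, hz]; ring
    rw [e1]
    have e2 : k₄ * z ^ 2 ≤ k₄ ^ 2 * z ^ 2 := by
      have : k₄ ≤ k₄ ^ 2 := by nlinarith
      gcongr
    have e3 : 0 ≤ y * (k₄ * z) := by positivity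
    have e4 : 0 ≤ k₄ ^ 2 * z ^ 2 := by positivity
    nlinarith [sq_nonneg y]
  refine e.trans ?_
  have b1 : ρ ^ 2 * σ ^ 2 * (x / a) ≤ a⁻¹ * (ρ ^ 2 * T) := by
    calc ρ ^ 2 * σ ^ 2 * (x / a) = a⁻¹ * (1 * (ρ ^ 2 * σ ^ 2 * x)) := by ring
      _ ≤ a⁻¹ * (ρ ^ 2 * T) := by
        have := h.first_le
        have := one_le_pow₀ hρ (n := 2)
        gcongr
  have b2 : ρ * (σ ^ 3 * K) ≤ a⁻¹ * (ρ ^ 2 * T) := by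
    calc ρ * (σ ^ 3 * K) ≤ ρ * (a⁻¹ * (ρ * T)) := by
          have := h.pow_mul_le' (k := 3) (by norm_num)
          gcongr
      _ = _ := by ring
  calc _ ≤ 2 * (a⁻¹ * (ρ ^ 2 * T)) + 2 * k₄ * (a⁻¹ * (ρ ^ 2 * T)) := by gcongr
    _ = _ := by ring

/-- After division by s², of order at least ρ⁴, the three parts of the variance match the three
summands of the rate. -/
lemma sqrt_quadVar_le (h : RateBounds a ρ σ K x G T) (hk : 1 ≤ k₈) :
    √(8 * ((ρ ^ 2) ^ 3 * σ ^ 2) ^ 2 * x ^ 2 + 2 * (k₈ * ((ρ ^ 2) ^ 3 * (σ ^ 2) ^ 5)) * K ^ 4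
      + 2 * (ρ ^ 2 * σ ^ 2) ^ 4 * G ^ 2) ≤ (5 + 2 * k₈) * (ρ ^ 4 * T) := by
  have h2 := h.one_le_σ
  have h3 := h.ρ_pos
  have h4 := h.x_nonneg
  have h5 := h.K_pos
  have h6 := h.T_nonneg
  have h7 := h.G_nonneg
  have e : √(8 * ((ρ ^ 2) ^ 3 * σ ^ 2) ^ 2 * x ^ 2
      + 2 * (k₈ * ((ρ ^ 2) ^ 3 * (σ ^ 2) ^ 5)) * K ^ 4 + 2 * (ρ ^ 2 * σ ^ 2) ^ 4 * G ^ 2)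
      ≤ 3 * (ρ ^ 4 * (ρ ^ 2 * σ ^ 2 * x)) + 2 * k₈ * (ρ ^ 3 * (σ ^ 5 * K ^ 2))
        + 2 * (ρ ^ 4 * (σ ^ 4 * G)) := by
    rw [Real.sqrt_le_iff]
    refine ⟨by positivity, ?_⟩
    set y := ρ ^ 4 * (ρ ^ 2 * σ ^ 2 * x) with hy
    set z := ρ ^ 3 * (σ ^ 5 * K ^ 2) with hz
    set t := ρ ^ 4 * (σ ^ 4 * G) with ht
    have hy0 : 0 ≤ y := by positivity
    have hz0 : 0 ≤ z := by positivity
    have ht0 : 0 ≤ t := by positivity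
    have e1 : 8 * ((ρ ^ 2) ^ 3 * σ ^ 2) ^ 2 * x ^ 2
      + 2 * (k₈ * ((ρ ^ 2) ^ 3 * (σ ^ 2) ^ 5)) * K ^ 4 + 2 * (ρ ^ 2 * σ ^ 2) ^ 4 * G ^ 2
      = 8 * y ^ 2 + 2 * k₈ * z ^ 2 + 2 * t ^ 2 := by
      simp only [hy, hz, ht]; ring
    rw [e1]
    have e2 : k₈ * z ^ 2 ≤ k₈ ^ 2 * z ^ 2 := by
      have : k₈ ≤ k₈ ^ 2 := by nlinarith
      gcongr
    have e3 : 0 ≤ y * (k₈ * z) := by positivity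
    have e4 : 0 ≤ k₈ ^ 2 * z ^ 2 := by positivity
    have e5 : 0 ≤ y * t := by positivity
    have e6 : 0 ≤ t * (k₈ * z) := by positivity
    nlinarith [sq_nonneg y, sq_nonneg t]
  refine e.trans ?_
  have b1 : ρ ^ 3 * (σ ^ 5 * K ^ 2) ≤ ρ ^ 4 * T := by
    calc ρ ^ 3 * (σ ^ 5 * K ^ 2) ≤ ρ ^ 3 * (ρ * T) := by
          have := h.pow_mul_le (k := 5) (by norm_num)
          gcongr
      _ = _ := by ring
  have b2 := h.first_le
  have b3 := h.third_le
  calc _ ≤ 3 * (ρ ^ 4 * T) + 2 * k₈ * (ρ ^ 4 * T) + 2 * (ρ ^ 4 * T) := by gcongr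
    _ = _ := by ring

/-- Since ρ² x ≤ T ≤ 1, the mixing error in the second moment is bounded, and a row sum has size ρσ
with a constant free of `K`. -/
lemma sqrt_rowVar_le (h : RateBounds a ρ σ K x G T) (hk : 0 ≤ k₂) :
    √(2 * (ρ ^ 2) ^ 2 * (x ^ 2 / a ^ 2) + k₂ * (ρ ^ 2 * σ ^ 2) * (b ^ 2 + 2 * (x ^ 2 / a ^ 2)))
      ≤ √(2 / a ^ 2 + k₂ * (b ^ 2 + 2 / a ^ 2)) * (ρ * σ) := by
  have h1 := h.a_pos
  have h2 := h.one_le_σ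
  have h3 := h.ρ_pos
  have h4 := h.x_nonneg
  have hρ : 1 ≤ ρ := h.one_le_σ.trans h.σ_le
  have hx := pow_le_one₀ (n := 2) h4 h.x_le
  have hnx := pow_le_one₀ (n := 2) (by positivity) (h.size_mul_le.trans h.T_le)
  rw [← Real.sqrt_sq (by positivity : 0 ≤ ρ * σ), ← Real.sqrt_mul (by positivity)]
  apply Real.sqrt_le_sqrt
  have e0 : 1 ≤ (ρ * σ) ^ 2 := one_le_pow₀ (one_le_mul_of_one_le_of_one_le hρ h2)
  have e1 : (ρ ^ 2) ^ 2 * (x ^ 2 / a ^ 2) ≤ 1 / a ^ 2 * (ρ * σ) ^ 2 := by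
    calc (ρ ^ 2) ^ 2 * (x ^ 2 / a ^ 2) = 1 / a ^ 2 * (ρ ^ 2 * x) ^ 2 := by ring
      _ ≤ 1 / a ^ 2 * (ρ * σ) ^ 2 := mul_le_mul_of_nonneg_left (hnx.trans e0) (by positivity)
  have e2 : x ^ 2 / a ^ 2 ≤ 1 / a ^ 2 := by gcongr
  calc _ ≤ 2 * (1 / a ^ 2 * (ρ * σ) ^ 2)
        + k₂ * (ρ ^ 2 * σ ^ 2) * (b ^ 2 + 2 * (1 / a ^ 2)) := by
        rw [mul_assoc 2]; gcongr
    _ = _ := by ring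

/-- The mixing error carries no `K` and is absorbed through a ≤ K; the local part is absorbed
through σ ≤ ρ. -/
lemma sqrt_touchMoment_le (h : RateBounds a ρ σ K x G T) (hk : 0 ≤ k₄) :
    √(128 * (σ ^ 2) ^ 4 * (2 * (ρ ^ 2) ^ 4 * x ^ 2 + k₄ * ((ρ ^ 2) ^ 2 * (σ ^ 2) ^ 2) * K ^ 4)
        + 8 * ((σ ^ 2) ^ 2 * K) ^ 4)
      ≤ √(128 * (2 / a ^ 4 + k₄) + 8) * (ρ ^ 2 * (σ ^ 6 * K ^ 2)) := by
  have h1 := h.a_pos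
  have h2 := h.one_le_σ
  have h3 := h.ρ_pos
  have h4 := h.x_nonneg
  have h5 := h.K_pos
  have h6 := h.a_le
  have h8 := h.σ_le
  have hnx := pow_le_one₀ (n := 2) (by positivity) (h.size_mul_le.trans h.T_le)
  rw [← Real.sqrt_sq (by positivity : 0 ≤ ρ ^ 2 * (σ ^ 6 * K ^ 2)), ← Real.sqrt_mul (by positivity)]
  apply Real.sqrt_le_sqrt
  have e1 : (ρ ^ 2) ^ 4 * x ^ 2 ≤ 1 / a ^ 4 * (ρ ^ 4 * σ ^ 4 * K ^ 4) := by
    calc (ρ ^ 2) ^ 4 * x ^ 2 = 1 / a ^ 4 * (ρ ^ 4 * (ρ ^ 2 * x) ^ 2 * a ^ 4) := by field_simp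
      _ ≤ 1 / a ^ 4 * (ρ ^ 4 * σ ^ 4 * K ^ 4) := by
        gcongr
        exact hnx.trans (one_le_pow₀ h2)
  have e2 : ((σ ^ 2) ^ 2 * K) ^ 4 ≤ ρ ^ 4 * σ ^ 12 * K ^ 4 := by
    calc ((σ ^ 2) ^ 2 * K) ^ 4 = σ ^ 4 * σ ^ 12 * K ^ 4 := by ring
      _ ≤ _ := by gcongr
  calc _ ≤ 128 * (σ ^ 2) ^ 4 * (2 * (1 / a ^ 4 * (ρ ^ 4 * σ ^ 4 * K ^ 4))
        + k₄ * ((ρ ^ 2) ^ 2 * (σ ^ 2) ^ 2) * K ^ 4) + 8 * (ρ ^ 4 * σ ^ 12 * K ^ 4) := by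
        rw [mul_assoc 2]; gcongr
    _ = _ := by ring

end RateBounds

/-- Every summand is bounded by a power of s⁻¹ρ² ≤ c⁻¹ times T or T², and T² ≤ T as T ≤ 1. The full
power σ⁷ is needed only in the third-order term `q7`; the other terms involve at most σ⁵. -/
lemma exists_rate_const (ha : 0 < a) (hc : 0 < c) (hk₂ : 0 ≤ k₂) (hk₄ : 1 ≤ k₄) (hk₈ : 1 ≤ k₈) :
    ∃ C : ℝ, 0 < C ∧ ∀ ρ σ K x G T s a₂ D₄ v w : ℝ, RateBounds a ρ σ K x G T → c * ρ ^ 2 ≤ s →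
      a₂ = 2 * (ρ ^ 2) ^ 2 * (x ^ 2 / a ^ 2)
        + k₂ * (ρ ^ 2 * σ ^ 2) * (b ^ 2 + 2 * (x ^ 2 / a ^ 2)) →
      D₄ = 128 * (σ ^ 2) ^ 4 * (2 * (ρ ^ 2) ^ 4 * x ^ 2
        + k₄ * ((ρ ^ 2) ^ 2 * (σ ^ 2) ^ 2) * K ^ 4) + 8 * ((σ ^ 2) ^ 2 * K) ^ 4 →
      v = 8 * ((ρ ^ 2) ^ 3 * σ ^ 2) ^ 2 * x ^ 2
        + 2 * (k₈ * ((ρ ^ 2) ^ 3 * (σ ^ 2) ^ 5)) * K ^ 4 + 2 * (ρ ^ 2 * σ ^ 2) ^ 4 * G ^ 2 →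
      w = 2 * (ρ ^ 2 * σ ^ 2) ^ 2 * (x ^ 2 / a ^ 2)
        + 2 * (k₄ * (ρ ^ 2 * (σ ^ 2) ^ 3)) * K ^ 2 →
      s⁻¹ * (√w + (ρ ^ 2) ^ 2 * (2 * (x / a)))
        + (20 * (s⁻¹) ^ 2 * (2 * (s * √w) + w + ((ρ ^ 2) ^ 2 * (2 * (x / a))) ^ 2
              + (ρ ^ 2) ^ 4 * (2 * (x ^ 2 / a ^ 2)) + 2 * √v
              + 2 * (ρ ^ 2 * (√a₂ * ((σ ^ 2) ^ 2 * K))))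
          + 20 * (s⁻¹) ^ 3 * (ρ ^ 2 * (√a₂ * √D₄))
          + s⁻¹ * ((ρ ^ 2) ^ 2 * (40 * (x / a)))) ≤ C * T := by
  set Cw := (2 + 2 * k₄) / a with hCw
  set A₂ := √(2 / a ^ 2 + k₂ * (b ^ 2 + 2 / a ^ 2)) with hA₂
  set A₄ := √(128 * (2 / a ^ 4 + k₄) + 8) with hA₄
  have hCw0 : 0 < Cw := by positivity
  have hA₂0 : 0 ≤ A₂ := Real.sqrt_nonneg _
  have hA₄0 : 0 ≤ A₄ := Real.sqrt_nonneg _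
  refine ⟨c⁻¹ * (Cw + 2 / a) + (20 * (2 * (c⁻¹ * Cw) + (c⁻¹) ^ 2 * (Cw ^ 2 + 4 / a ^ 2 + 2 / a ^ 2
    + 2 * (5 + 2 * k₈) + 2 * (A₂ / a))) + 20 * (c⁻¹) ^ 3 * (A₂ * A₄) + c⁻¹ * (40 / a)),
    by positivity, ?_⟩
  intro ρ σ K x G T s a₂ D₄ v w h hs ha₂ hD₄ hv hw
  have h2 := h.one_le_σ
  have h3 := h.ρ_pos
  have h4 := h.x_nonneg
  have h5 := h.K_pos
  have h6 := h.T_nonneg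
  have hT2 := h.sq_T_le
  have hs0 : 0 < s := lt_of_lt_of_le (by positivity) hs
  have hu0 : 0 < s⁻¹ := inv_pos.mpr hs0
  have hu : s⁻¹ * ρ ^ 2 ≤ c⁻¹ := by
    rw [inv_mul_le_iff₀ hs0, ← div_eq_mul_inv, le_div_iff₀ hc, mul_comm]; exact hs
  have hw0 : 0 ≤ w := by rw [hw]; positivity
  have bw : √w ≤ Cw * (ρ ^ 2 * T) := by rw [hw]; exact h.sqrt_nearVar_le hk₄
  have bv : √v ≤ (5 + 2 * k₈) * (ρ ^ 4 * T) := by rw [hv]; exact h.sqrt_quadVar_le hk₈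
  have ba₂ : √a₂ ≤ A₂ * (ρ * σ) := by rw [ha₂]; exact h.sqrt_rowVar_le hk₂
  have bD₄ : √D₄ ≤ A₄ * (ρ ^ 2 * (σ ^ 6 * K ^ 2)) := by
    rw [hD₄]; exact h.sqrt_touchMoment_le (by linarith)
  have hx := h.size_mul_le
  have q1 : s⁻¹ * √w ≤ c⁻¹ * Cw * T := by
    calc s⁻¹ * √w ≤ s⁻¹ * (Cw * (ρ ^ 2 * T)) := by gcongr
      _ = s⁻¹ * ρ ^ 2 * (Cw * T) := by ring
      _ ≤ c⁻¹ * (Cw * T) := by gcongr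
      _ = _ := by ring
  have qx : s⁻¹ * (ρ ^ 2) ^ 2 * (x / a) ≤ c⁻¹ * (1 / a) * T := by
    calc s⁻¹ * (ρ ^ 2) ^ 2 * (x / a) = s⁻¹ * ρ ^ 2 * (1 / a * (ρ ^ 2 * x)) := by ring
      _ ≤ c⁻¹ * (1 / a * T) := by gcongr
      _ = _ := by ring
  have q2 : (s⁻¹) ^ 2 * w ≤ (c⁻¹) ^ 2 * Cw ^ 2 * T := by
    calc (s⁻¹) ^ 2 * w = (s⁻¹ * √w) ^ 2 := by rw [mul_pow, Real.sq_sqrt hw0]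
      _ ≤ (c⁻¹ * Cw * T) ^ 2 := by gcongr
      _ = (c⁻¹) ^ 2 * Cw ^ 2 * T ^ 2 := by ring
      _ ≤ _ := by gcongr
  have q3 : (s⁻¹) ^ 2 * ((ρ ^ 2) ^ 2 * (2 * (x / a))) ^ 2 ≤ (c⁻¹) ^ 2 * (4 / a ^ 2) * T := by
    calc (s⁻¹) ^ 2 * ((ρ ^ 2) ^ 2 * (2 * (x / a))) ^ 2
        = 4 * (s⁻¹ * (ρ ^ 2) ^ 2 * (x / a)) ^ 2 := by ring
      _ ≤ 4 * (c⁻¹ * (1 / a) * T) ^ 2 := by gcongr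
      _ = (c⁻¹) ^ 2 * (4 / a ^ 2) * T ^ 2 := by ring
      _ ≤ _ := by gcongr
  have q4 : (s⁻¹) ^ 2 * ((ρ ^ 2) ^ 4 * (2 * (x ^ 2 / a ^ 2))) ≤ (c⁻¹) ^ 2 * (2 / a ^ 2) * T := by
    calc (s⁻¹) ^ 2 * ((ρ ^ 2) ^ 4 * (2 * (x ^ 2 / a ^ 2)))
        = 2 * (s⁻¹ * (ρ ^ 2) ^ 2 * (x / a)) ^ 2 := by ring
      _ ≤ 2 * (c⁻¹ * (1 / a) * T) ^ 2 := by gcongr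
      _ = (c⁻¹) ^ 2 * (2 / a ^ 2) * T ^ 2 := by ring
      _ ≤ _ := by gcongr
  have q5 : (s⁻¹) ^ 2 * √v ≤ (c⁻¹) ^ 2 * (5 + 2 * k₈) * T := by
    calc (s⁻¹) ^ 2 * √v ≤ (s⁻¹) ^ 2 * ((5 + 2 * k₈) * (ρ ^ 4 * T)) := by gcongr
      _ = (s⁻¹ * ρ ^ 2) ^ 2 * ((5 + 2 * k₈) * T) := by ring
      _ ≤ (c⁻¹) ^ 2 * ((5 + 2 * k₈) * T) := by gcongr
      _ = _ := by ring
  have q6 : (s⁻¹) ^ 2 * (ρ ^ 2 * (√a₂ * ((σ ^ 2) ^ 2 * K))) ≤ (c⁻¹) ^ 2 * (A₂ / a) * T := by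
    have hK := h.pow_mul_le' (k := 5) (by norm_num)
    calc (s⁻¹) ^ 2 * (ρ ^ 2 * (√a₂ * ((σ ^ 2) ^ 2 * K)))
        ≤ (s⁻¹) ^ 2 * (ρ ^ 2 * (A₂ * (ρ * σ) * ((σ ^ 2) ^ 2 * K))) := by gcongr
      _ = (s⁻¹) ^ 2 * (ρ ^ 3 * (A₂ * (σ ^ 5 * K))) := by ring
      _ ≤ (s⁻¹) ^ 2 * (ρ ^ 3 * (A₂ * (a⁻¹ * (ρ * T)))) := by gcongr
      _ = (s⁻¹ * ρ ^ 2) ^ 2 * (A₂ / a * T) := by ring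
      _ ≤ (c⁻¹) ^ 2 * (A₂ / a * T) := by gcongr
      _ = _ := by ring
  have q7 : (s⁻¹) ^ 3 * (ρ ^ 2 * (√a₂ * √D₄)) ≤ (c⁻¹) ^ 3 * (A₂ * A₄) * T := by
    have hK := h.second_le
    calc (s⁻¹) ^ 3 * (ρ ^ 2 * (√a₂ * √D₄))
        ≤ (s⁻¹) ^ 3 * (ρ ^ 2 * (A₂ * (ρ * σ) * (A₄ * (ρ ^ 2 * (σ ^ 6 * K ^ 2))))) := by gcongr
      _ = (s⁻¹) ^ 3 * (ρ ^ 5 * (A₂ * A₄ * (σ ^ 7 * K ^ 2))) := by ring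
      _ ≤ (s⁻¹) ^ 3 * (ρ ^ 5 * (A₂ * A₄ * (ρ * T))) := by gcongr
      _ = (s⁻¹ * ρ ^ 2) ^ 3 * (A₂ * A₄ * T) := by ring
      _ ≤ (c⁻¹) ^ 3 * (A₂ * A₄ * T) := by gcongr
      _ = _ := by ring
  have q8 : (s⁻¹) ^ 2 * (2 * (s * √w)) = 2 * (s⁻¹ * √w) := by field_simp
  linear_combination q1 + 2 * qx + 40 * q1 + 20 * q2 + 20 * q3 + 20 * q4 + 40 * q5 + 40 * q6
    + 20 * q7 + 40 * qx + 20 * q8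

end Rates

/-! ### The bound for one sample with real parameters -/

section Assembly

universe u

variable {Ω : Type*} [MeasurableSpace Ω] {P : Measure Ω} [IsProbabilityMeasure P] {d : ℕ}

/-- The bound for one sample in terms of real parameters, with a constant that does not depend on
the sample. -/
lemma exists_const_boundedSample (P : Measure Ω) [IsProbabilityMeasure P] (d : ℕ) {a c : ℝ} (b : ℝ)
    (ha : 0 < a) (hc : 0 < c) :
    ∃ C : ℝ, 0 < C ∧ ∀ (ι : Type u) [Fintype ι] [EMetricSpace ι] (X : ι → Ω → Pt d)
      (H : Pt d → Pt d → ℝ) (m : ℝ) (β : ℝ≥0∞) (r K G x T : ℝ) (η : ℕ),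
      BoundedSample P X H m β r K b G (x / a) (x ^ 2 / a ^ 2) (x ^ 2) η →
      c * Fintype.card ι ≤ sdev P X H → 1 ≤ η → a ≤ K → 0 ≤ x →
      T = Fintype.card ι * η * x + √((η : ℝ) ^ 7 / Fintype.card ι) * K ^ 2 + (η : ℝ) ^ 2 * G →
      T ≤ 1 → ∀ g : ℝ → ℝ, LipschitzWith 1 g →
      |∫ ω, g (stdUStat P X H ω) ∂P - ∫ y, g y ∂(gaussianReal 0 1)| ≤ C * T := by
  have hpos : ∀ q : ℕ, 0 < q → (1 : ℝ) ≤ countConst q := fun q hq => by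
    have : 0 < countConst q := by rw [countConst]; positivity
    exact_mod_cast this
  obtain ⟨C, hC0, hC⟩ := exists_rate_const (a := a) (b := b) (c := c) (k₂ := countConst 2)
    (k₄ := countConst 4) (k₈ := countConst 8) ha hc (by positivity) (hpos 4 (by norm_num))
    (hpos 8 (by norm_num))
  refine ⟨C, hC0, ?_⟩
  intro ι _ _ X H m β r K G x T η h hs hη haK hx hT hT1 g hg
  have hηN := h.η_le
  -- Square roots of the sample size and of the neighbourhood size make all terms under the roots
  -- polynomial.
  obtain ⟨ρ, hρ0, hρ⟩ : ∃ ρ : ℝ, 0 ≤ ρ ∧ (Fintype.card ι : ℝ) = ρ ^ 2 :=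
    ⟨√(Fintype.card ι), Real.sqrt_nonneg _, (Real.sq_sqrt (Nat.cast_nonneg _)).symm⟩
  obtain ⟨σ, hσ0, hσ⟩ : ∃ σ : ℝ, 0 ≤ σ ∧ (η : ℝ) = σ ^ 2 :=
    ⟨√η, Real.sqrt_nonneg _, (Real.sq_sqrt (Nat.cast_nonneg _)).symm⟩
  have hη' : (1 : ℝ) ≤ η := by exact_mod_cast hη
  have hηN' : (η : ℝ) ≤ Fintype.card ι := by exact_mod_cast hηN
  have hσ1 : 1 ≤ σ := by
    rw [hσ] at hη'
    exact (one_le_sq_iff₀ hσ0).mp hη'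
  have hσρ : σ ≤ ρ := by
    rw [hσ, hρ] at hηN'
    exact (sq_le_sq₀ hσ0 hρ0).mp hηN'
  have hρpos : 0 < ρ := by linarith
  have ha₄0 : 0 ≤ 2 * (Fintype.card ι : ℝ) ^ 4 * x ^ 2
      + countConst 4 * ((Fintype.card ι : ℝ) ^ 2 * (η : ℝ) ^ 2) * K ^ 4 := by positivity
  have hspos : 0 < sdev P X H := lt_of_lt_of_le (by rw [hρ]; positivity) hs
  have hmain := h.abs_integral_stdUStat_sub_le h.integral_rowSum_sq_le
    (fun i => h.integral_touchSum_pow_four_le i h.integral_rowSum_pow_four_le ha₄0)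
    h.variance_quadSum_le h.variance_nearSum_le hspos hg
  have hsq : √((σ ^ 2) ^ 7 / ρ ^ 2) = σ ^ 7 / ρ := by
    rw [show (σ ^ 2) ^ 7 / ρ ^ 2 = (σ ^ 7 / ρ) ^ 2 by ring, Real.sqrt_sq (by positivity)]
  have hR : RateBounds a ρ σ K x G T :=
    { a_pos := ha
      one_le_σ := hσ1
      σ_le := hσρ
      a_le := haK
      x_nonneg := hx
      G_nonneg := h.G_nonneg
      T_eq := by rw [hT, hρ, hσ, hsq]; ring
      T_le := hT1 }
  rw [hρ] at hs hmain
  rw [hσ] at hmain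
  exact hmain.trans (hC ρ σ K x G T (sdev P X H) _ _ _ _ hR hs rfl rfl rfl rfl)

variable {ι : Type*} {X : ι → Ω → Pt d} {H : Pt d → Pt d → ℝ}

lemma measurable_uStat [Fintype ι] (hX : ∀ i, Measurable (X i))
    (hH : Measurable (Function.uncurry H)) : Measurable (uStat X H) := by
  classical
  unfold uStat
  exact Finset.measurable_fun_sum _ fun i _ => Finset.measurable_fun_sum _ fun k _ =>
    measurable_kernel hX hH i k

lemma measurable_stdUStat [Fintype ι] (hX : ∀ i, Measurable (X i))
    (hH : Measurable (Function.uncurry H)) : Measurable (stdUStat P X H) :=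
  ((measurable_uStat hX hH).sub_const _).div_const _

lemma wassersteinDist_le [Fintype ι] (hX : ∀ i, Measurable (X i))
    (hH : Measurable (Function.uncurry H)) {B : ℝ≥0∞}
    (hB : ∀ g : ℝ → ℝ, LipschitzWith 1 g → ENNReal.ofReal
      |∫ ω, g (stdUStat P X H ω) ∂P - ∫ y, g y ∂(gaussianReal 0 1)| ≤ B) :
    wassersteinDist (P.map (stdUStat P X H)) (gaussianReal 0 1) ≤ B := by
  refine iSup₂_le fun g hg => ?_
  rw [integral_map (measurable_stdUStat hX hH).aemeasurable hg.continuous.aestronglyMeasurable]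
  exact hB g hg

/-- Both laws have first absolute moment at most one, so each expectation is within one of the value
of the test function at the origin. This disposes of the case where the rate is not small. -/
lemma wassersteinDist_le_two [Fintype ι] (hX : ∀ i, Measurable (X i))
    (hH : Measurable (Function.uncurry H)) (hs : 0 < sdev P X H) :
    wassersteinDist (P.map (stdUStat P X H)) (gaussianReal 0 1) ≤ 2 := by
  have hv : 0 < variance (uStat X H) P := Real.sqrt_pos.mp hs
  have hm := measurable_uStat hX hH
  have hL : MemLp (uStat X H) 2 P := by
    rw [← evariance_lt_top_iff_memLp hm.aestronglyMeasurable]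
    -- An infinite variance is recorded as zero in the reals, so a positive standard deviation
    -- forces square integrability.
    refine lt_top_iff_ne_top.mpr fun htop => ?_
    rw [variance, htop] at hv
    simp at hv
  have hW : MemLp (stdUStat P X H) 2 P := by
    have := (hL.sub (memLp_const (∫ ω, uStat X H ω ∂P))).const_mul (sdev P X H)⁻¹
    refine this.ae_eq (Eventually.of_forall fun ω => ?_)
    simp only [stdUStat, Pi.sub_apply]
    ring
  have iW := hW.integrable (by norm_num)
  have h1 : ∫ ω, |stdUStat P X H ω| ∂P ≤ 1 := by
    refine (integral_abs_le_sqrt hW).trans (Real.sqrt_le_one.mpr (le_of_eq ?_))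
    have e : ∀ ω, stdUStat P X H ω ^ 2
        = (sdev P X H ^ 2)⁻¹ * (uStat X H ω - ∫ a, uStat X H a ∂P) ^ 2 := fun ω => by
      rw [stdUStat]; ring
    simp_rw [e]
    rw [integral_const_mul, integral_sub_mean_sq_eq hL, sdev, Real.sq_sqrt hv.le,
      inv_mul_cancel₀ hv.ne']
  refine wassersteinDist_le hX hH fun g hg => ?_
  have hgl : ∀ y, |g y - g 0| ≤ |y| := fun y => by
    simpa [Real.dist_eq] using hg.dist_le_mul y 0
  have e1 : |∫ ω, g (stdUStat P X H ω) ∂P - g 0| ≤ 1 := by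
    have ig := integrable_comp_of_lipschitz iW hg
    have : ∫ ω, g (stdUStat P X H ω) ∂P - g 0 = ∫ ω, (g (stdUStat P X H ω) - g 0) ∂P := by
      rw [integral_sub ig (integrable_const _)]; simp
    rw [this]
    exact abs_integral_le_integral_abs.trans ((integral_mono (ig.sub (integrable_const _)).abs
      iW.abs fun ω => hgl _).trans h1)
  have e2 : |∫ y, g y ∂(gaussianReal 0 1) - g 0| ≤ 1 := by
    have ig := integrable_gaussianReal_of_lipschitz hg
    have : ∫ y, g y ∂(gaussianReal 0 1) - g 0 = ∫ y, (g y - g 0) ∂(gaussianReal 0 1) := by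
      rw [integral_sub ig (integrable_const _)]; simp
    rw [this]
    exact abs_integral_le_integral_abs.trans ((integral_mono (ig.sub (integrable_const _)).abs
      integrable_gaussianReal_id.abs fun y => hgl _).trans integral_abs_gaussianReal_le)
  have e3 : |∫ ω, g (stdUStat P X H ω) ∂P - ∫ y, g y ∂(gaussianReal 0 1)| ≤ 2 := by
    rw [abs_le] at e1 e2 ⊢
    constructor <;> linarith
  calc _ ≤ ENNReal.ofReal 2 := ENNReal.ofReal_le_ofReal e3
    _ = 2 := by simp

lemma indepKernelNorm_two_le (hX : ∀ i, Measurable (X i)) (hH : Measurable (Function.uncurry H))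
    {p : ℝ≥0∞} (hp : 2 ≤ p) : indepKernelNorm P X H 2 ≤ kernelNorm P X H p := by
  refine iSup_mono fun i => iSup_mono fun j => iSup_mono fun _ => le_trans ?_ (le_max_right _ _)
  have := Measure.isProbabilityMeasure_map (μ := P) (hX i).aemeasurable
  have := Measure.isProbabilityMeasure_map (μ := P) (hX j).aemeasurable
  have : IsProbabilityMeasure (indepPair P X i j) := by rw [indepPair]; infer_instance
  exact eLpNorm_le_eLpNorm_of_exponent_le hp hH.aestronglyMeasurable

variable [EMetricSpace ι]

lemma card_nearFin_le [Fintype ι] (m : ℝ) (i : ι) : (nearFin m i).card ≤ maxNbhd ι m := by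
  have h : (nbhd m i).ncard = (nearFin m i).card := by
    rw [← Set.ncard_coe_finset]
    congr 1
    ext j
    simp [nbhd, Near]
  rw [← h]
  exact Finset.le_sup (f := fun i : ι => (nbhd m i).ncard) (Finset.mem_univ i)

lemma maxNbhd_le_card [Fintype ι] (m : ℝ) : maxNbhd ι m ≤ Fintype.card ι := by
  refine Finset.sup_le fun i _ => ?_
  rw [← Nat.card_eq_fintype_card]
  exact Set.ncard_le_card _

lemma one_le_maxNbhd [Fintype ι] [Nonempty ι] (m : ℝ) : 1 ≤ maxNbhd ι m := by
  obtain ⟨i⟩ := ‹Nonempty ι›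
  refine le_trans ?_ (card_nearFin_le m i)
  exact Finset.card_pos.mpr ⟨i, mem_nearFin.mpr (near_refl i)⟩

lemma sampleBeta_le_one (hX : ∀ i, Measurable (X i)) (n₁ n₂ : ℕ∞) (m : ℝ) :
    sampleBeta P X n₁ n₂ m ≤ 1 :=
  iSup_le fun s => iSup_le fun t => iSup_le fun _ => iSup_le fun _ => iSup_le fun _ =>
    betaCoeff_le_one P (sigmaOf_le hX s) (sigmaOf_le hX t)

lemma betaCoeff_le_sampleBeta {m : ℝ} (s t : Finset ι) (hs : s.card ≤ 2)
    (hst : ∀ i ∈ s, ∀ j ∈ t, ENNReal.ofReal m < edist i j) :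
    betaCoeff P (sigmaOf X s) (sigmaOf X t) ≤ sampleBeta P X 2 ⊤ m :=
  le_iSup_of_le s <| le_iSup_of_le t <| le_iSup_of_le (by exact_mod_cast hs) <|
    le_iSup_of_le le_top <| le_iSup_of_le
      (le_iInf₂ fun i hi => le_iInf₂ fun j hj => (hst i hi j hj).le) le_rfl

end Assembly

/-! ### Reducing all decoupling errors to the one for four kernels -/

section DecouplingErrors

variable {Ω : Type*} [MeasurableSpace Ω] {P : Measure Ω} {d : ℕ} {ι : Type*}
  {X : ι → Ω → Pt d} {H : Pt d → Pt d → ℝ} {β : ℝ≥0∞} {r : ℝ}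

/-- For β ≤ 1 the smaller exponent belonging to four kernels gives the larger power, and missing
kernel norms are supplied by the lower bound `κ`. -/
lemma pow_mul_decErr_le (hβ : β ≤ 1) (hr : 4 ≤ r) {κ : ℝ≥0∞}
    (hκ : κ ≤ kernelNorm P X H (ENNReal.ofReal r)) {q k : ℕ} (hqk : q + k = 4) :
    κ ^ k * decErr P X H β r q ≤ decErr P X H β r 4 := by
  have h1 : β ^ (1 - q / r) ≤ β ^ (1 - (4 : ℕ) / r) := by
    refine ENNReal.rpow_le_rpow_of_exponent_ge hβ ?_
    have : (q : ℝ) ≤ (4 : ℕ) := by exact_mod_cast (by omega : q ≤ 4)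
    have hr0 : 0 < r := by linarith
    gcongr
  rw [decErr, decErr]
  calc κ ^ k * (β ^ (1 - q / r) * kernelNorm P X H (ENNReal.ofReal r) ^ q)
      ≤ kernelNorm P X H (ENNReal.ofReal r) ^ k *
        (β ^ (1 - (4 : ℕ) / r) * kernelNorm P X H (ENNReal.ofReal r) ^ q) := by gcongr
    _ = β ^ (1 - (4 : ℕ) / r) * kernelNorm P X H (ENNReal.ofReal r) ^ (q + k) := by ring
    _ = _ := by rw [hqk]

/-- After squaring, the exponent 2 - 2/r exceeds 1 - 4/r, so the error for one kernel is of the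
order of the square root of the error for four, which is the quantity `x` of the rate. -/
lemma sq_mul_decErr_one_le (hβ : β ≤ 1) (hr : 4 ≤ r) {κ : ℝ≥0∞}
    (hκ : κ ≤ kernelNorm P X H (ENNReal.ofReal r)) :
    (κ * decErr P X H β r 1) ^ 2 ≤ decErr P X H β r 4 := by
  have h1 : (β ^ (1 - (1 : ℕ) / r)) ^ 2 ≤ β ^ (1 - (4 : ℕ) / r) := by
    rw [← ENNReal.rpow_natCast, ← ENNReal.rpow_mul]
    refine ENNReal.rpow_le_rpow_of_exponent_ge hβ ?_
    have hr0 : 0 < r := by linarith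
    have : 1 / r ≤ 1 := by rw [div_le_one hr0]; linarith
    have h4 : (4 : ℝ) / r = 4 * (1 / r) := by ring
    have h0 : 0 < 1 / r := by positivity
    push_cast
    linarith
  rw [decErr, decErr]
  calc (κ * (β ^ (1 - (1 : ℕ) / r) * kernelNorm P X H (ENNReal.ofReal r) ^ 1)) ^ 2
      = (β ^ (1 - (1 : ℕ) / r)) ^ 2 * (κ * kernelNorm P X H (ENNReal.ofReal r)) ^ 2 := by ring
    _ ≤ β ^ (1 - (4 : ℕ) / r) * (kernelNorm P X H (ENNReal.ofReal r)
          * kernelNorm P X H (ENNReal.ofReal r)) ^ 2 := by gcongr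
    _ = _ := by ring

/-- The bounds on all decoupling errors in terms of the one for four kernels. -/
lemma decErr_le_of_four (hβ : β ≤ 1) (hr : 4 ≤ r) {a x : ℝ} (ha : 0 < a) (hx : 0 ≤ x)
    (hκ : ENNReal.ofReal a ≤ kernelNorm P X H (ENNReal.ofReal r))
    (h4 : decErr P X H β r 4 ≤ ENNReal.ofReal (x ^ 2)) :
    decErr P X H β r 1 ≤ ENNReal.ofReal (x / a)
      ∧ decErr P X H β r 2 ≤ ENNReal.ofReal (x ^ 2 / a ^ 2) := by
  have ha0 : ENNReal.ofReal a ≠ 0 := by simpa using ha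
  constructor
  · rw [ENNReal.ofReal_div_of_pos ha, ENNReal.le_div_iff_mul_le (Or.inl ha0)
      (Or.inl ENNReal.ofReal_ne_top), mul_comm]
    have := (sq_mul_decErr_one_le hβ hr hκ).trans h4
    rw [ENNReal.ofReal_pow hx] at this
    exact (ENNReal.pow_le_pow_left_iff two_ne_zero).mp this
  · rw [ENNReal.ofReal_div_of_pos (by positivity), ENNReal.le_div_iff_mul_le
      (Or.inl (ENNReal.ofReal_pos.mpr (by positivity)).ne') (Or.inl ENNReal.ofReal_ne_top), mul_comm,
      ENNReal.ofReal_pow ha.le]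
    exact (pow_mul_decErr_le hβ hr hκ (q := 2) (k := 2) rfl).trans h4

end DecouplingErrors

-- The bound for one sample in extended reals, and the theorem

universe u

lemma rpow_half_sq (x : ℝ≥0∞) : (x ^ 2) ^ (1 / 2 : ℝ) = x := by
  rw [← ENNReal.rpow_natCast, ← ENNReal.rpow_mul]
  norm_num

/-- The bound for one sample in terms of the norms of the kernel, with a constant that does not
depend on the sample. -/
lemma exists_const_sample {Ω : Type*} [MeasurableSpace Ω] (P : Measure Ω) [IsProbabilityMeasure P]
    (d : ℕ) {a b c δ : ℝ} (ha : 0 < a) (hc : 0 < c) (hδ : 0 < δ) :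
    ∃ C : ℝ, 0 < C ∧ ∀ (ι : Type u) [Fintype ι] [EMetricSpace ι] (X : ι → Ω → Pt d)
      (H : Pt d → Pt d → ℝ) (m : ℝ) (β : ℝ≥0∞) (η' : ℝ≥0∞), DegenerateSample P X H m β → β ≤ 1 →
      0 < Fintype.card ι → ENNReal.ofReal a ≤ indepKernelNorm P X H 2 →
      indepKernelNorm P X H 2 ≤ ENNReal.ofReal b → c * Fintype.card ι ≤ sdev P X H →
      wassersteinDist (P.map (stdUStat P X H)) (gaussianReal 0 1) ≤ ENNReal.ofReal C *
        (((Fintype.card ι : ℝ≥0∞) ^ 2 * (maxNbhd ι m : ℝ≥0∞) ^ 2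
              * kernelNorm P X H (ENNReal.ofReal (4 + δ)) ^ 4 * β ^ (δ / (4 + δ))) ^ (1 / 2 : ℝ)
          + (((maxNbhd ι m : ℝ≥0∞) ^ 7 + η' ^ 3) / (Fintype.card ι : ℝ≥0∞)
              * kernelNorm P X H 4 ^ 4) ^ (1 / 2 : ℝ)
          + ((maxNbhd ι m : ℝ≥0∞) ^ 4 * gamNorm P X H m 2 ^ 2) ^ (1 / 2 : ℝ)) := by
  -- No sign of `b` is assumed, whereas `BoundedSample` wants a nonnegative bound.
  obtain ⟨C, hC0, hC⟩ := exists_const_boundedSample.{u} P d (max b 0) ha hc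
  refine ⟨max C 2, lt_max_of_lt_left hC0, ?_⟩
  intro ι _ _ X H m β η' h hβ hcard hba hbb hs
  have hX := h.measX
  have hH := h.measH
  set N := Fintype.card ι with hN
  set η := maxNbhd ι m with hη
  set B₁ := ((N : ℝ≥0∞) ^ 2 * (η : ℝ≥0∞) ^ 2
    * kernelNorm P X H (ENNReal.ofReal (4 + δ)) ^ 4 * β ^ (δ / (4 + δ))) ^ (1 / 2 : ℝ) with hB₁
  set B₂ := (((η : ℝ≥0∞) ^ 7 + η' ^ 3) / (N : ℝ≥0∞) * kernelNorm P X H 4 ^ 4) ^ (1 / 2 : ℝ) with hB₂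
  set B₃ := ((η : ℝ≥0∞) ^ 4 * gamNorm P X H m 2 ^ 2) ^ (1 / 2 : ℝ) with hB₃
  have hN0 : (0 : ℝ) < N := by exact_mod_cast hcard
  have hspos : 0 < sdev P X H := lt_of_lt_of_le (by positivity) hs
  -- When the right-hand side is not small, the trivial bound two suffices; hence the maximum in the
  -- constant. Otherwise each summand is below one, which makes all norms that occur finite.
  by_cases hbig : 1 ≤ B₁ + B₂ + B₃
  · calc _ ≤ (2 : ℝ≥0∞) := wassersteinDist_le_two hX hH hspos
      _ = ENNReal.ofReal 2 * 1 := by simp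
      _ ≤ _ := by
        gcongr
        exact le_max_right _ _
  rw [not_le] at hbig
  have : Nonempty ι := Fintype.card_pos_iff.mp hcard
  have hη1 : 1 ≤ η := one_le_maxNbhd m
  have hη0 : (0 : ℝ) < η := by exact_mod_cast hη1
  have hr : (4 : ℝ) ≤ 4 + δ := by linarith
  have hN' : (N : ℝ≥0∞) ≠ 0 := by exact_mod_cast hcard.ne'
  have hη' : (η : ℝ≥0∞) ≠ 0 := by exact_mod_cast (by omega : η ≠ 0)
  have f₁ : (N : ℝ≥0∞) * η * (decErr P X H β (4 + δ) 4) ^ (1 / 2 : ℝ) = B₁ := by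
    have he : 1 - ((4 : ℕ) : ℝ) / (4 + δ) = δ / (4 + δ) := by
      push_cast
      field_simp
      ring
    have e : (N : ℝ≥0∞) ^ 2 * (η : ℝ≥0∞) ^ 2 * kernelNorm P X H (ENNReal.ofReal (4 + δ)) ^ 4
        * β ^ (δ / (4 + δ)) = ((N : ℝ≥0∞) * η) ^ 2 * decErr P X H β (4 + δ) 4 := by
      rw [decErr, he]; ring
    rw [hB₁, e, ENNReal.mul_rpow_of_nonneg _ _ (by norm_num), rpow_half_sq]
  -- The summand with `η'` only enlarges the bound and is dropped.
  have f₂ : ((η : ℝ≥0∞) ^ 7 / N) ^ (1 / 2 : ℝ) * kernelNorm P X H 4 ^ 2 ≤ B₂ := by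
    have e1 : kernelNorm P X H 4 ^ 2 = (kernelNorm P X H 4 ^ 4) ^ (1 / 2 : ℝ) := by
      rw [show 4 = 2 * 2 from rfl, pow_mul, rpow_half_sq]
    rw [hB₂, ENNReal.mul_rpow_of_nonneg _ _ (by norm_num), ← e1]
    gcongr
    exact le_self_add
  have f₃ : (η : ℝ≥0∞) ^ 2 * gamNorm P X H m 2 = B₃ := by
    rw [hB₃, show (4 : ℕ) = 2 * 2 from rfl, pow_mul, ← mul_pow, rpow_half_sq]
  have t₁ : B₁ < 1 := lt_of_le_of_lt (le_self_add.trans le_self_add) hbig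
  have t₂ : B₂ < 1 := lt_of_le_of_lt (le_add_self.trans le_self_add) hbig
  have t₃ : B₃ < 1 := lt_of_le_of_lt le_add_self hbig
  have dtop : (decErr P X H β (4 + δ) 4) ^ (1 / 2 : ℝ) ≠ ⊤ := fun htop => by
    rw [htop, ENNReal.mul_top (mul_ne_zero hN' hη')] at f₁
    exact absurd (f₁ ▸ t₁) (by simp)
  have Ktop : kernelNorm P X H 4 ≠ ⊤ := fun htop => by
    have h0 : ((η : ℝ≥0∞) ^ 7 / N) ^ (1 / 2 : ℝ) ≠ 0 := by
      rw [Ne, ENNReal.rpow_eq_zero_iff]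
      simp [hη']
    rw [htop, ENNReal.top_pow two_ne_zero, ENNReal.mul_top h0, top_le_iff] at f₂
    exact absurd (f₂ ▸ t₂) (by simp)
  have Gtop : gamNorm P X H m 2 ≠ ⊤ := fun htop => by
    rw [htop, ENNReal.mul_top (pow_ne_zero 2 hη')] at f₃
    exact absurd (f₃ ▸ t₃) (by simp)
  -- Half the exponent, so that the error for four kernels is x² and the first summand of the rate
  -- is linear in `x`.
  set x := ((decErr P X H β (4 + δ) 4) ^ (1 / 2 : ℝ)).toReal with hx
  set K := (kernelNorm P X H 4).toReal with hK
  set G := (gamNorm P X H m 2).toReal with hG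
  have hx0 : 0 ≤ x := ENNReal.toReal_nonneg
  have ex : ENNReal.ofReal x = (decErr P X H β (4 + δ) 4) ^ (1 / 2 : ℝ) := ENNReal.ofReal_toReal dtop
  have eK : ENNReal.ofReal K = kernelNorm P X H 4 := ENNReal.ofReal_toReal Ktop
  have eG : ENNReal.ofReal G = gamNorm P X H m 2 := ENNReal.ofReal_toReal Gtop
  have hd4 : decErr P X H β (4 + δ) 4 = ENNReal.ofReal (x ^ 2) := by
    rw [ENNReal.ofReal_pow hx0, ex, ← ENNReal.rpow_natCast, ← ENNReal.rpow_mul]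
    norm_num
  have hκ : ENNReal.ofReal a ≤ kernelNorm P X H (ENNReal.ofReal (4 + δ)) :=
    hba.trans (indepKernelNorm_two_le hX hH (by
      rw [← ENNReal.ofReal_ofNat]
      exact ENNReal.ofReal_le_ofReal (by linarith)))
  have haK : a ≤ K := by
    have h1 : ENNReal.ofReal a ≤ ENNReal.ofReal K := by
      rw [eK]; exact hba.trans (indepKernelNorm_two_le hX hH (by norm_num))
    exact (ENNReal.ofReal_le_ofReal_iff ENNReal.toReal_nonneg).mp h1
  obtain ⟨hd1, hd2⟩ := decErr_le_of_four hβ hr ha hx0 hκ hd4.le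
  have hB : BoundedSample P X H m β (4 + δ) K (max b 0) G (x / a) (x ^ 2 / a ^ 2) (x ^ 2) η :=
    { toDegenerateSample := h
      four_le := hr
      K_nonneg := ENNReal.toReal_nonneg
      b_nonneg := le_max_right _ _
      G_nonneg := ENNReal.toReal_nonneg
      ε₁_nonneg := by positivity
      ε₂_nonneg := by positivity
      ε₄_nonneg := by positivity
      kernel_le := by rw [eK, ENNReal.ofReal_ofNat]
      indep_le := hbb.trans (ENNReal.ofReal_le_ofReal (le_max_left _ _))
      gam_le := eG.ge
      err₁_le := hd1
      err₂_le := hd2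
      err₄_le := hd4.le
      card_near_le := card_nearFin_le m
      η_le := maxNbhd_le_card m }
  set T := (N : ℝ) * η * x + √((η : ℝ) ^ 7 / N) * K ^ 2 + (η : ℝ) ^ 2 * G with hT
  have hK0 : 0 ≤ K := ENNReal.toReal_nonneg
  have hG0 : 0 ≤ G := ENNReal.toReal_nonneg
  have eT : ENNReal.ofReal T ≤ B₁ + B₂ + B₃ := by
    rw [hT, ENNReal.ofReal_add (by positivity) (by positivity),
      ENNReal.ofReal_add (by positivity) (by positivity), ENNReal.ofReal_mul (by positivity),
      ENNReal.ofReal_mul (by positivity), ENNReal.ofReal_mul (by positivity),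
      ENNReal.ofReal_mul (by positivity), ex, eG, ENNReal.ofReal_pow hK0, eK,
      ENNReal.ofReal_pow (by positivity), ENNReal.ofReal_natCast, ENNReal.ofReal_natCast, f₁, f₃]
    gcongr
    refine le_trans (le_of_eq ?_) f₂
    rw [Real.sqrt_eq_rpow, ← ENNReal.ofReal_rpow_of_nonneg (by positivity) (by norm_num),
      ENNReal.ofReal_div_of_pos hN0, ENNReal.ofReal_pow (by positivity), ENNReal.ofReal_natCast,
      ENNReal.ofReal_natCast]
  have hT1 : T ≤ 1 := ENNReal.ofReal_le_one.mp (eT.trans hbig.le)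
  refine wassersteinDist_le hX hH fun g hg => ?_
  calc _ ≤ ENNReal.ofReal (C * T) := ENNReal.ofReal_le_ofReal
        (hC ι X H m β (4 + δ) K G x T η hB hs hη1 haK hx0 hT hT1 g hg)
    _ = ENNReal.ofReal C * ENNReal.ofReal T := ENNReal.ofReal_mul hC0.le
    _ ≤ _ := by
      gcongr
      exact le_max_left _ _

end DegenerateUStat

end

theorem mainTheorem1 {Ω : Type*} [MeasurableSpace Ω] (P : Measure Ω) [IsProbabilityMeasure P]
    {d : ℕ} {I : ℕ → Type*} [∀ n, Fintype (I n)] [∀ n, EMetricSpace (I n)]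
    (hcard : ∀ n, Fintype.card (I n) = n)
    -- distinct nodes are at distance at least one
    (hsep : ∀ n, ∀ i j : I n, i ≠ j → 1 ≤ edist i j)
    (X : ∀ n, I n → Ω → EuclideanSpace ℝ (Fin d)) (hX : ∀ n i, Measurable (X n i))
    -- symmetric measurable kernels, square integrable at independent copies, degenerate
    (H : ℕ → EuclideanSpace ℝ (Fin d) → EuclideanSpace ℝ (Fin d) → ℝ)
    (hmeas : ∀ n, Measurable (Function.uncurry (H n)))
    (hsymm : ∀ n x y, H n x y = H n y x)
    (hsq : ∀ n, ∀ i j : I n, i ≠ j →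
      MemLp (Function.uncurry (H n)) 2 (DegenerateUStat.indepPair P (X n) i j))
    (hdeg : ∀ n, DegenerateUStat.IsDegenerate P (X n) (H n))
    -- the second moments at independent copies are bounded away from zero and infinity
    {a b : ℝ} (ha : 0 < a)
    (hnorm : ∀ᶠ n in atTop,
      ENNReal.ofReal a ≤ DegenerateUStat.indepKernelNorm P (X n) (H n) 2 ∧
        DegenerateUStat.indepKernelNorm P (X n) (H n) 2 ≤ ENNReal.ofReal b)
    -- the standard deviation is of exact order `n`
    (hs : (fun n => DegenerateUStat.sdev P (X n) (H n)) =Θ[atTop] (fun n : ℕ => (n : ℝ)))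
    (m : ℕ → ℝ) (hm : ∀ n, 0 < m n) (δ : ℝ) (hδ : 0 < δ) :
    ∃ C : ℝ, 0 < C ∧ ∀ᶠ n : ℕ in atTop,
      DegenerateUStat.wassersteinDist
          (P.map (DegenerateUStat.stdUStat P (X n) (H n))) (gaussianReal 0 1) ≤
        ENNReal.ofReal C *
          (((n : ℝ≥0∞) ^ 2 * (DegenerateUStat.maxNbhd (I n) (m n) : ℝ≥0∞) ^ 2
                * DegenerateUStat.kernelNorm P (X n) (H n) (ENNReal.ofReal (4 + δ)) ^ 4
                * DegenerateUStat.arrayBeta P X 2 ⊤ (m n) ^ (δ / (4 + δ))) ^ (1 / 2 : ℝ)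
            + (((DegenerateUStat.maxNbhd (I n) (m n) : ℝ≥0∞) ^ 7
                  + (DegenerateUStat.maxNbhd (I n) (4 * m n) : ℝ≥0∞) ^ 3) / (n : ℝ≥0∞)
                * DegenerateUStat.kernelNorm P (X n) (H n) 4 ^ 4) ^ (1 / 2 : ℝ)
            + ((DegenerateUStat.maxNbhd (I n) (m n) : ℝ≥0∞) ^ 4
                * DegenerateUStat.gamNorm P (X n) (H n) (m n) 2 ^ 2) ^ (1 / 2 : ℝ)) := by
  -- This half of the order condition bounds n by κ times the standard deviation, which is the lower
  -- bound with constant κ⁻¹ passed to the one-sample result.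
  obtain ⟨κ, hκ0, hκ⟩ := hs.2.exists_pos
  obtain ⟨C, hC0, hC⟩ := DegenerateUStat.exists_const_sample P d (a := a) (b := b) (c := κ⁻¹)
    (δ := δ) ha (inv_pos.mpr hκ0) hδ
  refine ⟨C, hC0, ?_⟩
  filter_upwards [hnorm, hκ.bound, eventually_gt_atTop 0] with n hn hsn hn0
  have hmix : DegenerateUStat.sampleBeta P (X n) 2 ⊤ (m n)
      ≤ DegenerateUStat.arrayBeta P X 2 ⊤ (m n) :=
    le_iSup (fun k => DegenerateUStat.sampleBeta P (X k) 2 ⊤ (m n)) n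
  have hsample : DegenerateUStat.DegenerateSample P (X n) (H n) (m n)
      (DegenerateUStat.arrayBeta P X 2 ⊤ (m n)) :=
    { measX := hX n
      measH := hmeas n
      symm := hsymm n
      deg := hdeg n
      mix := fun s t hs hst => (DegenerateUStat.betaCoeff_le_sampleBeta s t hs hst).trans hmix }
  have hβ : DegenerateUStat.arrayBeta P X 2 ⊤ (m n) ≤ 1 :=
    iSup_le fun k => DegenerateUStat.sampleBeta_le_one (hX k) _ _ _
  have hsd : κ⁻¹ * Fintype.card (I n) ≤ DegenerateUStat.sdev P (X n) (H n) := by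
    rw [hcard, inv_mul_le_iff₀ hκ0]
    simpa [abs_of_nonneg (Real.sqrt_nonneg _), DegenerateUStat.sdev] using hsn
  have := hC (I n) (X n) (H n) (m n) _ (DegenerateUStat.maxNbhd (I n) (4 * m n)) hsample hβ
    (by rw [hcard]; exact hn0) hn.1 hn.2 hsd
  rwa [hcard] at this
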